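/- Let $m,N\ge 0$ be integers, $m$ even and $N$ odd. All vector spaces are over $\mathbb{Q}$. **Graphs.** Consider finite connected graphs (loops and multiple edges allowed) with a non-empty set of external vertices, all of valence $1$, and a set of internal vertices, all of valence $\ge 3$. The orientation set of a graph consists of its external vertices (of degree $-m$), its internal vertices (of degree $-N$) and its edges (of degree $N-1$); the total degree of the graph is the sum of these degrees. An orientation is an ordering of the orientation set together with a direction of every edge. Let $\mathcal{E}$ be the vector space spanned by isomorphism classes of oriented graphs modulo the relations: reversing the direction of an edge multiplies the graph by $(-1)^N$, and permuting the orientation set multiplies it by the Koszul sign of the permutation. The differential $\partial$ of $\mathcal E$ sends a graph to the sum of all expansions of its internal vertices: a vertex is replaced by an edge, and the half-edges at it are distributed among the two ends of this edge (an unordered splitting) so that both ends have valence $\ge 3$; the new vertex and the new edge are put as the first and the second element of the orientation set, and the new edge is directed from the old vertex to the new one. **Two-loop hairy graphs.** An edge is tree-type if its removal disconnects the graph and exactly one of the two components is a tree. The frame is the subgraph generated by the edges that are not tree-type. A tree-type edge is a hair if one of its vertices is univalent and the other one lies on the frame and has no other tree-type edge adjacent to it. A graph of first Betti number $2$ is called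 a two-loop hairy graph if no vertex of its frame is a cut vertex of the frame (a point whose removal disconnects the frame as a topological space) and all its tree-type edges are hairs. The Hodge degree of a graph is its number of external vertices, and its defect is $\sum_v(|v|-3)$, where $v$ runs over the internal vertices and $|v|$ is the valence. Let $\mathcal{C}_i^{(k)}\subset\mathcal E$ be the span of the two-loop hairy graphs of defect $i$ and Hodge degree $k$. **Theorem.** The spaces $\mathcal C_i^{(k)}$ are finite-dimensional, and $\partial$ makes them, for each $k$, into a complex $$0\to\mathcal C_2^{(k)}\xrightarrow{\partial}\mathcal C_1^{(k)}\xrightarrow{\partial}\mathcal C_0^{(k)}\to 0 .$$ Let $a_k$ and $b_k$ be the dimensions of its homology in defect $0$ and in defect $1$, respectively, and let $\chi_k=\sum_{i=0}^{2}(-1)^{d_{i,k}}\dim\mathcal C_i^{(k)}$ be its Euler characteristic, where $d_{i,k}=k(N-m-2)+N-3+i$ is the total degree of the graphs in $\mathcal C_i^{(k)}$. Then $h_0(t)=\sum_{k\ge1}a_kt^k$, $h_1(t)=\sum_{k\ge1}b_kt^k$ and $\chi(t)=\sum_{k\ge1}\chi_kt^k$ are $$h_0(t)=\frac{t^3+t^{11}+t^{14}-t^{15}}{(1-t^4)(1-t^{12})},\qquad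 h_1(t)=\frac{t+t^{16}}{(1-t^4)(1-t^{12})},\qquad \chi(t)=\frac{t-t^{11}-t^{13}+t^{14}}{(1+t^2)(1-t^{12})}.$$ -/

import Mathlib

open scoped PowerSeries

noncomputable section

namespace HairyGraph

/-- A finite graph (loops and multiple edges allowed) with external and internal vertices, together
with orientation data.  Edge `j` runs from `endpt j false` to `endpt j true`, and the pair `(j, b)`
is the half-edge of `j` at `endpt j b`.  The orientation set consists of all external vertices,
all internal vertices and all edges; it is ordered by the injective function `rank`. -/
structure OGraph where
  numExt : ℕ
  numInt : ℕ
  numEdge : ℕ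
  endpt : Fin numEdge → Bool → Fin numExt ⊕ Fin numInt
  rank : (Fin numExt ⊕ Fin numInt) ⊕ Fin numEdge → ℕ
  rank_injective : Function.Injective rank

namespace OGraph

/-- Vertices: external or internal. -/
abbrev Vert (G : OGraph) : Type := Fin G.numExt ⊕ Fin G.numInt

abbrev Edge (G : OGraph) : Type := Fin G.numEdge

abbrev HalfEdge (G : OGraph) : Type := G.Edge × Bool

/-- The orientation set. -/
abbrev Elt (G : OGraph) : Type := G.Vert ⊕ G.Edge

/-- Degrees in the orientation set: external vertices have degree `-m`, internal vertices `-N`,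
edges `N - 1`. -/
def deg (m N : ℕ) (G : OGraph) : G.Elt → ℤ :=
  Sum.elim (Sum.elim (fun _ => -(m : ℤ)) (fun _ => -(N : ℤ))) (fun _ => (N : ℤ) - 1)

/-- The total degree of a graph. -/
def totalDegree (m N : ℕ) (G : OGraph) : ℤ := ∑ a : G.Elt, G.deg m N a

/-- The half-edges at a vertex. -/
def halfEdgesAt (G : OGraph) (u : G.Vert) : Finset G.HalfEdge :=
  Finset.univ.filter fun h => G.endpt h.1 h.2 = u

def valence (G : OGraph) (u : G.Vert) : ℕ := (G.halfEdgesAt u).card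

/-! ### Isomorphisms and orientation relations -/

/-- An isomorphism of the underlying unoriented graphs; `flip j` records whether the edge `j` is
mapped with its direction reversed (for a loop both values are possible). -/
structure Iso (G G' : OGraph) where
  ext : Fin G.numExt ≃ Fin G'.numExt
  int : Fin G.numInt ≃ Fin G'.numInt
  edge : G.Edge ≃ G'.Edge
  flip : G.Edge → Bool
  endpt_eq : ∀ j b, G'.endpt (edge j) (xor (flip j) b) = Sum.map ext int (G.endpt j b)

/-- The bijection of orientation sets induced by an isomorphism. -/
def Iso.elt {G G' : OGraph} (f : Iso G G') : G.Elt ≃ G'.Elt :=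
  Equiv.sumCongr (Equiv.sumCongr f.ext f.int) f.edge

/-- The Koszul sign of the reordering of the orientation set: each pair of elements whose order is
reversed contributes `(-1) ^ (product of their degrees)`. -/
def Iso.koszulSign (m N : ℕ) {G G' : OGraph} (f : Iso G G') : ℤˣ :=
  ∏ a : G.Elt, ∏ b : G.Elt,
    if G.rank a < G.rank b ∧ G'.rank (f.elt b) < G'.rank (f.elt a)
    then (G.deg m N a * G.deg m N b).negOnePow else 1

/-- The sign of an isomorphism: the Koszul sign times `(-1) ^ N` for each reversed edge. -/
def Iso.sign (m N : ℕ) {G G' : OGraph} (f : Iso G G') : ℤˣ :=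
  (∏ j : G.Edge, if f.flip j then (N : ℤ).negOnePow else 1) * f.koszulSign m N

/-- The orientation relations: isomorphic graphs are equal up to the sign of the isomorphism.
Isomorphisms preserving all orientation data, isomorphisms that only reverse an edge, and those that
only change the order of the orientation set are all included. -/
def orientRel (m N : ℕ) : Submodule ℚ (OGraph →₀ ℚ) :=
  Submodule.span ℚ {z | ∃ (G G' : OGraph) (f : Iso G G'),
    z = Finsupp.single G 1 - ((f.sign m N : ℤ) : ℚ) • Finsupp.single G' 1}

/-- The rational vector space of oriented graphs modulo the orientation relations. -/
abbrev Space (m N : ℕ) : Type := (OGraph →₀ ℚ) ⧸ orientRel m N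

/-- The class of an oriented graph. -/
def cls (m N : ℕ) (G : OGraph) : Space m N := (orientRel m N).mkQ (Finsupp.single G 1)

/-! ### The differential -/

/-- Expansion of the internal vertex `x`: a new internal vertex `0` and a new edge `0` running from
`x` to it are added, as the first and the second element of the orientation set, and the half-edges
in `S` are attached to the new vertex. -/
def expand (G : OGraph) (x : Fin G.numInt) (S : Finset G.HalfEdge) : OGraph where
  numExt := G.numExt
  numInt := G.numInt + 1
  numEdge := G.numEdge + 1
  endpt := Fin.cases (fun b => if b then Sum.inr 0 else Sum.inr x.succ)
    (fun j b => if (j, b) ∈ S then Sum.inr 0 else Sum.map id Fin.succ (G.endpt j b))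
  rank := Sum.elim
    (Sum.elim (fun a => G.rank (Sum.inl (Sum.inl a)) + 2)
      (Fin.cases 0 fun y => G.rank (Sum.inl (Sum.inr y)) + 2))
    (Fin.cases 1 fun j => G.rank (Sum.inr j) + 2)
  rank_injective := by
    have key := G.rank_injective
    rintro ((a | a) | a) ((b | b) | b) h
    · simpa using key (Nat.add_right_cancel h)
    · induction b using Fin.cases with
      | zero => simp at h
      | succ b => simpa using key (Nat.add_right_cancel h)
    · induction b using Fin.cases with
      | zero => simp at h
      | succ b => simpa using key (Nat.add_right_cancel h)
    · induction a using Fin.cases with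
      | zero => simp at h
      | succ a => simpa using key (Nat.add_right_cancel h)
    · induction a using Fin.cases with
      | zero =>
        induction b using Fin.cases with
        | zero => rfl
        | succ b => simp at h
      | succ a =>
        induction b using Fin.cases with
        | zero => simp at h
        | succ b => simpa using key (Nat.add_right_cancel h)
    · induction a using Fin.cases with
      | zero =>
        induction b using Fin.cases with
        | zero => simp at h
        | succ b => simp at h
      | succ a =>
        induction b using Fin.cases with
        | zero => simp at h
        | succ b => simpa using key (Nat.add_right_cancel h)
    · induction a using Fin.cases with
      | zero => simp at h
      | succ a => simpa using key (Nat.add_right_cancel h)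
    · induction a using Fin.cases with
      | zero =>
        induction b using Fin.cases with
        | zero => simp at h
        | succ b => simp at h
      | succ a =>
        induction b using Fin.cases with
        | zero => simp at h
        | succ b => simpa using key (Nat.add_right_cancel h)
    · induction a using Fin.cases with
      | zero =>
        induction b using Fin.cases with
        | zero => rfl
        | succ b => simp at h
      | succ a =>
        induction b using Fin.cases with
        | zero => simp at h
        | succ b => simpa using key (Nat.add_right_cancel h)

/-- The sets of half-edges at `x` that may be moved to the new vertex, so that both vertices of the
new edge have valence at least three. -/
def splittings (G : OGraph) (x : Fin G.numInt) : Finset (Finset G.HalfEdge) :=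
  (G.halfEdgesAt (Sum.inr x)).powerset.filter fun S =>
    2 ≤ S.card ∧ 2 ≤ (G.halfEdgesAt (Sum.inr x) \ S).card

/-- The sum of all expansions of all internal vertices.  A set of half-edges and its complement at
`x` describe the same (unordered) expansion, whence the factor `1 / 2`. -/
def bdry (G : OGraph) : OGraph →₀ ℚ :=
  (1 / 2 : ℚ) • ∑ x : Fin G.numInt, ∑ S ∈ G.splittings x, Finsupp.single (G.expand x S) 1

namespace Iso

variable {G G' : OGraph} (f : Iso G G')

/-- The bijection of half-edges induced by an isomorphism. -/
def half : G.HalfEdge ≃ G'.HalfEdge where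
  toFun h := (f.edge h.1, xor (f.flip h.1) h.2)
  invFun h := (f.edge.symm h.1, xor (f.flip (f.edge.symm h.1)) h.2)
  left_inv h := by simp
  right_inv h := by simp

theorem mem_halfEdgesAt (u : G.Vert) (h : G.HalfEdge) :
    f.half h ∈ G'.halfEdgesAt (Sum.map f.ext f.int u) ↔ h ∈ G.halfEdgesAt u := by
  have hinj : Function.Injective (Sum.map f.ext f.int) :=
    f.ext.injective.sumMap f.int.injective
  simp [halfEdgesAt, half, f.endpt_eq, hinj.eq_iff]

theorem map_halfEdgesAt (x : Fin G.numInt) :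
    (G.halfEdgesAt (Sum.inr x)).map f.half.toEmbedding
      = G'.halfEdgesAt (Sum.inr (f.int x)) := by
  ext h
  obtain ⟨h, rfl⟩ := f.half.surjective h
  have := f.mem_halfEdgesAt (Sum.inr x) h
  simpa using this.symm

theorem mem_splittings (x : Fin G.numInt) (S : Finset G.HalfEdge) :
    S ∈ G.splittings x ↔ S.map f.half.toEmbedding ∈ G'.splittings (f.int x) := by
  simp only [splittings, Finset.mem_filter, Finset.mem_powerset, ← f.map_halfEdgesAt,
    Finset.map_subset_map, Finset.card_map, ← Finset.map_sdiff]

/-- The extension of a bijection by `0 ↦ 0`. -/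
def succEquiv {p q : ℕ} (e : Fin p ≃ Fin q) : Fin (p + 1) ≃ Fin (q + 1) where
  toFun := Fin.cases 0 fun y => (e y).succ
  invFun := Fin.cases 0 fun y => (e.symm y).succ
  left_inv y := by induction y using Fin.cases <;> simp
  right_inv y := by induction y using Fin.cases <;> simp

/-- The extension of an isomorphism to an expansion. -/
def expand (x : Fin G.numInt) (S : Finset G.HalfEdge) :
    Iso (G.expand x S) (G'.expand (f.int x) (S.map f.half.toEmbedding)) where
  ext := f.ext
  int := succEquiv f.int
  edge := succEquiv f.edge
  flip := Fin.cases false f.flip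
  endpt_eq := by
    intro j b
    change Fin (G.numEdge + 1) at j
    induction j using Fin.cases with
    | zero => cases b <;> rfl
    | succ j =>
      have hm : ((f.edge j, xor (f.flip j) b) ∈ S.map f.half.toEmbedding) ↔ (j, b) ∈ S := by
        have : (f.edge j, xor (f.flip j) b) = f.half.toEmbedding (j, b) := rfl
        rw [this, Finset.mem_map']
      change (if (f.edge j, xor (f.flip j) b) ∈ S.map f.half.toEmbedding then Sum.inr 0
          else Sum.map id Fin.succ (G'.endpt (f.edge j) (xor (f.flip j) b)))
        = Sum.map f.ext (succEquiv f.int)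
          (if (j, b) ∈ S then Sum.inr 0 else Sum.map id Fin.succ (G.endpt j b))
      rw [f.endpt_eq]
      by_cases hS : (j, b) ∈ S
      · rw [if_pos (hm.2 hS), if_pos hS]
        rfl
      · rw [if_neg (fun h => hS (hm.1 h)), if_neg hS]
        rcases G.endpt j b with a | a <;> rfl

/-- The new vertex in the orientation set of an expansion. -/
def newVert (G : OGraph) (x : Fin G.numInt) (S : Finset G.HalfEdge) : (G.expand x S).Elt :=
  Sum.inl (Sum.inr (0 : Fin (G.numInt + 1)))

/-- The new edge in the orientation set of an expansion. -/
def newEdge (G : OGraph) (x : Fin G.numInt) (S : Finset G.HalfEdge) : (G.expand x S).Elt :=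
  Sum.inr (0 : Fin (G.numEdge + 1))

/-- The old elements in the orientation set of an expansion. -/
def oldElt (G : OGraph) (x : Fin G.numInt) (S : Finset G.HalfEdge) (a : G.Elt) :
    (G.expand x S).Elt :=
  (Sum.map (Sum.map id Fin.succ) Fin.succ a : (Fin _ ⊕ Fin (G.numInt + 1)) ⊕ Fin (G.numEdge + 1))

theorem prod_expand (x : Fin G.numInt) (S : Finset G.HalfEdge) (F : (G.expand x S).Elt → ℤˣ) :
    ∏ a, F a = F (newVert G x S) * F (newEdge G x S) * ∏ a : G.Elt, F (oldElt G x S a) := by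
  have key : ∀ F : (Fin G.numExt ⊕ Fin (G.numInt + 1)) ⊕ Fin (G.numEdge + 1) → ℤˣ,
      ∏ a, F a = F (Sum.inl (Sum.inr 0)) * F (Sum.inr 0) *
        ∏ a : G.Elt, F (Sum.map (Sum.map id Fin.succ) Fin.succ a) := by
    intro F
    simp only [Fintype.prod_sum_type, Fin.prod_univ_succ, Sum.map_inl, Sum.map_inr, id]
    simp only [mul_assoc, mul_left_comm]
  exact key F

theorem sign_expand (m N : ℕ) (x : Fin G.numInt) (S : Finset G.HalfEdge) :
    (f.expand x S).sign m N = f.sign m N := by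
  have hrank : ∀ (K : OGraph) (y : Fin K.numInt) (T : Finset K.HalfEdge) (a : K.Elt),
      (K.expand y T).rank (oldElt K y T a) = K.rank a + 2 := by
    rintro K y T ((a | a) | a) <;> rfl
  have hdeg : ∀ a : G.Elt, (G.expand x S).deg m N (oldElt G x S a) = G.deg m N a := by
    rintro ((a | a) | a) <;> rfl
  have helt : ∀ a : G.Elt, (f.expand x S).elt (oldElt G x S a) = oldElt G' _ _ (f.elt a) := by
    rintro ((a | a) | a) <;> rfl
  have h0 : ∀ (K : OGraph) (y : Fin K.numInt) (T : Finset K.HalfEdge),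
      (K.expand y T).rank (newVert K y T) = 0 := fun _ _ _ => rfl
  have h1 : ∀ (K : OGraph) (y : Fin K.numInt) (T : Finset K.HalfEdge),
      (K.expand y T).rank (newEdge K y T) = 1 := fun _ _ _ => rfl
  have he0 : (f.expand x S).elt (newVert G x S) = newVert G' _ _ := rfl
  have he1 : (f.expand x S).elt (newEdge G x S) = newEdge G' _ _ := rfl
  have hflip : (∏ j, if (f.expand x S).flip j then (N : ℤ).negOnePow else 1)
      = ∏ j, if f.flip j then (N : ℤ).negOnePow else 1 := by
    refine (Fin.prod_univ_succ
      (fun j : Fin (G.numEdge + 1) => if (f.expand x S).flip j then _ else 1)).trans ?_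
    change (if false = true then _ else (1 : ℤˣ)) * _ = _
    simp only [Bool.false_eq_true, if_false, one_mul]
    rfl
  unfold sign koszulSign
  rw [hflip]
  congr 1
  simp only [prod_expand, he0, he1, h0, h1, hrank, helt, hdeg]
  simp

end Iso

/-- The differential respects the orientation relations. -/
theorem bdry_rel (m N : ℕ) {G G' : OGraph} (f : Iso G G') :
    G.bdry - ((f.sign m N : ℤ) : ℚ) • G'.bdry ∈ orientRel m N := by
  have h : G'.bdry = (1 / 2 : ℚ) • ∑ x : Fin G.numInt, ∑ S ∈ G.splittings x,
      Finsupp.single (G'.expand (f.int x) (S.map f.half.toEmbedding)) 1 := by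
    unfold bdry
    congr 1
    refine (Fintype.sum_equiv f.int _ _ fun x => ?_).symm
    refine Finset.sum_equiv f.half.finsetCongr (fun S => ?_) (fun S _ => ?_)
    · simpa using f.mem_splittings x S
    · simp
  rw [h, bdry, smul_comm, ← smul_sub, Finset.smul_sum, ← Finset.sum_sub_distrib]
  refine Submodule.smul_mem _ _ (Submodule.sum_mem _ fun x _ => ?_)
  rw [Finset.smul_sum, ← Finset.sum_sub_distrib]
  refine Submodule.sum_mem _ fun S _ => Submodule.subset_span ⟨_, _, f.expand x S, ?_⟩
  rw [f.sign_expand]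

/-- The differential on oriented graphs modulo orientation relations. -/
def diff (m N : ℕ) : Space m N →ₗ[ℚ] Space m N :=
  (orientRel m N).mapQ (orientRel m N) (Finsupp.linearCombination ℚ bdry) (by
    conv_lhs => rw [orientRel]
    rw [Submodule.span_le]
    rintro _ ⟨G, G', f, rfl⟩
    have h := bdry_rel m N f
    rw [SetLike.mem_coe, Submodule.mem_comap, map_sub, map_smul,
      Finsupp.linearCombination_single, Finsupp.linearCombination_single, one_smul, one_smul]
    exact h)

theorem diff_cls (m N : ℕ) (G : OGraph) :
    diff m N (cls m N G) = (orientRel m N).mkQ G.bdry := by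
  simp [diff, cls]

/-! ### Uni-≥3-valent graphs and hairy graphs -/

/-- Two vertices are joined by an edge belonging to `F`. -/
def Step (G : OGraph) (F : Set G.Edge) (u w : G.Vert) : Prop :=
  ∃ j ∈ F, ∃ b, G.endpt j b = u ∧ G.endpt j (!b) = w

/-- Two vertices are joined by a path of edges belonging to `F`. -/
def Joined (G : OGraph) (F : Set G.Edge) : G.Vert → G.Vert → Prop :=
  Relation.ReflTransGen (G.Step F)

/-- Connected graphs with a non-empty set of external vertices, all of valence one, whose internal
vertices have valence at least three. -/
structure IsUniThreeValent (G : OGraph) : Prop where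
  ext_nonempty : 0 < G.numExt
  connected : ∀ u w, G.Joined Set.univ u w
  valence_ext : ∀ a, G.valence (Sum.inl a) = 1
  valence_int : ∀ x, 3 ≤ G.valence (Sum.inr x)

/-- The defect `∑ (|v| - 3)`, over the internal vertices `v`. -/
def defect (G : OGraph) : ℤ := ∑ x : Fin G.numInt, ((G.valence (Sum.inr x) : ℤ) - 3)

/-- The first Betti number of a connected graph. -/
def loops (G : OGraph) : ℤ := (G.numEdge : ℤ) - (G.numExt + G.numInt : ℕ) + 1

/-- The connected component of the end `(j, b)` in the graph with the (open) edge `j` removed. -/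
def side (G : OGraph) (j : G.Edge) (b : Bool) : Set G.Vert :=
  {u | G.Joined {j}ᶜ (G.endpt j b) u}

/-- The component `side j b` is a tree: it has one edge less than it has vertices. -/
def SideIsTree (G : OGraph) (j : G.Edge) (b : Bool) : Prop :=
  {i : G.Edge | i ≠ j ∧ G.endpt i false ∈ G.side j b}.ncard + 1 = (G.side j b).ncard

/-- An edge of a connected graph is tree-type if its removal disconnects the graph and exactly one
of the two resulting components is a tree. -/
def IsTreeType (G : OGraph) (j : G.Edge) : Prop :=
  G.endpt j true ∉ G.side j false ∧ Xor (G.SideIsTree j false) (G.SideIsTree j true)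

/-- The edges of the frame, which is the subgraph generated by the edges not of tree type. -/
def frameEdges (G : OGraph) : Set G.Edge := {j | ¬ G.IsTreeType j}

/-- The vertex `u` is an end of the edge `j`. -/
def Incident (G : OGraph) (j : G.Edge) (u : G.Vert) : Prop := ∃ b, G.endpt j b = u

/-- The vertices of the frame. -/
def frameVerts (G : OGraph) : Set G.Vert := {u | ∃ j ∈ G.frameEdges, G.Incident j u}

/-- A tree-type edge is a hair if one of its vertices is univalent, and the other one belongs to the
frame and has no other tree-type edges adjacent to it. -/
def IsHair (G : OGraph) (j : G.Edge) : Prop :=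
  G.IsTreeType j ∧ ∃ b, G.valence (G.endpt j b) = 1 ∧ G.endpt j (!b) ∈ G.frameVerts ∧
    ∀ i, G.IsTreeType i → G.Incident i (G.endpt j (!b)) → i = j

/-- A vertex `u` is a cut vertex of the frame if removing the point `u` from the frame, as a
topological space, disconnects it.  Every other vertex of the frame lies on an edge of the frame, so
this says that two (open) edges of the frame are not linked by a chain of edges of the frame in
which consecutive edges share a vertex different from `u`.  In particular, a vertex with a loop
and at least one other edge is a cut vertex. -/
def IsFrameCut (G : OGraph) (u : G.Vert) : Prop :=
  u ∈ G.frameVerts ∧ ∃ i ∈ G.frameEdges, ∃ j ∈ G.frameEdges, ¬ Relation.ReflTransGen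
    (fun p q => q ∈ G.frameEdges ∧ ∃ w, w ≠ u ∧ G.Incident p w ∧ G.Incident q w) i j

/-- The frame has no cut vertices, and all tree-type edges are hairs. -/
structure IsHairy (G : OGraph) : Prop where
  no_cut : ∀ u, ¬ G.IsFrameCut u
  hair : ∀ j, G.IsTreeType j → G.IsHair j

/-- Two-loop hairy graphs. -/
structure IsTwoLoopHairy (G : OGraph) : Prop where
  uni : G.IsUniThreeValent
  two_loop : G.loops = 2
  hairy : G.IsHairy

end OGraph

open OGraph

/-! ### The two-loop part of the hairy graph-complex -/

/-- The space spanned by the two-loop hairy graphs of defect `i` and Hodge degree `k` (that is, with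
`k` external vertices). -/
def chains (m N i k : ℕ) : Submodule ℚ (Space m N) :=
  Submodule.span ℚ {z | ∃ G : OGraph, G.IsTwoLoopHairy ∧ G.defect = i ∧ G.numExt = k ∧
    z = cls m N G}

def cycles (m N i k : ℕ) : Submodule ℚ (Space m N) :=
  chains m N i k ⊓ LinearMap.ker (diff m N)

/-- The differential lowers the defect by one and preserves the Hodge degree. -/
def boundaries (m N i k : ℕ) : Submodule ℚ (Space m N) :=
  (chains m N (i + 1) k).map (diff m N)

/-- The homology of defect `i` in Hodge degree `k`. -/
abbrev Homology (m N i k : ℕ) : Type :=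
  cycles m N i k ⧸ (boundaries m N i k).submoduleOf (cycles m N i k)

/-- The total degree of the two-loop graphs of defect `i` and Hodge degree `k`
(see `totalDegree_eq`). -/
def chainDegree (m N i k : ℕ) : ℤ := (k : ℤ) * ((N : ℤ) - m - 2) + N - 3 + i

theorem totalDegree_eq (m N i k : ℕ) (G : OGraph) (hG : G.IsTwoLoopHairy)
    (hi : G.defect = i) (hk : G.numExt = k) : G.totalDegree m N = chainDegree m N i k := by
  have h2 := hG.two_loop
  have hsum : ∑ u : G.Vert, G.valence u = 2 * G.numEdge := by
    have := Finset.card_eq_sum_card_fiberwise (s := (Finset.univ : Finset G.HalfEdge))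
      (t := (Finset.univ : Finset G.Vert)) (f := fun h => G.endpt h.1 h.2) (by simp)
    rw [Finset.card_univ] at this
    simp only [Fintype.card_prod, Fintype.card_fin, Fintype.card_bool] at this
    rw [mul_comm, this]
    rfl
  rw [Fintype.sum_sum_type] at hsum
  simp only [hG.uni.valence_ext, Finset.sum_const, Finset.card_univ, Fintype.card_fin,
    smul_eq_mul, mul_one] at hsum
  simp only [OGraph.defect, Finset.sum_sub_distrib, Finset.sum_const, Finset.card_univ,
    Fintype.card_fin, nsmul_eq_mul] at hi
  simp only [OGraph.loops] at h2
  simp only [OGraph.totalDegree, OGraph.deg, Fintype.sum_sum_type, Sum.elim_inl, Sum.elim_inr,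
    Finset.sum_const, Finset.card_univ, Fintype.card_fin, nsmul_eq_mul, chainDegree]
  zify at hsum hk
  push_cast at h2 hsum
  have hv : (G.numInt : ℤ) = k + 2 - i := by linarith
  have he : (G.numEdge : ℤ) = 2 * k + 3 - i := by linarith
  rw [hv, he, hk]
  ring

/-- The Euler characteristic, with respect to the total degree, of the complex of two-loop hairy
graphs of Hodge degree `k` (the defect is at most two). -/
def eulerChar (m N k : ℕ) : ℤ :=
  ∑ i ∈ Finset.range 3,
    ((chainDegree m N i k).negOnePow : ℤ) * (Module.finrank ℚ (chains m N i k) : ℤ)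

/-- The generating function of the dimensions of the homology of defect `i`.  The coefficient at
`k = 0` vanishes since graphs have external vertices. -/
def homologySeries (m N i : ℕ) : ℚ⟦X⟧ :=
  PowerSeries.mk fun k => (Module.finrank ℚ (Homology m N i k) : ℚ)

/-- The generating function of the Euler characteristics. -/
def eulerSeries (m N : ℕ) : ℚ⟦X⟧ := PowerSeries.mk fun k => (eulerChar m N k : ℚ)

end HairyGraph

end

open scoped PowerSeries

noncomputable section

namespace HairyGraph

/-! ### Signs of reorderings -/

/-! For even `m` and odd `N` the external vertices and the edges are even elements of the
orientation set, so signs arise only from the order of the internal vertices and from reversed edges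
(`Iso.sign_eq`).

The frame of a two-loop hairy graph has first Betti number two and no cut vertex, hence is a theta
graph: two trivalent vertices joined by three subdivided arcs (`exists_theta`). A bivalent vertex of
the frame carries exactly one hair, a trivalent one at most one. So the graph is determined by the
numbers `(a, b, c)` of hairs inside the arcs and two flags (`exists_iso_theta`), and its defect
counts the hairs at the two trivalent vertices. All isomorphisms come from permutations of the arcs,
where exchanging neighbours costs `(-1)^(a*b)`, and from the reflection, which costs `(-1)^(tri a +
tri b + tri c)` with `tri a = a*(a+1)/2`. Expanding a trivalent vertex of the frame that bears a
hair pushes this hair onto one of the three arcs; hence the differential is a signed sum over the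
arcs (`diff_gen1`, `diff_gen2`).

The computation is done on the dual side. Functionals on the chains are functions of `(a, b, c)`
that are equivariant under permutations with Koszul signs (`exists_functional_gen`). In defects zero
and two the reflection is an automorphism and confines the support to triples with `tri a + tri b +
tri c` even; in defect one it only moves the hair to the other vertex and imposes nothing. The dual
differential is `addDual`, up to reflection signs and a factor two. It is onto on equivariant
functions: the equation can be solved recursively in the first argument, and the solution can be
symmetrised (`exists_addDual`). Therefore the differential is injective in defect two
(`cycles_two`), and the homology in defect one follows from that in defect zero and the dimensions
of the chains (`finrank_homology_one`). The homology in defect zero is dual to the kernel of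
`addDual` on the reflection-invariant functions (`finrank_homology_zero`).

For triples with sum `k`, reflection invariance prescribes the number of odd entries as `3 * k % 4`
(`evenTri_iff`). With zero or three odd entries, two of the three terms of the kernel equation have
the wrong parities, and the kernel vanishes for `k > 0`. With one or two odd entries, halving the
entries identifies the kernel with that of the unsigned operator on symmetric or on alternating
functions (`kerFn_three`, `kerFn_two`). The unsigned operator is onto as well, so the dimensions are
differences of numbers of partitions into at most three parts. The chains are counted by triples in
which the odd entries come first and are distinct. What remains is arithmetic and the comparison
with the linear recurrences given by the denominators. -/

/-- The sign of the bijection `e` with respect to the orders given by `r` and `r'`: each inversion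
contributes `-1`. -/
def invSign {α β : Type*} [Fintype α] (r : α → ℕ) (r' : β → ℕ) (e : α ≃ β) : ℤˣ :=
  ∏ x, ∏ y, if r x < r y ∧ r' (e y) < r' (e x) then -1 else 1

/-- Both sides are the product of the symmetric function `T` over unordered pairs of distinct
elements; the order only selects which of `(x, y)` and `(y, x)` represents a pair. -/
theorem prod_pairs_eq {α : Type*} [Fintype α] {r r' : α → ℕ} (hr : Function.Injective r)
    (hr' : Function.Injective r') (T : α → α → ℤˣ) (hT : ∀ x y, T x y = T y x) :
    (∏ x, ∏ y, if r x < r y then T x y else 1) = ∏ x, ∏ y, if r' x < r' y then T x y else 1 := by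
  classical
  rw [← Fintype.prod_prod_type', ← Fintype.prod_prod_type', ← Finset.prod_filter,
    ← Finset.prod_filter]
  refine Finset.prod_nbij' (fun p => if r' p.1 < r' p.2 then p else p.swap)
    (fun p => if r p.1 < r p.2 then p else p.swap) ?_ ?_ ?_ ?_ ?_
  · rintro ⟨x, y⟩ h
    simp only [Finset.mem_filter, Finset.mem_univ, true_and] at h ⊢
    have hne : r' x ≠ r' y := fun e => by rw [hr' e] at h; exact lt_irrefl _ h
    split_ifs with h'
    · exact h'
    · simp only [Prod.fst_swap, Prod.snd_swap]; omega
  · rintro ⟨x, y⟩ h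
    simp only [Finset.mem_filter, Finset.mem_univ, true_and] at h ⊢
    have hne : r x ≠ r y := fun e => by rw [hr e] at h; exact lt_irrefl _ h
    split_ifs with h'
    · exact h'
    · simp only [Prod.fst_swap, Prod.snd_swap]; omega
  · rintro ⟨x, y⟩ h
    simp only [Finset.mem_filter, Finset.mem_univ, true_and] at h ⊢
    split_ifs with h1 h2
    · rfl
    · simp only [Prod.fst_swap, Prod.snd_swap] at h2; omega
    · simp
  · rintro ⟨x, y⟩ h
    simp only [Finset.mem_filter, Finset.mem_univ, true_and] at h ⊢
    split_ifs with h1 h2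
    · rfl
    · simp only [Prod.fst_swap, Prod.snd_swap] at h2; omega
    · simp
  · rintro ⟨x, y⟩ h
    dsimp only
    split_ifs with h1
    · rfl
    · exact hT _ _

/-- The inner factor is now symmetric in `x` and `y`, as `prod_pairs_eq` requires. -/
theorem invSign_eq_pairs {α β : Type*} [Fintype α] {r : α → ℕ} {r' : β → ℕ}
    (hr' : Function.Injective r') (e : α ≃ β) :
    invSign r r' e = ∏ x, ∏ y, if r x < r y then
      (if (r x < r y ↔ r' (e x) < r' (e y)) then 1 else -1) else 1 := by
  unfold invSign
  refine Finset.prod_congr rfl fun x _ => Finset.prod_congr rfl fun y _ => ?_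
  by_cases h : r x < r y
  · have hne : r' (e x) ≠ r' (e y) := fun h' => by
      rw [e.injective (hr' h')] at h; exact lt_irrefl _ h
    have : r' (e y) < r' (e x) ↔ ¬ r' (e x) < r' (e y) := by omega
    simp only [h, true_and, if_true, true_iff, this, ite_not]
  · simp [h]

/-- A pair is inverted by the composite exactly if it is inverted by one of the two bijections but
not by both. To multiply the products factor by factor, the second one is reindexed along `e`. -/
theorem invSign_trans {α β γ : Type*} [Fintype α] [Fintype β] {r : α → ℕ} {r' : β → ℕ}
    {r'' : γ → ℕ} (hr : Function.Injective r) (hr' : Function.Injective r')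
    (hr'' : Function.Injective r'') (e : α ≃ β) (e' : β ≃ γ) :
    invSign r r'' (e.trans e') = invSign r r' e * invSign r' r'' e' := by
  rw [invSign_eq_pairs hr'', invSign_eq_pairs hr', invSign_eq_pairs hr'']
  have h2 : (∏ x, ∏ y, if r' x < r' y then
      (if (r' x < r' y ↔ r'' (e' x) < r'' (e' y)) then 1 else -1) else 1 : ℤˣ) =
      ∏ x, ∏ y, if r x < r y then
      (if (r' (e x) < r' (e y) ↔ r'' (e' (e x)) < r'' (e' (e y))) then 1 else -1) else 1 := by
    have hs : ∀ x y : β, (if (r' x < r' y ↔ r'' (e' x) < r'' (e' y)) then 1 else -1 : ℤˣ) =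
        if (r' y < r' x ↔ r'' (e' y) < r'' (e' x)) then 1 else -1 := by
      intro x y
      by_cases hxy : x = y
      · subst hxy; rfl
      · have h1 : r' x ≠ r' y := fun h => hxy (hr' h)
        have h2 : r'' (e' x) ≠ r'' (e' y) := fun h => hxy (e'.injective (hr'' h))
        congr 1
        apply propext
        omega
    -- The order on `β` is replaced by the one transported from `α`, so that both products run over
    -- the same pairs.
    rw [prod_pairs_eq (r := r') (r' := r ∘ e.symm) hr' (hr.comp e.symm.injective) _ hs]
    refine (Fintype.prod_equiv e _ _ fun x => Fintype.prod_equiv e _ _ fun y => ?_).symm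
    simp
  rw [h2, ← Finset.prod_mul_distrib]
  refine Finset.prod_congr rfl fun x _ => ?_
  rw [← Finset.prod_mul_distrib]
  refine Finset.prod_congr rfl fun y _ => ?_
  simp only [Equiv.trans_apply]
  by_cases h1 : r x < r y <;> by_cases h2 : r' (e x) < r' (e y) <;>
    by_cases h3 : r'' (e' (e x)) < r'' (e' (e y)) <;> simp [h1, h2, h3]

theorem invSign_eq_one {α β : Type*} [Fintype α] {r : α → ℕ} {r' : β → ℕ} {e : α ≃ β}
    (h : ∀ x y, r x < r y → r' (e x) ≤ r' (e y)) : invSign r r' e = 1 := by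
  refine Finset.prod_eq_one fun x _ => Finset.prod_eq_one fun y _ => ?_
  rw [if_neg]
  rintro ⟨h1, h2⟩
  have := h x y h1
  omega

theorem invSign_perm_fin {n : ℕ} (f : Equiv.Perm (Fin n)) :
    invSign Fin.val Fin.val f = Equiv.Perm.sign f := by
  rw [f.sign_eq_prod_prod_Iio, invSign, Finset.prod_comm]
  refine Finset.prod_congr rfl fun j _ => ?_
  have : Finset.Iio j = Finset.univ.filter fun i => i < j := by ext; simp
  rw [this, Finset.prod_filter]
  refine Finset.prod_congr rfl fun i _ => ?_
  by_cases h : i < j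
  · have hne : f i ≠ f j := fun h' => h.ne (f.injective h')
    rcases lt_or_gt_of_ne hne with h' | h'
    · simp [h, h', h'.not_gt]
    · simp [h, h', h'.not_gt]
  · simp [h]

/-- Conjugation with the increasing enumeration of `α`, which has no inversions, reduces this to
permutations of `Fin n`. -/
theorem invSign_perm {α : Type*} [Fintype α] [DecidableEq α] {r : α → ℕ}
    (hr : Function.Injective r) (f : Equiv.Perm α) : invSign r r f = Equiv.Perm.sign f := by
  let : LinearOrder α := LinearOrder.lift' r hr
  let e : Fin (Fintype.card α) ≃o α := Fintype.orderIsoFinOfCardEq α rfl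
  have he : invSign Fin.val r e.toEquiv = 1 := invSign_eq_one fun x y h => by
    have : e x ≤ e y := e.monotone (le_of_lt h)
    exact this
  have he' : invSign r Fin.val e.toEquiv.symm = 1 := by
    have := invSign_trans Fin.val_injective hr Fin.val_injective e.toEquiv e.toEquiv.symm
    rw [he, one_mul, Equiv.self_trans_symm] at this
    rw [← this]
    exact invSign_eq_one fun x y h => le_of_lt h
  have h := invSign_perm_fin ((e.toEquiv.trans f).trans e.toEquiv.symm)
  rw [invSign_trans Fin.val_injective hr Fin.val_injective, he', mul_one,
    invSign_trans Fin.val_injective hr hr, he, one_mul] at h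
  rw [h, ← Equiv.Perm.sign_symm_trans_trans f e.toEquiv.symm]
  rfl

/-! ### Signs of graph isomorphisms for even `m` and odd `N` -/

namespace OGraph

/-- The order of the internal vertices. -/
def intRank (G : OGraph) (x : Fin G.numInt) : ℕ := G.rank (Sum.inl (Sum.inr x))

theorem intRank_injective (G : OGraph) : Function.Injective G.intRank := fun x y h => by
  simpa using G.rank_injective h

theorem negOnePow_mul_even_left {a : ℤ} (b : ℤ) (h : Even a) : (a * b).negOnePow = 1 :=
  Int.negOnePow_even _ (h.mul_right b)

theorem negOnePow_mul_even_right (a : ℤ) {b : ℤ} (h : Even b) : (a * b).negOnePow = 1 :=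
  Int.negOnePow_even _ (h.mul_left a)

/-- For even `m` and odd `N`, signs come from the internal vertices and the reversed edges. -/
theorem Iso.sign_eq {m N : ℕ} (hm : Even m) (hN : Odd N) {G G' : OGraph} (f : Iso G G') :
    f.sign m N = (∏ j : G.Edge, if f.flip j then -1 else 1) *
      invSign G.intRank G'.intRank f.int := by
  have hm' : Even (-(m : ℤ)) := by simpa using hm
  have hN' : Odd (N : ℤ) := by exact_mod_cast hN
  have hN1 : Even ((N : ℤ) - 1) := hN'.sub_odd odd_one
  unfold Iso.sign
  congr 1
  · rw [Int.negOnePow_odd _ hN']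
  · unfold Iso.koszulSign invSign
    simp only [Fintype.prod_sum_type, deg, Sum.elim_inl, Sum.elim_inr,
      negOnePow_mul_even_left _ hm', negOnePow_mul_even_right _ hm', negOnePow_mul_even_left _ hN1,
      negOnePow_mul_even_right _ hN1, ite_self, Finset.prod_const_one, one_mul, mul_one]
    rw [Int.negOnePow_odd _ (by simpa using hN'.neg.mul hN'.neg)]
    rfl

namespace Iso

variable {G G' G'' : OGraph}

def refl (G : OGraph) : Iso G G where
  ext := Equiv.refl _
  int := Equiv.refl _
  edge := Equiv.refl _
  flip := fun _ => false
  endpt_eq := by simp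

def trans (f : Iso G G') (g : Iso G' G'') : Iso G G'' where
  ext := f.ext.trans g.ext
  int := f.int.trans g.int
  edge := f.edge.trans g.edge
  flip j := xor (g.flip (f.edge j)) (f.flip j)
  endpt_eq j b := by
    rw [Equiv.trans_apply, Bool.xor_assoc, g.endpt_eq, f.endpt_eq, Sum.map_map]
    rfl

def symm (f : Iso G G') : Iso G' G where
  ext := f.ext.symm
  int := f.int.symm
  edge := f.edge.symm
  flip j := f.flip (f.edge.symm j)
  endpt_eq j b := by
    have h := f.endpt_eq (f.edge.symm j) (xor (f.flip (f.edge.symm j)) b)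
    rw [← Bool.xor_assoc, Bool.xor_self, Bool.false_xor, Equiv.apply_symm_apply] at h
    rw [h, Sum.map_map]
    simp

theorem sign_trans {m N : ℕ} (hm : Even m) (hN : Odd N) (f : Iso G G') (g : Iso G' G'') :
    (f.trans g).sign m N = f.sign m N * g.sign m N := by
  rw [sign_eq hm hN, sign_eq hm hN, sign_eq hm hN]
  have h1 : invSign G.intRank G''.intRank (f.trans g).int = _ :=
    invSign_trans G.intRank_injective G'.intRank_injective G''.intRank_injective f.int g.int
  have h2 : (∏ j : G.Edge, if (f.trans g).flip j then -1 else 1 : ℤˣ) =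
      (∏ j : G.Edge, if f.flip j then -1 else 1) * ∏ j : G'.Edge, if g.flip j then -1 else 1 := by
    rw [← Fintype.prod_equiv f.edge (fun j => if g.flip (f.edge j) then -1 else 1)
      (fun j => if g.flip j then -1 else 1 : G'.Edge → ℤˣ) (fun _ => rfl),
      ← Finset.prod_mul_distrib]
    refine Finset.prod_congr rfl fun j _ => ?_
    have key : ∀ a b : Bool, (if xor b a then -1 else 1 : ℤˣ) =
        (if a then -1 else 1) * if b then -1 else 1 := by decide
    exact key _ _
  rw [h1, h2]
  exact mul_mul_mul_comm _ _ _ _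

theorem sign_symm {m N : ℕ} (hm : Even m) (hN : Odd N) (f : Iso G G') :
    f.symm.sign m N = f.sign m N := by
  have h := sign_trans hm hN f f.symm
  have h1 : (f.trans f.symm).sign m N = 1 := by
    rw [sign_eq hm hN]
    have : ∀ j, (f.trans f.symm).flip j = false := by intro j; simp [trans, symm]
    simp only [this, Bool.false_eq_true, if_false, Finset.prod_const_one, one_mul]
    refine invSign_eq_one fun x y h => ?_
    simpa [trans, symm] using h.le
  rw [h1] at h
  calc f.symm.sign m N = f.sign m N * (f.sign m N * f.symm.sign m N) := by
        rw [← mul_assoc, Int.units_mul_self, one_mul]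
    _ = f.sign m N := by rw [← h, mul_one]

end Iso

theorem cls_eq_of_iso (m N : ℕ) {G G' : OGraph} (f : Iso G G') :
    cls m N G = ((f.sign m N : ℤ) : ℚ) • cls m N G' := by
  unfold cls
  rw [← map_smul]
  exact (Submodule.Quotient.eq _).2 (Submodule.subset_span ⟨G, G', f, rfl⟩)

end OGraph

/-! ### Subdivided theta graphs -/

/-- The vertices in the interior of the three arcs of a theta graph, subdivided by `n i` vertices
on the arc `i`. -/
abbrev Mid (n : Fin 3 → ℕ) : Type := {p : Fin 3 × ℕ // p.2 < n p.1}

/-- The vertices of a subdivided theta graph; `inl false` and `inl true` are the two vertices of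
valence three. -/
abbrev Inn (n : Fin 3 → ℕ) : Type := Bool ⊕ Mid n

/-- The edges of a subdivided theta graph. -/
abbrev Seg (n : Fin 3 → ℕ) : Type := {p : Fin 3 × ℕ // p.2 ≤ n p.1}

/-- The vertex in position `t` on the arc `i`, counted from `inl false` to `inl true`. -/
def pos (n : Fin 3 → ℕ) (i : Fin 3) (t : ℕ) : Inn n :=
  if t = 0 then Sum.inl false else if h : t - 1 < n i then Sum.inr ⟨(i, t - 1), h⟩ else Sum.inl true

@[simp] theorem pos_zero (n : Fin 3 → ℕ) (i : Fin 3) : pos n i 0 = Sum.inl false := rfl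

theorem pos_succ {n : Fin 3 → ℕ} {i : Fin 3} {t : ℕ} (h : t < n i) :
    pos n i (t + 1) = Sum.inr ⟨(i, t), h⟩ := by simp [pos, h]

theorem pos_last {n : Fin 3 → ℕ} {i : Fin 3} {t : ℕ} (h : n i ≤ t) :
    pos n i (t + 1) = Sum.inl true := by simp [pos, h]

/-- A graph given by its half-edges, with the involution exchanging the halves of an edge and the
map sending a half-edge to its vertex. -/
structure HalfGraph (I Hf : Type) where
  opp : Hf → Hf
  opp_opp : ∀ p, opp (opp p) = p
  vt : Hf → I

/-! ### Walks through bivalent vertices and the recognition of theta graphs -/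

namespace HalfGraph

variable {I Hf : Type} (K : HalfGraph I Hf)

open Classical in
def star [Fintype Hf] (x : I) : Finset Hf := Finset.univ.filter fun p => K.vt p = x

theorem mem_star [Fintype Hf] {x : I} {p : Hf} : p ∈ K.star x ↔ K.vt p = x := by simp [star]

open Classical in
/-- Another half-edge at the same vertex. -/
def turn (p : Hf) : Hf := if h : ∃ q, q ≠ p ∧ K.vt q = K.vt p then h.choose else p

theorem opp_injective : Function.Injective K.opp :=
  Function.LeftInverse.injective K.opp_opp

theorem turn_spec [Fintype Hf] {p : Hf} (h : (K.star (K.vt p)).card = 2) :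
    K.turn p ≠ p ∧ K.vt (K.turn p) = K.vt p ∧ ∀ q, K.vt q = K.vt p → q = p ∨ q = K.turn p := by
  classical
  obtain ⟨a, b, hab, hs⟩ := Finset.card_eq_two.1 h
  have hm : ∀ q, K.vt q = K.vt p ↔ q = a ∨ q = b := fun q => by
    rw [← K.mem_star, hs]; simp
  have hex : ∃ q, q ≠ p ∧ K.vt q = K.vt p := by
    rcases (hm p).1 rfl with rfl | rfl
    · exact ⟨b, hab.symm, (hm b).2 (Or.inr rfl)⟩
    · exact ⟨a, hab, (hm a).2 (Or.inl rfl)⟩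
  have ht : K.turn p = hex.choose := dif_pos hex
  obtain ⟨h1, h2⟩ := hex.choose_spec
  rw [← ht] at h1 h2
  refine ⟨h1, h2, fun q hq => ?_⟩
  have hp := (hm p).1 rfl
  have hq := (hm q).1 hq
  have h3 := (hm _).1 h2
  grind

/-- The half-edges met by walking from a half-edge through vertices of valence two. -/
def walk (p : Hf) : ℕ → Hf
  | 0 => p
  | t + 1 => K.turn (K.opp (walk p t))

/-- A step through a bivalent vertex can be undone, since only two half-edges meet there. Hence
walks cannot merge. -/
theorem turn_opp_injective [Fintype Hf] {p q : Hf} (hp : (K.star (K.vt (K.opp p))).card = 2)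
    (hq : (K.star (K.vt (K.opp q))).card = 2) (h : K.turn (K.opp p) = K.turn (K.opp q)) :
    p = q := by
  obtain ⟨h1, h2, h3⟩ := K.turn_spec hp
  obtain ⟨h4, h5, h6⟩ := K.turn_spec hq
  rcases h3 (K.opp q) (by rw [← h2, ← h5, h]) with h' | h'
  · exact (K.opp_injective h').symm
  · exact absurd (h'.trans h).symm h4

/-- A walk that never leaves the bivalent vertices repeats itself by finiteness. As steps can be
undone, the repetition moves back to the first half-edge, which does not lie at a bivalent vertex.
-/
theorem exists_walk_end [Fintype Hf] {p : Hf} (hp : (K.star (K.vt p)).card ≠ 2) :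
    ∃ t, (K.star (K.vt (K.opp (K.walk p t)))).card ≠ 2 := by
  by_contra! hc
  have hb : ∀ t, (K.star (K.vt (K.walk p (t + 1)))).card = 2 := fun t => by
    have := (K.turn_spec (hc t)).2.1
    rw [walk, this]
    exact hc t
  have key : ∀ t s, t < s → K.walk p t ≠ K.walk p s := by
    intro t
    induction t with
    | zero =>
      intro s hs h
      obtain ⟨s, rfl⟩ := Nat.exists_eq_succ_of_ne_zero hs.ne'
      have := hb s
      rw [← h] at this
      exact hp this
    | succ t ih =>
      intro s hs h
      obtain ⟨s, rfl⟩ := Nat.exists_eq_succ_of_ne_zero (by omega : s ≠ 0)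
      exact ih s (by omega) (K.turn_opp_injective (hc t) (hc s) h)
  obtain ⟨t, s, hts, h⟩ := Finite.exists_ne_map_eq_of_infinite (K.walk p)
  rcases lt_or_gt_of_ne hts with h' | h'
  · exact key _ _ h' h
  · exact key _ _ h' h.symm

/-- The number of vertices of valence two passed by the walk from `p`. -/
def len [Fintype Hf] {p : Hf} (hp : (K.star (K.vt p)).card ≠ 2) : ℕ :=
  Nat.find (K.exists_walk_end hp)

theorem len_spec [Fintype Hf] {p : Hf} (hp : (K.star (K.vt p)).card ≠ 2) :
    (K.star (K.vt (K.opp (K.walk p (K.len hp))))).card ≠ 2 := Nat.find_spec (K.exists_walk_end hp)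

theorem len_min [Fintype Hf] {p : Hf} (hp : (K.star (K.vt p)).card ≠ 2) {t : ℕ}
    (ht : t < K.len hp) : (K.star (K.vt (K.opp (K.walk p t)))).card = 2 := by
  simpa using Nat.find_min (K.exists_walk_end hp) ht

theorem vt_walk_succ [Fintype Hf] {p : Hf} (hp : (K.star (K.vt p)).card ≠ 2) {t : ℕ}
    (ht : t < K.len hp) : K.vt (K.walk p (t + 1)) = K.vt (K.opp (K.walk p t)) :=
  (K.turn_spec (K.len_min hp ht)).2.1

/-- No vertex is a cut vertex: a set of edges is everything if it contains all edges having a vertex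
`≠ x` in common with one of its members. -/
def NoCut : Prop := ∀ (x : I) (W : Set Hf), W.Nonempty → (∀ p ∈ W, K.opp p ∈ W) →
  (∀ p ∈ W, ∀ q, K.vt p = K.vt q → K.vt p ≠ x → q ∈ W) → ∀ q, q ∈ W

/-- If the walk came back to its starting vertex, its edges would be closed under sharing any other
vertex, hence would be all edges by `NoCut`. Then only the first and the last half-edge of the walk
would lie at that vertex, which has valence at least three. This excludes loops and dumbbells. -/
theorem vt_end_ne [Fintype Hf] (hK : K.NoCut) {p : Hf} (hp : 3 ≤ (K.star (K.vt p)).card)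
    (hp' : (K.star (K.vt p)).card ≠ 2) : K.vt (K.opp (K.walk p (K.len hp'))) ≠ K.vt p := by
  classical
  intro h
  have hall := hK (K.vt p) {q | ∃ t ≤ K.len hp', q = K.walk p t ∨ q = K.opp (K.walk p t)}
    ⟨p, 0, Nat.zero_le _, Or.inl rfl⟩ ?_ ?_
  · have hsub : K.star (K.vt p) ⊆ {p, K.opp (K.walk p (K.len hp'))} := by
      intro q hq
      rw [K.mem_star] at hq
      obtain ⟨t, ht, rfl | rfl⟩ := hall q
      · rcases t with _ | t
        · simp [walk]
        · have h2 := K.len_min hp' (t := t) (by omega)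
          rw [← K.vt_walk_succ hp' (by omega), hq] at h2
          exact absurd h2 hp'
      · rcases ht.lt_or_eq with ht | rfl
        · have h2 := K.len_min hp' ht
          rw [hq] at h2
          exact absurd h2 hp'
        · simp
    have := (Finset.card_le_card hsub).trans Finset.card_le_two
    omega
  · rintro q ⟨t, ht, rfl | rfl⟩
    · exact ⟨t, ht, Or.inr rfl⟩
    · exact ⟨t, ht, Or.inl (K.opp_opp _)⟩
  · rintro q ⟨t, ht, rfl | rfl⟩ q' hq' hne
    · rcases t with _ | t
      · exact absurd rfl hne
      · rw [K.vt_walk_succ hp' (by omega)] at hq'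
        rcases (K.turn_spec (K.len_min hp' (t := t) (by omega))).2.2 q' hq'.symm with rfl | rfl
        · exact ⟨t, by omega, Or.inr rfl⟩
        · exact ⟨t + 1, ht, Or.inl rfl⟩
    · rcases ht.lt_or_eq with ht | rfl
      · rcases (K.turn_spec (K.len_min hp' ht)).2.2 q' hq'.symm with rfl | rfl
        · exact ⟨t, by omega, Or.inr rfl⟩
        · exact ⟨t + 1, ht, Or.inl rfl⟩
      · exact absurd h hne

theorem sum_card_star [Fintype I] [Fintype Hf] : ∑ x, (K.star x).card = Fintype.card Hf := by
  classical
  have := Finset.card_eq_sum_card_fiberwise (s := (Finset.univ : Finset Hf))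
    (t := (Finset.univ : Finset I)) (f := K.vt) (by simp)
  rw [Finset.card_univ] at this
  rw [this]
  refine Finset.sum_congr rfl fun x _ => ?_
  congr 1

/-- A graph of first Betti number two without cut vertices has two vertices of valence three, and
walks starting at one of them lead to the other one. -/
theorem exists_trivalent [Fintype I] [Fintype Hf] (hdeg : ∀ x, 2 ≤ (K.star x).card)
    (hcard : Fintype.card Hf = 2 * Fintype.card I + 2) (hK : K.NoCut) :
    ∃ u v, u ≠ v ∧ (K.star u).card = 3 ∧ (K.star v).card = 3 ∧
      ∀ x, x ≠ u → x ≠ v → (K.star x).card = 2 := by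
  classical
  have hs := K.sum_card_star
  have hu : ∃ u, 3 ≤ (K.star u).card := by
    by_contra! h
    have h2 : ∑ x, (K.star x).card ≤ ∑ _x : I, 2 :=
      Finset.sum_le_sum fun x _ => by have := h x; omega
    simp only [Finset.sum_const, Finset.card_univ, smul_eq_mul] at h2
    omega
  obtain ⟨u, hu⟩ := hu
  obtain ⟨p, hp⟩ := Finset.card_pos.1 (by omega : 0 < (K.star u).card)
  obtain rfl := K.mem_star.1 hp
  have hp' : (K.star (K.vt p)).card ≠ 2 := by omega
  have hne := K.vt_end_ne hK hu hp'
  set v := K.vt (K.opp (K.walk p (K.len hp'))) with hv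
  have hv3 : (K.star v).card ≠ 2 := K.len_spec hp'
  have hv2 := hdeg v
  -- The valences exceed two by two in total. Both ends of the walk have excess at least one, so
  -- each has excess exactly one and nothing is left for the other vertices.
  have hsub : ∑ x, ((K.star x).card - 2) = 2 := by
    have h2 : ∑ x, ((K.star x).card - 2) + ∑ _x : I, 2 = ∑ x, (K.star x).card := by
      rw [← Finset.sum_add_distrib]
      exact Finset.sum_congr rfl fun x _ => by have := hdeg x; omega
    simp only [Finset.sum_const, Finset.card_univ, smul_eq_mul] at h2
    omega
  have hvm : v ∈ Finset.univ.erase (K.vt p) := by simp [hne]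
  rw [← Finset.add_sum_erase _ _ (Finset.mem_univ (K.vt p)), ← Finset.add_sum_erase _ _ hvm] at hsub
  refine ⟨K.vt p, v, hne.symm, by omega, by omega, fun x hxu hxv => ?_⟩
  have hx0 : ∑ x ∈ (Finset.univ.erase (K.vt p)).erase v, ((K.star x).card - 2) = 0 := by omega
  have := (Finset.sum_eq_zero_iff.1 hx0) x (by simp [hxu, hxv])
  have := hdeg x
  omega

/-- A graph of first Betti number two without cut vertices is a subdivided theta graph. -/
theorem exists_theta [Fintype I] [Fintype Hf] (hdeg : ∀ x, 2 ≤ (K.star x).card)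
    (hcard : Fintype.card Hf = 2 * Fintype.card I + 2) (hK : K.NoCut) :
    ∃ (n : Fin 3 → ℕ) (a : Inn n ≃ I) (e : Seg n × Bool ≃ Hf),
      (∀ p b, K.opp (e (p, b)) = e (p, !b)) ∧
      (∀ p, K.vt (e (p, false)) = a (pos n p.1.1 p.1.2)) ∧
      ∀ p, K.vt (e (p, true)) = a (pos n p.1.1 (p.1.2 + 1)) := by
  classical
  obtain ⟨u, v, huv, hu, hv, hbiv⟩ := K.exists_trivalent hdeg hcard hK
  let l : Fin 3 ≃ K.star u := (Finset.equivFinOfCardEq hu).symm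
  have hlu : ∀ i, K.vt (l i) = u := fun i => K.mem_star.1 (l i).2
  have hl2 : ∀ i, (K.star (K.vt (l i))).card ≠ 2 := fun i => by rw [hlu, hu]; omega
  let n : Fin 3 → ℕ := fun i => K.len (hl2 i)
  let h : Fin 3 → ℕ → Hf := fun i t => K.walk (l i) t
  have hend : ∀ i, K.vt (K.opp (h i (n i))) = v := fun i => by
    by_contra hne
    refine K.len_spec (hl2 i) (hbiv _ ?_ hne)
    exact fun h' => K.vt_end_ne hK (by rw [hlu, hu]) (hl2 i) (h'.trans (hlu i).symm)
  have hb : ∀ i t, t < n i → (K.star (K.vt (K.opp (h i t)))).card = 2 := fun i t ht =>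
    K.len_min (hl2 i) ht
  have hsucc : ∀ i t, t < n i → K.vt (h i (t + 1)) = K.vt (K.opp (h i t)) := fun i t ht =>
    K.vt_walk_succ (hl2 i) ht
  have hbu : ∀ i t, t < n i → K.vt (K.opp (h i t)) ≠ u := fun i t ht h' => by
    have := hb i t ht; rw [h'] at this; omega
  have hbv : ∀ i t, t < n i → K.vt (K.opp (h i t)) ≠ v := fun i t ht h' => by
    have := hb i t ht; rw [h'] at this; omega
  have hou : ∀ i t, t ≤ n i → K.vt (K.opp (h i t)) ≠ u := fun i t ht => by
    rcases ht.lt_or_eq with ht | rfl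
    · exact hbu i t ht
    · rw [hend]; exact huv.symm
  have hiv : ∀ i t, t ≤ n i → K.vt (h i t) ≠ v := fun i t ht => by
    rcases t with _ | t
    · intro h'; exact huv ((hlu i).symm.trans h')
    · rw [hsucc i t (by omega)]; exact hbv i t (by omega)
  -- The three walks are disjoint: a coincidence can be traced back to the starting half-edges.
  have d1 : ∀ t i j s, t ≤ n i → s ≤ n j → h i t = h j s → i = j ∧ t = s := by
    intro t
    induction t with
    | zero =>
      intro i j s _ hs he
      rcases s with _ | s
      · exact ⟨l.injective (Subtype.ext he), rfl⟩
      · have := hsucc j s (by omega)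
        rw [← he] at this
        exact absurd (this.symm.trans (hlu i)) (hbu j s (by omega))
    | succ t ih =>
      intro i j s ht hs he
      rcases s with _ | s
      · have := hsucc i t (by omega)
        rw [he] at this
        exact absurd (this.symm.trans (hlu j)) (hbu i t (by omega))
      · have := ih i j s (by omega) (by omega)
          (K.turn_opp_injective (hb i t (by omega)) (hb j s (by omega)) he)
        exact ⟨this.1, by omega⟩
  -- No walk traverses an edge of a walk backwards: such a coincidence passes from `(t, s)` to `(t -
  -- 1, s + 1)`, and at `t = 0` it would put the far end of an edge at `u`.
  have d2 : ∀ t i j s, t ≤ n i → s ≤ n j → h i t ≠ K.opp (h j s) := by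
    intro t
    induction t with
    | zero =>
      intro i j s _ hs he
      exact hou j s hs (by rw [← he]; exact hlu i)
    | succ t ih =>
      intro i j s ht hs he
      have hsn : s < n j := by
        refine lt_of_le_of_ne hs fun h' => ?_
        subst h'
        exact hiv i (t + 1) ht (by rw [he]; exact hend j)
      obtain ⟨h1, h2, h3⟩ := K.turn_spec (hb i t (by omega))
      obtain ⟨h4, h5, h6⟩ := K.turn_spec (hb j s hsn)
      have he' : K.turn (K.opp (h i t)) = K.opp (h j s) := he
      rcases h6 (K.opp (h i t)) (by rw [← h2, he']) with h' | h'
      · exact h1 (he'.trans h'.symm)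
      · refine ih i j (s + 1) (by omega) (by omega) ?_
        rw [← K.opp_opp (h i t), h']
        rfl
  let e0 : Seg n × Bool → Hf := fun q => if q.2 then K.opp (h q.1.1.1 q.1.1.2) else h q.1.1.1 q.1.1.2
  have he0 : Function.Injective e0 := by
    rintro ⟨⟨⟨i, t⟩, ht⟩, b⟩ ⟨⟨⟨j, s⟩, hs⟩, c⟩ he
    cases b <;> cases c
    · obtain ⟨rfl, rfl⟩ := d1 t i j s ht hs he; rfl
    · exact absurd he (d2 t i j s ht hs)
    · exact absurd he.symm (d2 s j i t hs ht)
    · obtain ⟨rfl, rfl⟩ := d1 t i j s ht hs (K.opp_injective he); rfl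
  -- The ends of the three walks are distinct half-edges at `v`, so they exhaust the three
  -- half-edges there.
  have hstarv : K.star v = Finset.univ.image fun i => K.opp (h i (n i)) := by
    symm
    refine Finset.eq_of_subset_of_card_le ?_ ?_
    · intro q hq
      obtain ⟨i, -, rfl⟩ := Finset.mem_image.1 hq
      exact K.mem_star.2 (hend i)
    · rw [Finset.card_image_of_injective, hv]
      · simp
      · intro i j hij
        exact (d1 _ _ _ _ le_rfl le_rfl (K.opp_injective hij)).1
  -- Since `u` is not a cut vertex, it suffices that the edges of the walks are closed under sharing
  -- a vertex different from `u`.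
  have hs0 : ∀ q, q ∈ Set.range e0 := by
    refine hK u _ ⟨_, ⟨⟨(0, 0), Nat.zero_le _⟩, false⟩, rfl⟩ ?_ ?_
    · rintro _ ⟨⟨p, b⟩, rfl⟩
      refine ⟨(p, !b), ?_⟩
      cases b
      · rfl
      · exact (K.opp_opp _).symm
    · have hout : ∀ i t, t ≤ n i → ∀ q, K.vt q = K.vt (K.opp (h i t)) → q ∈ Set.range e0 := by
        intro i t ht q hq
        rcases ht.lt_or_eq with ht' | rfl
        · rcases (K.turn_spec (hb i t ht')).2.2 q hq with rfl | rfl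
          · exact ⟨(⟨(i, t), ht⟩, true), rfl⟩
          · exact ⟨(⟨(i, t + 1), ht'⟩, false), rfl⟩
        · rw [hend, ← K.mem_star, hstarv] at hq
          obtain ⟨j, -, rfl⟩ := Finset.mem_image.1 hq
          exact ⟨(⟨(j, n j), le_rfl⟩, true), rfl⟩
      rintro _ ⟨⟨⟨⟨i, t⟩, ht⟩, b⟩, rfl⟩ q hq hne
      cases b
      · rcases t with _ | t
        · exact absurd (hlu i) hne
        · exact hout i t (Nat.le_of_succ_le ht) q (hq.symm.trans (hsucc i t ht))
      · exact hout i t ht q hq.symm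
  let e : Seg n × Bool ≃ Hf := Equiv.ofBijective e0 ⟨he0, hs0⟩
  -- Interior vertex number `t` is the start of the half-edge number `t + 1`, because the half-edge
  -- number `0` starts at `u`.
  let a0 : Inn n → I := Sum.elim (fun b => if b then v else u) fun p => K.vt (h p.1.1 (p.1.2 + 1))
  have ha1 : ∀ p : Seg n, K.vt (e0 (p, false)) = a0 (pos n p.1.1 p.1.2) := by
    rintro ⟨⟨i, t⟩, ht⟩
    rcases t with _ | t
    · exact hlu i
    · dsimp only
      rw [pos_succ ht]
      rfl
  have ha2 : ∀ p : Seg n, K.vt (e0 (p, true)) = a0 (pos n p.1.1 (p.1.2 + 1)) := by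
    rintro ⟨⟨i, t⟩, ht⟩
    dsimp only at ht ⊢
    rcases ht.lt_or_eq with ht' | rfl
    · rw [pos_succ ht']
      exact (hsucc i t ht').symm
    · rw [pos_last le_rfl]
      exact hend i
  have ha : Function.Bijective a0 := by
    constructor
    · have hm : ∀ p : Mid n, a0 (Sum.inr p) ≠ u ∧ a0 (Sum.inr p) ≠ v := by
        rintro ⟨⟨i, t⟩, ht⟩
        refine ⟨fun h' => hbu i t ht ?_, hiv i (t + 1) ht⟩
        rw [← hsucc i t ht]
        exact h'
      rintro (b | p) (c | q) hpq
      · cases b <;> cases c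
        · rfl
        · exact absurd hpq huv
        · exact absurd hpq.symm huv
        · rfl
      · cases b
        · exact absurd hpq.symm (hm q).1
        · exact absurd hpq.symm (hm q).2
      · cases c
        · exact absurd hpq (hm p).1
        · exact absurd hpq (hm p).2
      · obtain ⟨⟨i, t⟩, ht⟩ := p
        obtain ⟨⟨j, s⟩, hs⟩ := q
        have hpq' : K.vt (h i (t + 1)) = K.vt (h j (s + 1)) := hpq
        rw [hsucc j s hs] at hpq'
        rcases (K.turn_spec (hb j s hs)).2.2 _ hpq' with h' | h'
        · exact absurd h' (d2 _ _ _ _ ht (Nat.le_of_succ_le hs))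
        · obtain ⟨rfl, h2⟩ := d1 (t + 1) i j (s + 1) ht hs h'
          obtain rfl : t = s := by omega
          rfl
    · intro x
      obtain ⟨q, hq⟩ := Finset.card_pos.1 (by have := hdeg x; omega : 0 < (K.star x).card)
      obtain ⟨⟨p, b⟩, rfl⟩ := hs0 q
      rw [K.mem_star] at hq
      cases b
      · exact ⟨_, (ha1 p).symm.trans hq⟩
      · exact ⟨_, (ha2 p).symm.trans hq⟩
  refine ⟨n, Equiv.ofBijective a0 ha, e, ?_, ha1, ha2⟩
  intro p b
  cases b
  · rfl
  · exact K.opp_opp _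

end HalfGraph
namespace OGraph

/-! ### The frame of a two-loop hairy graph -/

variable {G : OGraph}

theorem IsUniThreeValent.ext_unique (hG : G.IsUniThreeValent) {p q : G.HalfEdge}
    {a : Fin G.numExt} (hp : G.endpt p.1 p.2 = Sum.inl a) (hq : G.endpt q.1 q.2 = Sum.inl a) :
    p = q :=
  Finset.card_le_one.1 (hG.valence_ext a).le p (by simpa [halfEdgesAt] using hp) q
    (by simpa [halfEdgesAt] using hq)

theorem IsUniThreeValent.exists_ext (hG : G.IsUniThreeValent) (a : Fin G.numExt) :
    ∃ p : G.HalfEdge, G.endpt p.1 p.2 = Sum.inl a := by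
  obtain ⟨p, hp⟩ := Finset.card_pos.1 (by rw [← valence, hG.valence_ext a]; exact one_pos :
    0 < (G.halfEdgesAt (Sum.inl a)).card)
  exact ⟨p, by simpa [halfEdgesAt] using hp⟩

theorem IsUniThreeValent.endpt_not_ne (hG : G.IsUniThreeValent) {j : G.Edge} {b : Bool}
    {a : Fin G.numExt} (h : G.endpt j b = Sum.inl a) : G.endpt j (!b) ≠ Sum.inl a := fun h' => by
  have := congrArg Prod.snd (hG.ext_unique (p := (j, b)) (q := (j, !b)) h h')
  simp at this

/-- Edges at external vertices are of tree type. -/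
theorem IsUniThreeValent.isTreeType_of_ext (hG : G.IsUniThreeValent) (h2 : G.loops = 2)
    {j : G.Edge} {b : Bool} {a : Fin G.numExt} (h : G.endpt j b = Sum.inl a) :
    G.IsTreeType j := by
  classical
  have hne := hG.endpt_not_ne h
  have hu : ∀ i c, G.endpt i c = Sum.inl a → i = j := fun i c hi =>
    congrArg Prod.fst (hG.ext_unique (p := (i, c)) (q := (j, b)) hi h)
  have hs1 : G.side j b = {Sum.inl a} := by
    ext u
    simp only [side, Set.mem_ofPred_eq, Set.mem_singleton_iff, h]
    refine ⟨fun hj => ?_, fun hj => by rw [hj]; exact Relation.ReflTransGen.refl⟩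
    induction hj with
    | refl => rfl
    | tail _ hst ih =>
      obtain ⟨i, hi, c, h1, -⟩ := hst
      exact absurd (hu i c (h1.trans ih)) hi
  have hs2 : G.side j (!b) = {Sum.inl a}ᶜ := by
    ext u
    simp only [side, Set.mem_ofPred_eq, Set.mem_compl_iff, Set.mem_singleton_iff]
    constructor
    · intro hj
      induction hj with
      | refl => exact hne
      | tail _ hst ih =>
        obtain ⟨i, hi, c, -, h2⟩ := hst
        exact fun h' => hi (hu i _ (h2.trans h'))
    · have key : ∀ u, G.Joined Set.univ (G.endpt j (!b)) u → u = Sum.inl a ∨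
          G.Joined {j}ᶜ (G.endpt j (!b)) u := by
        intro u hj
        induction hj with
        | refl => exact Or.inr Relation.ReflTransGen.refl
        | tail _ hst ih =>
          obtain ⟨i, -, c, h1, h2⟩ := hst
          by_cases hij : i = j
          · subst hij
            by_cases hcb : c = b
            · subst hcb
              exact Or.inr (by rw [← h2]; exact Relation.ReflTransGen.refl)
            · obtain rfl : c = !b := Bool.eq_not_iff.2 hcb
              rw [Bool.not_not] at h2
              exact Or.inl (h2.symm.trans h)
          · rcases ih with ih | ih
            · exact absurd (hu i c (h1.trans ih)) hij
            · exact Or.inr (ih.tail ⟨i, hij, c, h1, h2⟩)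
      intro hua
      exact (key u (hG.connected _ _)).resolve_left hua
  -- Betti number two means one edge more than vertices. Removing the edge together with its
  -- univalent end leaves too many edges for a tree.
  have hE : (G.numEdge : ℤ) = G.numExt + G.numInt + 1 := by
    simp only [loops] at h2
    push_cast at h2
    linarith
  have ht1 : G.SideIsTree j b := by
    unfold SideIsTree
    rw [hs1, Set.ncard_singleton]
    have : {i : G.Edge | i ≠ j ∧ G.endpt i false ∈ ({Sum.inl a} : Set G.Vert)} = ∅ := by
      ext i
      simp only [Set.mem_ofPred_eq, Set.mem_singleton_iff, Set.mem_empty_iff_false, iff_false]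
      exact fun hi => hi.1 (hu i _ hi.2)
    rw [this, Set.ncard_empty]
  have ht2 : ¬ G.SideIsTree j (!b) := by
    unfold SideIsTree
    rw [hs2]
    have : {i : G.Edge | i ≠ j ∧ G.endpt i false ∈ ({Sum.inl a}ᶜ : Set G.Vert)} = {j}ᶜ := by
      ext i
      simp only [Set.mem_ofPred_eq, Set.mem_compl_iff, Set.mem_singleton_iff]
      exact ⟨fun hi => hi.1, fun hi => ⟨hi, fun h' => hi (hu i _ h')⟩⟩
    rw [this, Set.ncard_compl, Set.ncard_compl, Set.ncard_singleton, Set.ncard_singleton,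
      Nat.card_eq_fintype_card, Nat.card_eq_fintype_card, Fintype.card_sum]
    simp only [Fintype.card_fin]
    omega
  cases b
  · refine ⟨?_, Or.inl ⟨ht1, ht2⟩⟩
    rw [hs1]
    exact hne
  · refine ⟨?_, Or.inr ⟨ht1, ht2⟩⟩
    rw [Bool.not_true] at hs2
    rw [hs2, h]
    simp

theorem IsTwoLoopHairy.isTreeType_iff (hG : G.IsTwoLoopHairy) (j : G.Edge) :
    G.IsTreeType j ↔ ∃ b a, G.endpt j b = Sum.inl a := by
  refine ⟨fun h => ?_, fun ⟨b, a, h⟩ => hG.uni.isTreeType_of_ext hG.two_loop h⟩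
  obtain ⟨-, b, hb, -⟩ := hG.hairy.hair j h
  rcases hv : G.endpt j b with a | x
  · exact ⟨b, a, hv⟩
  · have := hG.uni.valence_int x
    rw [← hv, hb] at this
    omega

/-- The foot of a hair lies on an edge of the frame, and edges with an external end are not in the
frame. -/
theorem IsTwoLoopHairy.hair_int (hG : G.IsTwoLoopHairy) {j : G.Edge} {b : Bool}
    {a : Fin G.numExt} (h : G.endpt j b = Sum.inl a) : ∃ x, G.endpt j (!b) = Sum.inr x := by
  obtain ⟨ht, c, hc, ⟨i, hi, d, hd⟩, -⟩ :=
    hG.hairy.hair j (hG.uni.isTreeType_of_ext hG.two_loop h)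
  have hi' : ∀ b a, G.endpt i b ≠ Sum.inl a := fun b a h' =>
    hi (hG.uni.isTreeType_of_ext hG.two_loop h')
  rcases hv : G.endpt j (!c) with a' | x
  · exact absurd (hd.trans hv) (hi' d a')
  · by_cases hbc : c = b
    · subst hbc; exact ⟨x, hv⟩
    · obtain rfl : b = !c := by cases b <;> cases c <;> simp_all
      rw [hv] at h
      exact absurd h (by simp)

/-- The definition of a hair forbids a second tree-type edge at its foot, so a vertex carries at
most one hair. -/
theorem IsTwoLoopHairy.hair_unique (hG : G.IsTwoLoopHairy) {p q : G.HalfEdge}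
    {x : Fin G.numInt} {a a' : Fin G.numExt} (hp : G.endpt p.1 p.2 = Sum.inr x)
    (hq : G.endpt q.1 q.2 = Sum.inr x) (hpa : G.endpt p.1 (!p.2) = Sum.inl a)
    (hqa : G.endpt q.1 (!q.2) = Sum.inl a') : p = q := by
  obtain ⟨ht, c, hc, -, hu⟩ :=
    hG.hairy.hair p.1 (hG.uni.isTreeType_of_ext hG.two_loop hpa)
  have hcp : c = !p.2 := by
    refine Bool.eq_not_iff.2 fun hc' => ?_
    subst hc'
    rw [hp] at hc
    have := hG.uni.valence_int x
    omega
  subst hcp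
  rw [Bool.not_not] at hu
  have h1 : q.1 = p.1 := hu q.1 (hG.uni.isTreeType_of_ext hG.two_loop hqa) ⟨q.2, hq.trans hp.symm⟩
  obtain ⟨j, b⟩ := p
  obtain ⟨i, c⟩ := q
  obtain rfl : i = j := h1
  by_cases hbc : b = c
  · rw [hbc]
  · obtain rfl : c = !b := by cases b <;> cases c <;> simp_all
    rw [hpa] at hq
    exact absurd hq (by simp)

/-- The half-edges of the edges between internal vertices. -/
abbrev FrameHalf (G : OGraph) : Type :=
  {p : G.HalfEdge // (G.endpt p.1 p.2).isRight = true ∧ (G.endpt p.1 (!p.2)).isRight = true}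

/-- The edges between internal vertices. -/
def frame (G : OGraph) : HalfGraph (Fin G.numInt) G.FrameHalf where
  opp p := ⟨(p.1.1, !p.1.2), p.2.2, by simpa using p.2.1⟩
  opp_opp p := by simp
  vt p := (G.endpt p.1.1 p.1.2).getRight p.2.1

theorem frame_vt_iff {p : G.FrameHalf} {x : Fin G.numInt} :
    G.frame.vt p = x ↔ G.endpt p.1.1 p.1.2 = Sum.inr x := by
  simp [frame, Sum.getRight_eq_iff]

theorem endpt_frame (p : G.FrameHalf) : G.endpt p.1.1 p.1.2 = Sum.inr (G.frame.vt p) :=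
  frame_vt_iff.1 rfl

/-- Every half-edge at `x` belongs to an edge between internal vertices or to a hair, and there is
at most one hair. -/
theorem IsTwoLoopHairy.card_halfEdgesAt_le (hG : G.IsTwoLoopHairy) (x : Fin G.numInt) :
    (G.halfEdgesAt (Sum.inr x)).card ≤ (G.frame.star x).card + 1 := by
  classical
  set H := G.halfEdgesAt (Sum.inr x) with hH
  have h1 : (H.filter fun p => (G.endpt p.1 (!p.2)).isRight = true).card ≤ (G.frame.star x).card := by
    refine Finset.card_le_card_of_surjOn (fun p => p.1) ?_
    intro p hp
    simp only [hH, halfEdgesAt, Finset.coe_filter, Finset.mem_filter, Finset.mem_univ, true_and,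
      Set.mem_ofPred_eq] at hp
    exact ⟨⟨p, by rw [hp.1]; rfl, hp.2⟩, by simp [G.frame.mem_star, frame_vt_iff, hp.1], rfl⟩
  have h2 : (H.filter fun p => ¬ (G.endpt p.1 (!p.2)).isRight = true).card ≤ 1 := by
    refine Finset.card_le_one.2 fun p hp q hq => ?_
    simp only [hH, halfEdgesAt, Finset.mem_filter, Finset.mem_univ, true_and, Bool.not_eq_true,
      Sum.isRight_eq_false, Sum.isLeft_iff] at hp hq
    obtain ⟨hp, a, ha⟩ := hp
    obtain ⟨hq, a', ha'⟩ := hq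
    exact hG.hair_unique hp hq ha ha'
  have := Finset.card_filter_add_card_filter_not (s := H) fun p => (G.endpt p.1 (!p.2)).isRight = true
  omega

theorem IsTwoLoopHairy.two_le_star (hG : G.IsTwoLoopHairy) (x : Fin G.numInt) :
    2 ≤ (G.frame.star x).card := by
  have h1 := hG.card_halfEdgesAt_le x
  have h2 := hG.uni.valence_int x
  unfold valence at h2
  omega

theorem three_le_star_of_no_hair (hG : G.IsUniThreeValent) {x : Fin G.numInt}
    (h : ¬ ∃ (p : G.HalfEdge) (a : Fin G.numExt), G.endpt p.1 p.2 = Sum.inr x ∧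
      G.endpt p.1 (!p.2) = Sum.inl a) : 3 ≤ (G.frame.star x).card := by
  classical
  refine (hG.valence_int x).trans (Finset.card_le_card_of_surjOn (fun p => p.1) ?_)
  intro p hp
  simp only [halfEdgesAt, Finset.coe_filter, Finset.mem_univ, true_and, Set.mem_ofPred_eq] at hp
  have hr : (G.endpt p.1 (!p.2)).isRight = true := by
    rcases hv : G.endpt p.1 (!p.2) with a | y
    · exact absurd ⟨p, a, hp, hv⟩ h
    · rfl
  exact ⟨⟨p, by rw [hp]; rfl, hr⟩, by simp [G.frame.mem_star, frame_vt_iff, hp], rfl⟩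

theorem IsUniThreeValent.card_ext_half (hG : G.IsUniThreeValent) :
    (Finset.univ.filter fun p : G.HalfEdge => (G.endpt p.1 p.2).isRight = false).card
      = G.numExt := by
  classical
  have : (Finset.univ.filter fun p : G.HalfEdge => (G.endpt p.1 p.2).isRight = false) =
      Finset.univ.biUnion fun a => G.halfEdgesAt (Sum.inl a) := by
    ext p
    simp [halfEdgesAt, Sum.isLeft_iff]
  rw [this, Finset.card_biUnion]
  · have : ∀ a, (G.halfEdgesAt (Sum.inl a)).card = 1 := hG.valence_ext
    simp [this]
  · intro a _ b _ hab
    refine Finset.disjoint_left.2 fun p hp hq => hab ?_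
    simp only [halfEdgesAt, Finset.mem_filter, Finset.mem_univ, true_and] at hp hq
    simpa using hp.symm.trans hq

/-- Each hair accounts for two half-edges, so `2 * numEdge - 2 * numExt` remain, and `numEdge =
numExt + numInt + 1`. Thus the frame has first Betti number two as well. -/
theorem IsTwoLoopHairy.card_frameHalf (hG : G.IsTwoLoopHairy) :
    Fintype.card G.FrameHalf = 2 * Fintype.card (Fin G.numInt) + 2 := by
  classical
  have h2 := hG.two_loop
  simp only [loops] at h2
  have h1 := hG.uni.card_ext_half
  have h3 : (Finset.univ.filter fun p : G.HalfEdge => (G.endpt p.1 (!p.2)).isRight = false).card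
      = G.numExt := by
    refine Eq.trans ?_ h1
    refine Finset.card_nbij' (fun p => (p.1, !p.2)) (fun p => (p.1, !p.2)) ?_ ?_ ?_ ?_ <;>
      intro p hp <;> simpa using hp
  have hdis : Disjoint
      (Finset.univ.filter fun p : G.HalfEdge => (G.endpt p.1 p.2).isRight = false)
      (Finset.univ.filter fun p : G.HalfEdge => (G.endpt p.1 (!p.2)).isRight = false) := by
    refine Finset.disjoint_left.2 fun p hp hq => ?_
    simp only [Finset.mem_filter, Finset.mem_univ, true_and, Sum.isRight_eq_false,
      Sum.isLeft_iff] at hp hq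
    obtain ⟨a, ha⟩ := hp
    obtain ⟨a', ha'⟩ := hq
    obtain ⟨x, hx⟩ := hG.hair_int ha
    rw [hx] at ha'
    exact absurd ha' (by simp)
  have h4 := Finset.card_union_of_disjoint hdis
  have h5 : Fintype.card G.FrameHalf = (Finset.univ.filter fun p : G.HalfEdge =>
      (G.endpt p.1 p.2).isRight = true ∧ (G.endpt p.1 (!p.2)).isRight = true).card :=
    Fintype.card_subtype _
  have h6 : (Finset.univ.filter fun p : G.HalfEdge => (G.endpt p.1 p.2).isRight = false) ∪
      (Finset.univ.filter fun p : G.HalfEdge => (G.endpt p.1 (!p.2)).isRight = false) =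
      (Finset.univ.filter fun p : G.HalfEdge =>
      (G.endpt p.1 p.2).isRight = true ∧ (G.endpt p.1 (!p.2)).isRight = true)ᶜ := by
    ext p
    simp only [Finset.mem_union, Finset.mem_filter, Finset.mem_univ, true_and, Finset.mem_compl]
    cases (G.endpt p.1 p.2).isRight <;> cases (G.endpt p.1 (!p.2)).isRight <;> simp
  rw [h6, Finset.card_compl, ← h5, h1, h3, Fintype.card_prod, Fintype.card_fin,
    Fintype.card_bool] at h4
  have h7 : Fintype.card G.FrameHalf ≤ Fintype.card G.HalfEdge := Fintype.card_subtype_le _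
  rw [Fintype.card_prod, Fintype.card_fin, Fintype.card_bool] at h7
  rw [Fintype.card_fin]
  push_cast at h2
  omega

theorem IsTwoLoopHairy.mem_frameEdges (hG : G.IsTwoLoopHairy) (p : G.FrameHalf) :
    p.1.1 ∈ G.frameEdges := by
  intro ht
  obtain ⟨b, a, h⟩ := (hG.isTreeType_iff _).1 ht
  obtain ⟨⟨j, c⟩, h1, h2⟩ := p
  by_cases hbc : b = c
  · subst hbc
    dsimp only at h h1
    rw [h] at h1
    exact absurd h1 (by simp)
  · obtain rfl : b = !c := Bool.eq_not_iff.2 hbc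
    dsimp only at h h2
    rw [h] at h2
    exact absurd h2 (by simp)

/-- Translation from chains of edges, as in `IsFrameCut`, to closed sets of half-edges: a closed set
is propagated along a chain that avoids `x`. -/
theorem IsTwoLoopHairy.noCut (hG : G.IsTwoLoopHairy) : G.frame.NoCut := by
  intro x W ⟨p, hp⟩ hopp hcl q
  have hx := hG.hairy.no_cut (Sum.inr x)
  simp only [IsFrameCut, not_and, not_exists, not_not] at hx
  -- `IsFrameCut` presupposes that `x` is a vertex of the frame; an edge at `x` witnesses this.
  obtain ⟨s, hs⟩ := Finset.card_pos.1 (by have := hG.two_le_star x; omega :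
    0 < (G.frame.star x).card)
  have hj := hx ⟨s.1.1, hG.mem_frameEdges s, s.1.2, by rw [endpt_frame, G.frame.mem_star.1 hs]⟩
    p.1.1 (hG.mem_frameEdges p) q.1.1 (hG.mem_frameEdges q)
  have hW : ∀ r r' : G.FrameHalf, r.1.1 = r'.1.1 → r ∈ W → r' ∈ W := by
    rintro ⟨⟨j, b⟩, h⟩ ⟨⟨j', b'⟩, h'⟩ hjj hr
    obtain rfl : j = j' := hjj
    by_cases hb : b = b'
    · subst hb; exact hr
    · obtain rfl : b' = !b := Bool.eq_not_iff.2 (Ne.symm hb)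
      exact hopp _ hr
  have hfr : ∀ j ∈ G.frameEdges, ∀ b, ∃ y, G.endpt j b = Sum.inr y := by
    intro j hj b
    rcases h : G.endpt j b with a | y
    · exact absurd ((hG.isTreeType_iff j).2 ⟨b, a, h⟩) hj
    · exact ⟨y, rfl⟩
  have key : ∀ j, Relation.ReflTransGen
      (fun p q => q ∈ G.frameEdges ∧ ∃ w, w ≠ Sum.inr x ∧ G.Incident p w ∧ G.Incident q w)
      p.1.1 j → j ∈ G.frameEdges ∧ ∀ r : G.FrameHalf, r.1.1 = j → r ∈ W := by
    intro j hj
    induction hj with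
    | refl => exact ⟨hG.mem_frameEdges p, fun r hr => hW p r hr.symm hp⟩
    | tail _ hst ih =>
      rename_i i j _
      obtain ⟨hjF, w, hwx, ⟨b, hb⟩, ⟨c, hc⟩⟩ := hst
      obtain ⟨hiF, hi⟩ := ih
      refine ⟨hjF, fun r hr => ?_⟩
      have hfi := hfr i hiF
      have hfj := hfr j hjF
      let r1 : G.FrameHalf := ⟨(i, b), Sum.isRight_iff.2 (hfi b), Sum.isRight_iff.2 (hfi _)⟩
      let r2 : G.FrameHalf := ⟨(j, c), Sum.isRight_iff.2 (hfj c), Sum.isRight_iff.2 (hfj _)⟩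
      obtain ⟨y, hy⟩ := hfi b
      have h1 : G.frame.vt r1 = y := frame_vt_iff.2 hy
      have h2 : G.frame.vt r2 = y := frame_vt_iff.2 (by rw [← hy, hb]; exact hc)
      have hyx : y ≠ x := by
        rintro rfl
        exact hwx (by rw [← hb, hy])
      exact hW r2 r hr.symm (hcl r1 (hi r1 rfl) r2 (h1.trans h2.symm) (by rw [h1]; exact hyx))
  exact (key _ hj).2 q rfl

end OGraph

/-! ### Standard two-loop hairy graphs -/

variable {h : Bool → Bool} {n : Fin 3 → ℕ}

/-- The flag telling whether a vertex of a theta graph carries a hair: the vertices in the interior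
of the arcs always do, and `h` gives the flags of the two other vertices. -/
def hairFlag (h : Bool → Bool) (n : Fin 3 → ℕ) : Inn n → Bool := Sum.elim h fun _ => true

/-- The hairs, and thus the external vertices. -/
abbrev Hair (h : Bool → Bool) (n : Fin 3 → ℕ) : Type := {x : Inn n // hairFlag h n x = true}

instance (n : Fin 3 → ℕ) : Finite (Mid n) :=
  Finite.of_injective (fun p : Mid n => (⟨p.1.1, ⟨p.1.2, p.2⟩⟩ : Σ i, Fin (n i))) (by
    rintro ⟨⟨i, t⟩, ht⟩ ⟨⟨j, s⟩, hs⟩ h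
    simp only [Sigma.mk.injEq] at h
    obtain ⟨rfl, h⟩ := h
    simpa using h)

instance (n : Fin 3 → ℕ) : Finite (Seg n) :=
  Finite.of_injective (fun p : Seg n => (⟨p.1.1, ⟨p.1.2, Nat.lt_succ_of_le p.2⟩⟩ :
    Σ i, Fin (n i + 1))) (by
    rintro ⟨⟨i, t⟩, ht⟩ ⟨⟨j, s⟩, hs⟩ h
    simp only [Sigma.mk.injEq] at h
    obtain ⟨rfl, h⟩ := h
    simpa using h)

instance (n : Fin 3 → ℕ) : Fintype (Mid n) := Fintype.ofFinite _
instance (n : Fin 3 → ℕ) : Fintype (Seg n) := Fintype.ofFinite _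

/-- The interior vertices of the arcs as a sigma type. -/
def midEquiv (n : Fin 3 → ℕ) : Mid n ≃ Σ i, Fin (n i) where
  toFun p := ⟨p.1.1, ⟨p.1.2, p.2⟩⟩
  invFun s := ⟨(s.1, s.2.1), s.2.2⟩
  left_inv _ := rfl
  right_inv _ := rfl

/-- The edges of a theta graph as a sigma type. -/
def segEquiv (n : Fin 3 → ℕ) : Seg n ≃ Σ i, Fin (n i + 1) where
  toFun p := ⟨p.1.1, ⟨p.1.2, Nat.lt_succ_of_le p.2⟩⟩
  invFun s := ⟨(s.1, s.2.1), Nat.le_of_lt_succ s.2.2⟩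
  left_inv _ := rfl
  right_inv _ := rfl

theorem card_mid (n : Fin 3 → ℕ) : Fintype.card (Mid n) = ∑ i, n i := by
  rw [Fintype.card_congr (midEquiv n)]; simp

theorem card_seg (n : Fin 3 → ℕ) : Fintype.card (Seg n) = ∑ i, n i + 3 := by
  rw [Fintype.card_congr (segEquiv n)]; simp [Finset.sum_add_distrib]

theorem card_inn (n : Fin 3 → ℕ) : Fintype.card (Inn n) = ∑ i, n i + 2 := by
  rw [Fintype.card_sum, card_mid, Fintype.card_bool, add_comm]

/-- The number of hairs at the two vertices of valence three in the frame. -/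
def numHair (h : Bool → Bool) : ℕ := (h false).toNat + (h true).toNat

theorem card_hair (h : Bool → Bool) (n : Fin 3 → ℕ) :
    Fintype.card (Hair h n) = ∑ i, n i + numHair h := by
  rw [Fintype.card_congr Equiv.subtypeSum, Fintype.card_sum, add_comm]
  have h1 : Fintype.card {b : Mid n // hairFlag h n (Sum.inr b) = true} = ∑ i, n i := by
    rw [← card_mid, Fintype.card_subtype]
    simp [hairFlag, Finset.card_univ]
  have h2 : Fintype.card {b : Bool // hairFlag h n (Sum.inl b) = true} = numHair h := by
    rw [Fintype.card_subtype, Finset.card_filter, Fintype.sum_bool, numHair, add_comm]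
    simp only [hairFlag, Sum.elim_inl]
    exact (by decide : ∀ a b : Bool, ((if a = true then 1 else 0) + if b = true then 1 else 0) =
      a.toNat + b.toNat) _ _
  rw [h1, h2]

/-- The order of the vertices of a theta graph. -/
def innRank (n : Fin 3 → ℕ) : Inn n → ℕ :=
  -- The two trivalent vertices come first. A position on an arc is smaller than `∑ i, n i`, so the
  -- interior vertices are ordered lexicographically by arc and position.
  Sum.elim Bool.toNat fun p => 2 + (p.1.1 * (∑ i, n i) + p.1.2)

theorem le_sum_fin {n : Fin 3 → ℕ} (i : Fin 3) : n i ≤ ∑ i, n i :=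
  Finset.single_le_sum (fun _ _ => Nat.zero_le _) (Finset.mem_univ i)

theorem innRank_mid_lt {p q : Mid n} : innRank n (Sum.inr p) < innRank n (Sum.inr q) ↔
    p.1.1 < q.1.1 ∨ p.1.1 = q.1.1 ∧ p.1.2 < q.1.2 := by
  obtain ⟨⟨i, t⟩, ht⟩ := p
  obtain ⟨⟨j, s⟩, hs⟩ := q
  have h1 := le_sum_fin (n := n) i
  have h2 := le_sum_fin (n := n) j
  dsimp only at ht hs
  simp only [innRank, Sum.elim_inr]
  generalize ∑ i, n i = M at *
  rcases lt_trichotomy i j with hij | rfl | hij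
  · have : ((i : ℕ) + 1) * M ≤ j * M := Nat.mul_le_mul_right _ hij
    simp only [hij, true_or, iff_true]
    linarith
  · simp
  · have : ((j : ℕ) + 1) * M ≤ i * M := Nat.mul_le_mul_right _ hij
    simp only [hij.not_gt, hij.ne', false_and, or_self, iff_false, not_lt]
    linarith

theorem innRank_injective (n : Fin 3 → ℕ) : Function.Injective (innRank n) := by
  rintro (b | p) (c | q) hpq
  · revert hpq; cases b <;> cases c <;> simp [innRank]
  · have : b.toNat = _ := hpq
    have := b.toNat_lt
    simp only [innRank, Sum.elim_inr] at *
    omega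
  · have : _ = c.toNat := hpq
    have := c.toNat_lt
    simp only [innRank, Sum.elim_inr] at *
    omega
  · have h1 := innRank_mid_lt (p := p) (q := q)
    have h2 := innRank_mid_lt (p := q) (q := p)
    rw [hpq] at h1 h2
    simp only [lt_irrefl, false_iff, not_or, not_and, not_lt] at h1 h2
    have hi : p.1.1 = q.1.1 := le_antisymm h2.1 h1.1
    have := h1.2 hi
    have := h2.2 hi.symm
    congr 1
    exact Subtype.ext (Prod.ext hi (by omega))

/-- The end of a segment of a theta graph. -/
def segEnd (n : Fin 3 → ℕ) (p : Seg n) (b : Bool) : Inn n := pos n p.1.1 (p.1.2 + b.toNat)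

/-- The ends of the edges of a standard graph: a hair runs from the internal to the external
vertex. -/
def thetaEnd (h : Bool → Bool) (n : Fin 3 → ℕ) :
    Seg n ⊕ Hair h n → Bool → Hair h n ⊕ Inn n :=
  Sum.elim (fun p b => Sum.inr (segEnd n p b)) fun x b => if b then Sum.inl x else Sum.inr x.1

/-- The theta graph with `n i` hairs on the arc `i`, and hairs at the two other vertices according
to the flags `h`. -/
def thetaGraph (h : Bool → Bool) (n : Fin 3 → ℕ) : OGraph where
  numExt := Fintype.card (Hair h n)
  numInt := Fintype.card (Inn n)
  numEdge := Fintype.card (Seg n ⊕ Hair h n)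
  endpt j b := Sum.map (Fintype.equivFin _) (Fintype.equivFin _)
    (thetaEnd h n ((Fintype.equivFin _).symm j) b)
  -- Residues modulo three keep the ranks of the three kinds apart; in the parity at hand only the
  -- order of the internal vertices affects signs.
  rank := Sum.elim (Sum.elim (fun a => 3 * a)
    fun x => 3 * innRank n ((Fintype.equivFin _).symm x) + 1) fun j => 3 * j + 2
  rank_injective := by
    rintro ((a | a) | a) ((b | b) | b) hab <;>
      simp only [Sum.elim_inl, Sum.elim_inr] at hab <;> try omega
    · rw [Fin.ext (by omega : (a : ℕ) = b)]
    · have := innRank_injective n (by omega :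
        innRank n ((Fintype.equivFin _).symm a) = innRank n ((Fintype.equivFin _).symm b))
      simpa using this
    · rw [Fin.ext (by omega : (a : ℕ) = b)]

def extE (h : Bool → Bool) (n : Fin 3 → ℕ) : Hair h n ≃ Fin (thetaGraph h n).numExt :=
  Fintype.equivFin _

def intE (h : Bool → Bool) (n : Fin 3 → ℕ) : Inn n ≃ Fin (thetaGraph h n).numInt :=
  Fintype.equivFin _

def edgeE (h : Bool → Bool) (n : Fin 3 → ℕ) : Seg n ⊕ Hair h n ≃ (thetaGraph h n).Edge :=
  Fintype.equivFin _

theorem endpt_edgeE (j : Seg n ⊕ Hair h n) (b : Bool) :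
    (thetaGraph h n).endpt (edgeE h n j) b =
      Sum.map (extE h n) (intE h n) (thetaEnd h n j b) := by
  change Sum.map _ _ (thetaEnd h n ((edgeE h n).symm (edgeE h n j)) b) = _
  rw [Equiv.symm_apply_apply]
  rfl

theorem intRank_intE (x : Inn n) :
    (thetaGraph h n).intRank (intE h n x) = 3 * innRank n x + 1 := by
  change 3 * innRank n ((intE h n).symm (intE h n x)) + 1 = _
  rw [Equiv.symm_apply_apply]

open OGraph

/-- An isomorphism from a standard graph given by bijections of the vertices and edges. -/
def thetaIso {G : OGraph} (ex : Hair h n ≃ Fin G.numExt) (it : Inn n ≃ Fin G.numInt)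
    (ed : Seg n ⊕ Hair h n ≃ G.Edge) (fl : Seg n ⊕ Hair h n → Bool)
    (hc : ∀ j b, G.endpt (ed j) (xor (fl j) b) = Sum.map ex it (thetaEnd h n j b)) :
    Iso (thetaGraph h n) G where
  ext := (extE h n).symm.trans ex
  int := (intE h n).symm.trans it
  edge := (edgeE h n).symm.trans ed
  flip j := fl ((edgeE h n).symm j)
  endpt_eq j b := by
    obtain ⟨j, rfl⟩ := (edgeE h n).surjective j
    rw [endpt_edgeE, Sum.map_map, Equiv.trans_apply, Equiv.symm_apply_apply, hc]
    congr 1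
    · ext x; simp
    · ext x; simp

/-- Signs can be computed with the typed vertices and `innRank`, since `x ↦ 3 * x + 1` preserves the
order. -/
theorem sign_theta {m N : ℕ} (hm : Even m) (hN : Odd N) {G : OGraph} (f : Iso (thetaGraph h n) G) :
    f.sign m N = (∏ j, if f.flip (edgeE h n j) then -1 else 1) *
      invSign (innRank n) (fun x => G.intRank x) ((intE h n).trans f.int) := by
  rw [Iso.sign_eq hm hN]
  congr 1
  · exact (Fintype.prod_equiv (edgeE h n) _ _ fun _ => rfl).symm
  · unfold invSign
    refine (Fintype.prod_equiv (intE h n) _ _ fun x =>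
      Fintype.prod_equiv (intE h n) _ _ fun y => ?_).symm
    simp only [intRank_intE, Equiv.trans_apply]
    congr 2
    apply propext
    omega

theorem pos_eq_mid {i : Fin 3} {t : ℕ} {q : Mid n} (hq : pos n i t = Sum.inr q) :
    i = q.1.1 ∧ t = q.1.2 + 1 := by
  rcases t with _ | t
  · simp at hq
  · by_cases ht : t < n i
    · rw [pos_succ ht] at hq
      obtain rfl := Sum.inr_injective hq
      exact ⟨rfl, rfl⟩
    · rw [pos_last (by omega)] at hq
      simp at hq

theorem segEnd_eq_mid {p : Seg n} {b : Bool} {q : Mid n} (hq : segEnd n p b = Sum.inr q) :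
    (p, b) = (⟨q.1, q.2.le⟩, true) ∨ (p, b) = (⟨(q.1.1, q.1.2 + 1), q.2⟩, false) := by
  obtain ⟨h1, h2⟩ := pos_eq_mid hq
  obtain ⟨⟨i, t⟩, ht⟩ := p
  obtain ⟨⟨j, s⟩, hs⟩ := q
  obtain rfl : i = j := h1
  cases b
  · right
    obtain rfl : t = s + 1 := h2
    rfl
  · left
    obtain rfl : t = s := by simpa using h2
    rfl

/-- Two-loop hairy graphs are isomorphic to standard ones. -/
theorem exists_iso_theta {G : OGraph} (hG : G.IsTwoLoopHairy) :
    ∃ h n, Nonempty (Iso (thetaGraph h n) G) := by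
  classical
  obtain ⟨n, a, e, he, h1, h2⟩ :=
    G.frame.exists_theta hG.two_le_star hG.card_frameHalf hG.noCut
  have hvt : ∀ p b, G.frame.vt (e (p, b)) = a (segEnd n p b) := by
    intro p b
    cases b
    · exact h1 p
    · exact h2 p
  -- The vertices that carry a hair; on the two trivalent ones this defines the flags.
  let P : Inn n → Prop := fun x => ∃ (p : G.HalfEdge) (c : Fin G.numExt),
    G.endpt p.1 p.2 = Sum.inr (a x) ∧ G.endpt p.1 (!p.2) = Sum.inl c
  let h : Bool → Bool := fun b => decide (P (Sum.inl b))
  have hP : ∀ x : Hair h n, P x.1 := by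
    rintro ⟨b | q, hx⟩
    · simpa [h, hairFlag] using hx
    -- A bivalent vertex of the frame needs a hair to reach valence three in the graph.
    · by_contra hno
      have h3 := three_le_star_of_no_hair hG.uni hno
      have : G.frame.star (a (Sum.inr q)) ⊆
          {e (⟨q.1, q.2.le⟩, true), e (⟨(q.1.1, q.1.2 + 1), q.2⟩, false)} := by
        intro r hr
        obtain ⟨⟨p, b⟩, rfl⟩ := e.surjective r
        rw [G.frame.mem_star, hvt] at hr
        rcases segEnd_eq_mid (a.injective hr) with h' | h' <;> rw [h'] <;> simp
      have := h3.trans ((Finset.card_le_card this).trans Finset.card_le_two)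
      omega
  choose p c hp hc using hP
  have hflag : ∀ x, P x → hairFlag h n x = true := by
    rintro (b | q) hx
    · simpa [h, hairFlag] using hx
    · rfl
  have hcinj : Function.Injective c := by
    intro x y hxy
    have := hG.uni.ext_unique (p := ((p x).1, !(p x).2)) (q := ((p y).1, !(p y).2)) (hc x)
      (by rw [hxy]; exact hc y)
    have hpp : p x = p y := by
      rw [Prod.ext_iff] at this
      exact Prod.ext this.1 (by simpa using this.2)
    have h3 := hp x
    rw [hpp, hp y] at h3
    exact Subtype.ext (a.injective (Sum.inr_injective h3)).symm
  have hcsurj : Function.Surjective c := by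
    intro k
    obtain ⟨q, hq⟩ := hG.uni.exists_ext k
    obtain ⟨y, hy⟩ := hG.hair_int hq
    obtain ⟨x, rfl⟩ := a.surjective y
    have hx : P x := ⟨(q.1, !q.2), k, hy, by simpa using hq⟩
    refine ⟨⟨x, hflag x hx⟩, ?_⟩
    have := hG.hair_unique (hp ⟨x, hflag x hx⟩) (q := (q.1, !q.2)) hy (hc _)
      (a' := k) (by simpa using hq)
    have h3 := hc ⟨x, hflag x hx⟩
    rw [this, Bool.not_not, hq] at h3
    exact (Sum.inl_injective h3).symm
  have hfe : ∀ s b, G.endpt (e (s, false)).1.1 (xor (e (s, false)).1.2 b) =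
      Sum.inr (a (segEnd n s b)) := by
    intro s b
    rw [← hvt, ← endpt_frame]
    cases b
    · simp
    · have h3 : e (s, true) = G.frame.opp (e (s, false)) := (he s false).symm
      rw [h3]
      simp [frame]
  let ed0 : Seg n ⊕ Hair h n → G.Edge := Sum.elim (fun s => (e (s, false)).1.1) fun x => (p x).1
  let fl : Seg n ⊕ Hair h n → Bool := Sum.elim (fun s => (e (s, false)).1.2) fun x => (p x).2
  have hcompat : ∀ j b, G.endpt (ed0 j) (xor (fl j) b) =
      Sum.map (Equiv.ofBijective c ⟨hcinj, hcsurj⟩) a (thetaEnd h n j b) := by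
    rintro (s | x) b
    · exact hfe s b
    · cases b
      · simpa [ed0, fl, thetaEnd] using hp x
      · rw [Bool.xor_true]
        exact hc x
  have hinj : Function.Injective ed0 := by
    have hsx : ∀ s x, ed0 (Sum.inl s) ≠ ed0 (Sum.inr x) := by
      intro s x hsx
      have := hcompat (Sum.inl s) (xor (fl (Sum.inl s)) (!(fl (Sum.inr x))))
      rw [hsx, ← Bool.xor_assoc, Bool.xor_self, Bool.false_xor] at this
      exact absurd ((hc x).symm.trans this) (by simp [thetaEnd])
    rintro (s | x) (s' | x') hj
    · have hj' : (e (s, false)).1.1 = (e (s', false)).1.1 := hj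
      by_cases hb : (e (s, false)).1.2 = (e (s', false)).1.2
      · have := e.injective (Subtype.ext (Prod.ext hj' hb))
        exact congrArg Sum.inl (congrArg Prod.fst this)
      · have h3 : e (s, false) = G.frame.opp (e (s', false)) :=
          Subtype.ext (Prod.ext hj' (Bool.eq_not_iff.2 hb))
        rw [he] at h3
        simpa using e.injective h3
    · exact absurd hj (hsx s x')
    · exact absurd hj.symm (hsx s' x)
    · have hj' : (p x).1 = (p x').1 := hj
      by_cases hb : (p x).2 = (p x').2
      · have h3 := hc x
        rw [hj', hb, hc x'] at h3
        rw [hcinj (Sum.inl_injective h3)]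
      · have h3 := hp x
        rw [hj', Bool.eq_not_iff.2 hb, hc x'] at h3
        exact absurd h3 (by simp)
  have hsurj : Function.Surjective ed0 := by
    intro j
    by_cases hj : ∃ b k, G.endpt j b = Sum.inl k
    · obtain ⟨b, k, hk⟩ := hj
      obtain ⟨x, rfl⟩ := hcsurj k
      refine ⟨Sum.inr x, ?_⟩
      exact congrArg Prod.fst (hG.uni.ext_unique (p := ((p x).1, !(p x).2)) (q := (j, b)) (hc x) hk)
    · have hr : ∀ b, (G.endpt j b).isRight = true := fun b => by
        rcases hv : G.endpt j b with k | y
        · exact absurd ⟨b, k, hv⟩ hj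
        · rfl
      obtain ⟨⟨s, b⟩, hs⟩ := e.surjective ⟨(j, false), hr _, hr _⟩
      refine ⟨Sum.inl s, ?_⟩
      cases b
      · show (e (s, false)).1.1 = j
        rw [hs]
      · have h3 := he s true
        rw [hs] at h3
        show (e (s, false)).1.1 = j
        rw [← Bool.not_true, ← h3]
        rfl
  exact ⟨h, n, ⟨thetaIso _ a (Equiv.ofBijective ed0 ⟨hinj, hsurj⟩) fl hcompat⟩⟩

/-! ### Standard graphs are two-loop hairy graphs -/

theorem thetaEnd_eq_iff (j : Seg n ⊕ Hair h n) (b : Bool) (v : Hair h n ⊕ Inn n) :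
    (thetaGraph h n).endpt (edgeE h n j) b = Sum.map (extE h n) (intE h n) v ↔
      thetaEnd h n j b = v := by
  rw [endpt_edgeE]
  exact ((extE h n).injective.sumMap (intE h n).injective).eq_iff

theorem mem_halfEdgesAt_ext {j : Seg n ⊕ Hair h n} {b : Bool} {x : Hair h n} :
    (edgeE h n j, b) ∈ (thetaGraph h n).halfEdgesAt (Sum.inl (extE h n x)) ↔
      thetaEnd h n j b = Sum.inl x := by
  rw [← thetaEnd_eq_iff]; simp [halfEdgesAt]

theorem mem_halfEdgesAt_int {j : Seg n ⊕ Hair h n} {b : Bool} {x : Inn n} :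
    (edgeE h n j, b) ∈ (thetaGraph h n).halfEdgesAt (Sum.inr (intE h n x)) ↔
      thetaEnd h n j b = Sum.inr x := by
  rw [← thetaEnd_eq_iff]; simp [halfEdgesAt]

/-- The first or the last segment of an arc. -/
def endSeg (n : Fin 3 → ℕ) (b : Bool) (i : Fin 3) : Seg n := ⟨(i, if b then n i else 0), by
  cases b <;> simp⟩

@[simp] theorem segEnd_endSeg (b : Bool) (i : Fin 3) : segEnd n (endSeg n b i) b = Sum.inl b := by
  cases b
  · rfl
  · exact pos_last le_rfl

theorem endSeg_injective (b : Bool) : Function.Injective (endSeg n b) := fun _ _ hij =>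
  congrArg (fun p : Seg n => p.1.1) hij

theorem segEnd_eq_inl {p : Seg n} {b c : Bool} (hp : segEnd n p b = Sum.inl c) :
    b = c ∧ p = endSeg n c p.1.1 := by
  obtain ⟨⟨i, t⟩, ht⟩ := p
  unfold segEnd at hp
  dsimp only at hp ht
  cases b
  · rcases t with _ | t
    · obtain rfl : false = c := by simpa using hp
      exact ⟨rfl, rfl⟩
    · rw [Bool.toNat_false, add_zero, pos_succ ht] at hp
      simp at hp
  · rcases ht.lt_or_eq with ht' | rfl
    · rw [Bool.toNat_true, pos_succ ht'] at hp
      simp at hp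
    · rw [Bool.toNat_true, pos_last le_rfl] at hp
      obtain rfl : true = c := by simpa using hp
      exact ⟨rfl, rfl⟩

theorem three_le_valence_theta (x : Inn n) :
    3 ≤ (thetaGraph h n).valence (Sum.inr (intE h n x)) := by
  classical
  rcases x with b | q
  · have : (Finset.univ.image fun i => (edgeE h n (Sum.inl (endSeg n b i)), b)) ⊆
        (thetaGraph h n).halfEdgesAt (Sum.inr (intE h n (Sum.inl b))) := by
      intro p hp
      obtain ⟨i, -, rfl⟩ := Finset.mem_image.1 hp
      rw [mem_halfEdgesAt_int]
      simp [thetaEnd]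
    refine le_trans ?_ (Finset.card_le_card this)
    rw [Finset.card_image_of_injective]
    · simp
    · intro i j hij
      exact endSeg_injective b (Sum.inl_injective ((edgeE h n).injective (congrArg Prod.fst hij)))
  · have : {(edgeE h n (Sum.inl ⟨q.1, q.2.le⟩), true),
        (edgeE h n (Sum.inl ⟨(q.1.1, q.1.2 + 1), q.2⟩), false),
        (edgeE h n (Sum.inr ⟨Sum.inr q, rfl⟩), false)} ⊆
        (thetaGraph h n).halfEdgesAt (Sum.inr (intE h n (Sum.inr q))) := by
      intro p hp
      simp only [Finset.mem_insert, Finset.mem_singleton] at hp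
      rcases hp with rfl | rfl | rfl <;> rw [mem_halfEdgesAt_int]
      · exact congrArg Sum.inr (pos_succ q.2)
      · exact congrArg Sum.inr (pos_succ q.2)
      · rfl
    refine le_trans ?_ (Finset.card_le_card this)
    rw [Finset.card_insert_of_notMem, Finset.card_insert_of_notMem, Finset.card_singleton]
    · simp
    · simp

/-- The path along an arc. -/
theorem joined_pos (F : Set (thetaGraph h n).Edge) {i : Fin 3} {s t : ℕ} (hst : s ≤ t)
    (ht : t ≤ n i + 1)
    (hF : ∀ r (hr : r ≤ n i), s ≤ r → r < t → edgeE h n (Sum.inl ⟨(i, r), hr⟩) ∈ F) :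
    (thetaGraph h n).Joined F (Sum.inr (intE h n (pos n i s))) (Sum.inr (intE h n (pos n i t))) := by
  induction t, hst using Nat.le_induction with
  | base => exact Relation.ReflTransGen.refl
  | succ t hst ih =>
    refine (ih (by omega) fun r hr h1 h2 => hF r hr h1 (by omega)).tail
      ⟨_, hF t (by omega) hst (by omega), false, ?_, ?_⟩
    · rw [endpt_edgeE]; rfl
    · rw [endpt_edgeE]; rfl

theorem joined_symm {G : OGraph} {F : Set G.Edge} {u w : G.Vert} (hj : G.Joined F u w) :
    G.Joined F w u := by
  have : Std.Symm (G.Step F) := ⟨fun u w ⟨j, hj, b, h1, h2⟩ => ⟨j, hj, !b, h2, by simpa using h1⟩⟩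
  have h2 : Std.Symm (Relation.ReflTransGen (G.Step F)) := inferInstance
  exact h2.symm _ _ hj

theorem exists_pos (x : Inn n) : ∃ i t, t ≤ n i + 1 ∧ pos n i t = x := by
  rcases x with (_ | _) | ⟨⟨i, t⟩, ht⟩
  · exact ⟨0, 0, by omega, rfl⟩
  · exact ⟨0, n 0 + 1, le_rfl, pos_last le_rfl⟩
  · exact ⟨i, t + 1, by dsimp only at ht; omega, pos_succ ht⟩

theorem joined_theta (u w : (thetaGraph h n).Vert) : (thetaGraph h n).Joined Set.univ u w := by
  have h0 : ∀ x : Inn n, (thetaGraph h n).Joined Set.univ (Sum.inr (intE h n (Sum.inl false)))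
      (Sum.inr (intE h n x)) := by
    intro x
    obtain ⟨i, t, ht, rfl⟩ := exists_pos x
    exact joined_pos Set.univ (Nat.zero_le t) ht fun _ _ _ _ => Set.mem_univ _
  have h1 : ∀ u : (thetaGraph h n).Vert, (thetaGraph h n).Joined Set.univ
      (Sum.inr (intE h n (Sum.inl false))) u := by
    rintro (a | x)
    · obtain ⟨a, rfl⟩ := (extE h n).surjective a
      refine (h0 a.1).tail ⟨edgeE h n (Sum.inr a), Set.mem_univ _, false, ?_, ?_⟩ <;>
        rw [endpt_edgeE] <;> rfl
    · obtain ⟨x, rfl⟩ := (intE h n).surjective x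
      exact h0 x
  exact (joined_symm (h1 u)).trans (h1 w)

theorem isUniThreeValent_theta (hpos : 0 < ∑ i, n i + numHair h) :
    (thetaGraph h n).IsUniThreeValent where
  ext_nonempty := by
    change 0 < Fintype.card (Hair h n)
    rwa [card_hair]
  connected := joined_theta
  valence_ext a := by
    obtain ⟨a, rfl⟩ := (extE h n).surjective a
    refine Finset.card_eq_one.2 ⟨(edgeE h n (Sum.inr a), true), ?_⟩
    ext ⟨j, b⟩
    obtain ⟨j, rfl⟩ := (edgeE h n).surjective j
    rw [mem_halfEdgesAt_ext, Finset.mem_singleton, Prod.mk.injEq, (edgeE h n).injective.eq_iff]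
    rcases j with s | x
    · simp [thetaEnd]
    · cases b <;> simp [thetaEnd]
  valence_int x := by
    obtain ⟨x, rfl⟩ := (intE h n).surjective x
    exact three_le_valence_theta x

theorem loops_theta : (thetaGraph h n).loops = 2 := by
  change ((Fintype.card (Seg n ⊕ Hair h n) : ℕ) : ℤ) -
    (Fintype.card (Hair h n) + Fintype.card (Inn n) : ℕ) + 1 = 2
  rw [Fintype.card_sum, card_seg, card_inn, card_hair]
  push_cast
  ring

/-- The removal of a segment does not disconnect the graph: one can go back to the first vertex of
the arc, over along another arc, and back from the last vertex. -/
theorem not_isTreeType_seg (p : Seg n) : ¬ (thetaGraph h n).IsTreeType (edgeE h n (Sum.inl p)) := by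
  rintro ⟨hno, -⟩
  obtain ⟨⟨i, t⟩, ht⟩ := p
  dsimp only at ht
  apply hno
  simp only [side, Set.mem_ofPred_eq, endpt_edgeE]
  obtain ⟨i', hi'⟩ : ∃ i' : Fin 3, i' ≠ i := exists_ne i
  have hne : ∀ j r (hr : r ≤ n j), (j, r) ≠ (i, t) → edgeE h n (Sum.inl ⟨(j, r), hr⟩) ∈
      ({edgeE h n (Sum.inl ⟨(i, t), ht⟩)}ᶜ : Set (thetaGraph h n).Edge) := by
    intro j r hr hjr
    simpa using hjr
  have h1 := joined_pos (h := h) {edgeE h n (Sum.inl ⟨(i, t), ht⟩)}ᶜ (Nat.zero_le t)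
    (by omega : t ≤ n i + 1) fun r hr _ hrt => hne i r hr (by simpa using hrt.ne)
  have h2 := joined_pos (h := h) {edgeE h n (Sum.inl ⟨(i, t), ht⟩)}ᶜ (Nat.zero_le (n i' + 1)) le_rfl
    fun r hr _ _ => hne i' r hr (by simp [hi'])
  have h3 := joined_pos (h := h) {edgeE h n (Sum.inl ⟨(i, t), ht⟩)}ᶜ
    (by omega : t + 1 ≤ n i + 1) le_rfl fun r hr hrt _ => hne i r hr (by simp; omega)
  rw [pos_last le_rfl] at h2 h3
  exact (joined_symm h1).trans (h2.trans (joined_symm h3))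

/-- Two segments have a vertex different from `x` in common. -/
def SegLink (n : Fin 3 → ℕ) (x : Inn n) (p q : Seg n) : Prop :=
  ∃ b c, segEnd n p b = segEnd n q c ∧ segEnd n p b ≠ x

theorem segLink_symm (x : Inn n) {p q : Seg n} (hl : Relation.ReflTransGen (SegLink n x) p q) :
    Relation.ReflTransGen (SegLink n x) q p := by
  have : Std.Symm (SegLink n x) := ⟨fun p q ⟨b, c, h1, h2⟩ => ⟨c, b, h1.symm, by rwa [← h1]⟩⟩
  exact Std.Symm.symm _ _ hl

theorem segLink_arc {x : Inn n} {i : Fin 3} {s t : ℕ} (hst : s ≤ t) (ht : t ≤ n i)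
    (hx : ∀ r (hr : r < n i), s ≤ r → r < t → x ≠ Sum.inr ⟨(i, r), hr⟩) :
    Relation.ReflTransGen (SegLink n x) ⟨(i, s), hst.trans ht⟩ ⟨(i, t), ht⟩ := by
  induction t, hst using Nat.le_induction with
  | base => exact Relation.ReflTransGen.refl
  | succ t hst ih =>
    refine (ih (by omega) fun r hr h1 h2 => hx r hr h1 (by omega)).tail ⟨true, false, rfl, ?_⟩
    have := hx t ht hst (by omega)
    exact fun h' => this (by rw [← h']; exact pos_succ ht)

/-- A theta graph has no cut vertex. If `x` is one of the trivalent vertices, the arcs stay linked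
through the other one. If `x` lies inside an arc, each part of this arc is still linked to another
arc through the trivalent vertex at its end. -/
theorem segLink_all (x : Inn n) (p q : Seg n) : Relation.ReflTransGen (SegLink n x) p q := by
  have hjump : ∀ (b : Bool) i j, x ≠ Sum.inl b →
      Relation.ReflTransGen (SegLink n x) (endSeg n b i) (endSeg n b j) := fun b i j hb =>
    Relation.ReflTransGen.single ⟨b, b, by simp, by simpa using hb.symm⟩
  suffices hs : ∃ p0, ∀ p, Relation.ReflTransGen (SegLink n x) p p0 by
    obtain ⟨p0, hp0⟩ := hs
    exact (hp0 p).trans (segLink_symm x (hp0 q))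
  rcases x with (_ | _) | ⟨⟨i, t⟩, ht⟩
  · refine ⟨endSeg n true 0, fun ⟨⟨j, s⟩, hs⟩ => ?_⟩
    exact (segLink_arc (t := n j) hs le_rfl fun _ _ _ _ => by simp).trans
      (hjump true j 0 (by simp))
  · refine ⟨endSeg n false 0, fun ⟨⟨j, s⟩, hs⟩ => ?_⟩
    exact (segLink_symm _ (segLink_arc (s := 0) (Nat.zero_le s) hs fun _ _ _ _ => by simp)).trans
      (hjump false j 0 (by simp))
  · obtain ⟨i', hi'⟩ : ∃ i' : Fin 3, i' ≠ i := exists_ne i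
    refine ⟨endSeg n false i', fun ⟨⟨j, s⟩, hs⟩ => ?_⟩
    dsimp only at hs
    by_cases hjs : j = i ∧ t < s
    · obtain ⟨rfl, hjs⟩ := hjs
      refine (segLink_arc (t := n j) hs le_rfl fun r _ h1 _ => ?_).trans
        ((hjump true j i' (by simp)).trans
        (segLink_symm _ (segLink_arc (s := 0) (Nat.zero_le _) le_rfl fun _ _ _ _ => ?_)))
      · simp; omega
      · simp [hi'.symm]
    · refine (segLink_symm _ (segLink_arc (s := 0) (Nat.zero_le s) hs fun r _ _ h2 => ?_)).trans
        (hjump false j i' (by simp))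
      simp only [ne_eq, Sum.inr.injEq, Subtype.mk.injEq, Prod.mk.injEq, not_and]
      rintro rfl rfl
      exact hjs ⟨rfl, h2⟩

/-- The standard graphs are two-loop hairy graphs. -/
theorem isTwoLoopHairy_theta (hpos : 0 < ∑ i, n i + numHair h) :
    (thetaGraph h n).IsTwoLoopHairy := by
  have huni := isUniThreeValent_theta (h := h) (n := n) hpos
  have hhair : ∀ x, (thetaGraph h n).IsTreeType (edgeE h n (Sum.inr x)) := fun x =>
    huni.isTreeType_of_ext loops_theta (b := true) (a := extE h n x) (by rw [endpt_edgeE]; rfl)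
  have hframe : ∀ p, edgeE h n (Sum.inl p) ∈ (thetaGraph h n).frameEdges := not_isTreeType_seg
  refine ⟨huni, loops_theta, ?_, ?_⟩
  · rintro u ⟨⟨j, hj, b, hb⟩, i, hi, k, hk, hno⟩
    have hex : ∀ i ∈ (thetaGraph h n).frameEdges, ∃ p, edgeE h n (Sum.inl p) = i := by
      intro i hi
      obtain ⟨p | x, rfl⟩ := (edgeE h n).surjective i
      · exact ⟨p, rfl⟩
      · exact absurd (hhair x) hi
    obtain ⟨p, rfl⟩ := hex j hj
    obtain ⟨q, rfl⟩ := hex i hi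
    obtain ⟨r, rfl⟩ := hex k hk
    apply hno
    subst hb
    refine (segLink_all (segEnd n p b) q r).lift (fun p => edgeE h n (Sum.inl p)) ?_
    rintro s s' ⟨c, c', h1, h2⟩
    refine ⟨hframe s', (thetaGraph h n).endpt (edgeE h n (Sum.inl s)) c, ?_, ⟨c, rfl⟩, ⟨c', ?_⟩⟩
    · rw [endpt_edgeE, endpt_edgeE]
      simpa [thetaEnd] using h2
    · rw [endpt_edgeE, endpt_edgeE]
      simpa [thetaEnd] using h1.symm
  · intro j hj
    obtain ⟨p | x, rfl⟩ := (edgeE h n).surjective j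
    · exact absurd hj (not_isTreeType_seg p)
    · refine ⟨hj, true, ?_, ?_, ?_⟩
      · rw [endpt_edgeE]
        exact huni.valence_ext _
      · rw [endpt_edgeE]
        have : ∃ p b, segEnd n p b = x.1 := by
          obtain ⟨b | ⟨⟨i, t⟩, ht⟩, hx⟩ := x
          · exact ⟨endSeg n b 0, b, by simp⟩
          · exact ⟨⟨(i, t), le_of_lt ht⟩, true, pos_succ ht⟩
        obtain ⟨p, b, hp⟩ := this
        refine ⟨_, hframe p, b, ?_⟩
        rw [endpt_edgeE]
        simp [thetaEnd, hp]
      · intro i hi ⟨c, hc⟩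
        obtain ⟨p | y, rfl⟩ := (edgeE h n).surjective i
        · exact absurd hi (not_isTreeType_seg p)
        · rw [endpt_edgeE, endpt_edgeE] at hc
          cases c
          · have : y.1 = x.1 := by simpa [thetaEnd] using hc
            rw [Subtype.ext this]
          · simp [thetaEnd] at hc

/-! ### Isomorphisms between standard graphs -/

/-- The sign of the permutation of the arcs of a theta graph. -/
def arcSign (π : Equiv.Perm (Fin 3)) (n : Fin 3 → ℕ) : ℤˣ :=
  ∏ i, ∏ j, if i < j ∧ π j < π i then (-1) ^ (n i * n j) else 1

/-- The sign of the reflection of a theta graph. -/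
def flipSign (n : Fin 3 → ℕ) : ℤˣ := ∏ i, (-1) ^ (n i * (n i + 1) / 2)

variable {h' : Bool → Bool} {n' : Fin 3 → ℕ}

theorem innRank_inl (b : Bool) : innRank n (Sum.inl b) = b.toNat := rfl

theorem innRank_inl_lt_inr (b : Bool) (p : Mid n) :
    innRank n (Sum.inl b) < innRank n (Sum.inr p) := by
  have := b.toNat_lt
  simp only [innRank, Sum.elim_inl, Sum.elim_inr]
  omega

/-- Only pairs of vertices of the same kind contribute to the sign of a bijection preserving
`Mid`. -/
theorem invSign_inn (a : Inn n ≃ Inn n') (a0 : Bool → Bool) (a1 : Mid n → Mid n')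
    (h0 : ∀ b, a (Sum.inl b) = Sum.inl (a0 b)) (h1 : ∀ p, a (Sum.inr p) = Sum.inr (a1 p)) :
    invSign (innRank n) (innRank n') a = (if a0 true = false then -1 else 1) *
      ∏ p : Mid n, ∏ q : Mid n, if (p.1.1 < q.1.1 ∨ p.1.1 = q.1.1 ∧ p.1.2 < q.1.2) ∧
        ((a1 q).1.1 < (a1 p).1.1 ∨ (a1 q).1.1 = (a1 p).1.1 ∧ (a1 q).1.2 < (a1 p).1.2)
        then -1 else 1 := by
  have hne : a0 true ≠ a0 false := fun he => by
    have := a.injective ((h0 true).trans ((congrArg Sum.inl he).trans (h0 false).symm))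
    simp at this
  unfold invSign
  rw [Fintype.prod_sum_type]
  simp only [Fintype.prod_sum_type, h0, h1, innRank_mid_lt]
  congr 1
  · have hz : ∀ b q, ¬ (innRank n (Sum.inl b) < innRank n (Sum.inr q) ∧
        innRank n' (Sum.inr (a1 q)) < innRank n' (Sum.inl (a0 b))) := fun b q hbq =>
      (innRank_inl_lt_inr (a0 b) (a1 q)).not_gt hbq.2
    simp only [hz, if_false, Finset.prod_const_one, mul_one]
    simp only [Fintype.prod_bool, innRank_inl]
    revert hne
    generalize a0 true = x
    generalize a0 false = y
    cases x <;> cases y <;> simp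
  · have hz : ∀ b q, ¬ (innRank n (Sum.inr q) < innRank n (Sum.inl b) ∧
        innRank n' (Sum.inl (a0 b)) < innRank n' (Sum.inr (a1 q))) := fun b q hbq =>
      (innRank_inl_lt_inr b q).not_gt hbq.1
    simp only [hz, if_false, Finset.prod_const_one, one_mul]

theorem prod_mid (F : Fin 3 → ℕ → ℤˣ) :
    ∏ p : Mid n, F p.1.1 p.1.2 = ∏ i, ∏ t : Fin (n i), F i t := by
  rw [Fintype.prod_equiv (midEquiv n) (fun p => F p.1.1 p.1.2) (fun s => F s.1 s.2)
    fun _ => rfl, Fintype.prod_sigma]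

theorem prod_mid_mid (F : Fin 3 → ℕ → Fin 3 → ℕ → ℤˣ) :
    ∏ p : Mid n, ∏ q : Mid n, F p.1.1 p.1.2 q.1.1 q.1.2 =
      ∏ i, ∏ t : Fin (n i), ∏ j, ∏ s : Fin (n j), F i t j s := by
  rw [← prod_mid fun i t => ∏ j, ∏ s : Fin (n j), F i t j s]
  exact Finset.prod_congr rfl fun p _ => prod_mid fun j s => F p.1.1 p.1.2 j s

/-- Positions on an arc are preserved, so only pairs of vertices on different arcs can be inverted;
a pair of arcs `i`, `j` that is inverted contributes `n i * n j` inversions. -/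
theorem prod_perm_arcs (π : Equiv.Perm (Fin 3)) :
    (∏ p : Mid n, ∏ q : Mid n, if (p.1.1 < q.1.1 ∨ p.1.1 = q.1.1 ∧ p.1.2 < q.1.2) ∧
        (π q.1.1 < π p.1.1 ∨ π q.1.1 = π p.1.1 ∧ q.1.2 < p.1.2) then -1 else 1) =
      arcSign π n := by
  rw [prod_mid_mid fun i t j s => if (i < j ∨ i = j ∧ t < s) ∧
    (π j < π i ∨ π j = π i ∧ s < t) then -1 else 1]
  have : ∀ (i j : Fin 3) (t s : ℕ), ((i < j ∨ i = j ∧ t < s) ∧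
      (π j < π i ∨ π j = π i ∧ s < t)) ↔ (i < j ∧ π j < π i) := by
    intro i j t s
    constructor
    · rintro ⟨h1 | ⟨rfl, h1⟩, h2 | ⟨h2, h3⟩⟩
      · exact ⟨h1, h2⟩
      · exact absurd (π.injective h2) h1.ne'
      · exact absurd h2 (lt_irrefl _)
      · omega
    · rintro ⟨h1, h2⟩
      exact ⟨Or.inl h1, Or.inl h2⟩
  simp only [this]
  unfold arcSign
  refine Finset.prod_congr rfl fun i _ => ?_
  rw [Finset.prod_comm]
  refine Finset.prod_congr rfl fun j _ => ?_
  split_ifs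
  · simp [← pow_mul, mul_comm]
  · simp

/-- The sign of an isomorphism permuting the arcs. -/
theorem sign_of_perm {m N : ℕ} (hm : Even m) (hN : Odd N)
    (f : Iso (thetaGraph h n) (thetaGraph h' n')) (π : Equiv.Perm (Fin 3)) (hn : n = n' ∘ π)
    (hfl : ∀ j, f.flip (edgeE h n j) = false)
    (h0 : ∀ b, f.int (intE h n (Sum.inl b)) = intE h' n' (Sum.inl b))
    (h1 : ∀ p : Mid n, f.int (intE h n (Sum.inr p)) =
      intE h' n' (Sum.inr ⟨(π p.1.1, p.1.2), by have := p.2; subst hn; exact this⟩)) :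
    f.sign m N = arcSign π n := by
  rw [sign_theta hm hN]
  simp only [hfl, Bool.false_eq_true, if_false, Finset.prod_const_one, one_mul]
  rw [← prod_perm_arcs]
  have := invSign_inn (((intE h n).trans f.int).trans (intE h' n').symm) id
    (fun p => ⟨(π p.1.1, p.1.2), by have := p.2; subst hn; exact this⟩)
    (fun b => by simp [h0]) (fun p => by simp [h1])
  simp only [id, Bool.true_eq_false, if_false, one_mul] at this
  rw [← this]
  unfold invSign
  refine Finset.prod_congr rfl fun x _ => Finset.prod_congr rfl fun y _ => ?_
  congr 2
  apply propext
  obtain ⟨x', hx'⟩ := (intE h' n').surjective (f.int (intE h n x))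
  obtain ⟨y', hy'⟩ := (intE h' n').surjective (f.int (intE h n y))
  simp only [Equiv.trans_apply, ← hx', ← hy', intRank_intE, Equiv.symm_apply_apply]
  omega

/-- The typed form of an isomorphism of standard graphs. -/
theorem iso_edge (f : Iso (thetaGraph h n) (thetaGraph h' n')) :
    ∃ (e : Seg n → Seg n'), Function.Injective e ∧
      (∀ x, f.flip (edgeE h n (Sum.inr x)) = false) ∧
      ∀ p b, intE h' n' (segEnd n' (e p) (xor (f.flip (edgeE h n (Sum.inl p))) b)) =
        f.int (intE h n (segEnd n p b)) := by
  have hc : ∀ j b, Sum.map (extE h' n') (intE h' n')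
      (thetaEnd h' n' ((edgeE h' n').symm (f.edge (edgeE h n j))) (xor (f.flip (edgeE h n j)) b)) =
      Sum.map f.ext f.int (Sum.map (extE h n) (intE h n) (thetaEnd h n j b)) := by
    intro j b
    rw [← endpt_edgeE, ← endpt_edgeE, Equiv.apply_symm_apply, f.endpt_eq]
  have he : ∀ p, ∃ p', (edgeE h' n').symm (f.edge (edgeE h n (Sum.inl p))) = Sum.inl p' := by
    intro p
    have h1 := hc (Sum.inl p) (xor (f.flip (edgeE h n (Sum.inl p))) true)
    rw [← Bool.xor_assoc, Bool.xor_self, Bool.false_xor] at h1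
    rcases hp : (edgeE h' n').symm (f.edge (edgeE h n (Sum.inl p))) with p' | x
    · exact ⟨p', rfl⟩
    · rw [hp] at h1
      simp [thetaEnd] at h1
  choose e he using he
  refine ⟨e, fun p q hpq => ?_, fun x => ?_, fun p b => ?_⟩
  · have h1 := he p
    rw [hpq, ← he q] at h1
    simpa using h1
  · have h1 := hc (Sum.inr x) true
    rcases hx : (edgeE h' n').symm (f.edge (edgeE h n (Sum.inr x))) with p' | y
    · rw [hx] at h1
      simp [thetaEnd] at h1
    · rw [hx] at h1
      cases hfl : f.flip (edgeE h n (Sum.inr x))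
      · rfl
      · rw [hfl] at h1
        simp [thetaEnd] at h1
  · have h1 := hc (Sum.inl p) b
    rw [he] at h1
    simpa [thetaEnd] using h1

/-- An isomorphism maps the two trivalent vertices of the frame to such vertices. -/
theorem iso_inl (f : Iso (thetaGraph h n) (thetaGraph h' n')) (b : Bool) :
    ∃ c, f.int (intE h n (Sum.inl b)) = intE h' n' (Sum.inl c) := by
  obtain ⟨e, hinj, -, he⟩ := iso_edge f
  obtain ⟨c | q, hx⟩ := (intE h' n').surjective (f.int (intE h n (Sum.inl b)))
  · exact ⟨c, hx.symm⟩
  · exfalso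
    -- Otherwise the three segments at a trivalent vertex would be mapped injectively to the two
    -- segments at a bivalent one.
    have key : ∀ i, e (endSeg n b i) = ⟨q.1, q.2.le⟩ ∨
        e (endSeg n b i) = ⟨(q.1.1, q.1.2 + 1), q.2⟩ := by
      intro i
      have h1 := he (endSeg n b i) b
      rw [segEnd_endSeg, ← hx] at h1
      rcases segEnd_eq_mid ((intE h' n').injective h1) with h2 | h2
      · exact Or.inl (congrArg Prod.fst h2)
      · exact Or.inr (congrArg Prod.fst h2)
    have hne : ∀ i j : Fin 3, i ≠ j → e (endSeg n b i) ≠ e (endSeg n b j) := fun i j hij h1 =>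
      hij (endSeg_injective b (hinj h1))
    have h01 := hne 0 1 (by decide)
    have h02 := hne 0 2 (by decide)
    have h12 := hne 1 2 (by decide)
    have k0 := key 0
    have k1 := key 1
    have k2 := key 2
    grind

/-- An isomorphism of standard graphs fixing the vertex `inl false` is a permutation of the arcs. -/
theorem iso_fix {m N : ℕ} (hm : Even m) (hN : Odd N)
    (f : Iso (thetaGraph h n) (thetaGraph h' n'))
    (hf : f.int (intE h n (Sum.inl false)) = intE h' n' (Sum.inl false)) :
    ∃ π : Equiv.Perm (Fin 3), n = n' ∘ π ∧ f.sign m N = arcSign π n := by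
  obtain ⟨e, hinj, hflx, he⟩ := iso_edge f
  have hft : f.int (intE h n (Sum.inl true)) = intE h' n' (Sum.inl true) := by
    obtain ⟨c, hc⟩ := iso_inl f true
    cases c
    · rw [← hf] at hc
      simp at hc
    · exact hc
  have hstart : ∀ i, f.flip (edgeE h n (Sum.inl (endSeg n false i))) = false ∧
      e (endSeg n false i) = endSeg n' false (e (endSeg n false i)).1.1 := by
    intro i
    have h1 := he (endSeg n false i) false
    rw [segEnd_endSeg, hf] at h1
    have h2 := segEnd_eq_inl ((intE h' n').injective h1)
    exact ⟨by simpa using h2.1, h2.2⟩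
  let π0 : Fin 3 → Fin 3 := fun i => (e (endSeg n false i)).1.1
  have hπ0 : Function.Injective π0 := fun i j hij => by
    refine endSeg_injective (n := n) false (hinj ?_)
    rw [(hstart i).2, (hstart j).2]
    exact congrArg _ hij
  let π : Equiv.Perm (Fin 3) := Equiv.ofBijective π0 (Finite.injective_iff_bijective.1 hπ0)
  -- The isomorphism is followed along an arc: the segment after the current one must go to the
  -- other segment at the image vertex.
  have key : ∀ i t (ht : t ≤ n i), f.flip (edgeE h n (Sum.inl ⟨(i, t), ht⟩)) = false ∧
      ∃ ht' : t ≤ n' (π i), e ⟨(i, t), ht⟩ = ⟨(π i, t), ht'⟩ := by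
    intro i t
    induction t with
    | zero => exact fun ht => ⟨(hstart i).1, Nat.zero_le _, (hstart i).2⟩
    | succ t ih =>
      intro ht
      obtain ⟨hfl, ht', hE⟩ := ih (by omega)
      have h1 := he ⟨(i, t), Nat.le_of_succ_le ht⟩ true
      rw [hfl, hE] at h1
      have h2 : segEnd n ⟨(i, t), Nat.le_of_succ_le ht⟩ true = Sum.inr ⟨(i, t), ht⟩ := pos_succ ht
      rw [h2] at h1
      -- The image arc cannot end here, since its last vertex is already the image of `inl true`.
      have hlt : t < n' (π i) := by
        refine lt_of_le_of_ne ht' fun hteq => ?_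
        have h3 : segEnd n' ⟨(π i, t), ht'⟩ (xor false true) = Sum.inl true :=
          pos_last (n := n') (i := π i) hteq.ge
        rw [h3, ← hft] at h1
        simp at h1
      have h3 : segEnd n' ⟨(π i, t), ht'⟩ (xor false true) = Sum.inr ⟨(π i, t), hlt⟩ := pos_succ hlt
      rw [h3] at h1
      have h4 := he ⟨(i, t + 1), ht⟩ false
      have h5 : segEnd n ⟨(i, t + 1), ht⟩ false = Sum.inr ⟨(i, t), ht⟩ := pos_succ ht
      rw [h5, ← h1] at h4
      rcases segEnd_eq_mid ((intE h' n').injective h4) with h6 | h6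
      · have h7 := hinj ((congrArg Prod.fst h6).trans hE.symm)
        simp at h7
      · exact ⟨by simpa using congrArg Prod.snd h6, hlt, congrArg Prod.fst h6⟩
  have hn : n = n' ∘ π := by
    funext i
    obtain ⟨hfl, ht', hE⟩ := key i (n i) le_rfl
    refine le_antisymm ht' (not_lt.1 fun hlt => ?_)
    have h1 := he ⟨(i, n i), le_rfl⟩ true
    rw [hfl, hE] at h1
    have h2 : segEnd n ⟨(i, n i), le_rfl⟩ true = Sum.inl true := pos_last le_rfl
    have h3 : segEnd n' ⟨(π i, n i), ht'⟩ (xor false true) = Sum.inr ⟨(π i, n i), hlt⟩ :=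
      pos_succ (n := n') (i := π i) hlt
    rw [h2, h3, hft] at h1
    simp at h1
  refine ⟨π, hn, sign_of_perm hm hN f π hn ?_ ?_ ?_⟩
  · rintro (⟨⟨i, t⟩, ht⟩ | x)
    · exact (key i t ht).1
    · exact hflx x
  · rintro (_ | _)
    · exact hf
    · exact hft
  · rintro ⟨⟨i, t⟩, ht⟩
    dsimp only at ht
    obtain ⟨hfl, ht', hE⟩ := key i t ht.le
    have h1 := he ⟨(i, t), ht.le⟩ true
    rw [hfl, hE] at h1
    have h2 : segEnd n ⟨(i, t), ht.le⟩ true = Sum.inr ⟨(i, t), ht⟩ := pos_succ ht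
    have hlt : t < n' (π i) := by rw [hn] at ht; exact ht
    have h3 : segEnd n' ⟨(π i, t), ht'⟩ (xor false true) = Sum.inr ⟨(π i, t), hlt⟩ := pos_succ hlt
    rw [h2, h3] at h1
    exact h1.symm

/-! ### Relations between the standard graphs: permuted arcs and the reflection -/

/-- Permutation of the arcs. -/
def arcEquiv (π : Equiv.Perm (Fin 3)) (hn : n = n' ∘ π) : Mid n ≃ Mid n' where
  toFun p := ⟨(π p.1.1, p.1.2), by have := p.2; subst hn; exact this⟩
  invFun p := ⟨(π.symm p.1.1, p.1.2), by have := p.2; subst hn; simpa using this⟩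
  left_inv p := by simp
  right_inv p := by simp

def segPerm (π : Equiv.Perm (Fin 3)) (hn : n = n' ∘ π) : Seg n ≃ Seg n' where
  toFun p := ⟨(π p.1.1, p.1.2), by have := p.2; subst hn; exact this⟩
  invFun p := ⟨(π.symm p.1.1, p.1.2), by have := p.2; subst hn; simpa using this⟩
  left_inv p := by simp
  right_inv p := by simp

def innPerm (π : Equiv.Perm (Fin 3)) (hn : n = n' ∘ π) : Inn n ≃ Inn n' :=
  Equiv.sumCongr (Equiv.refl _) (arcEquiv π hn)

theorem innPerm_pos (π : Equiv.Perm (Fin 3)) (hn : n = n' ∘ π) (i : Fin 3) (t : ℕ) :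
    innPerm π hn (pos n i t) = pos n' (π i) t := by
  have hi : n i = n' (π i) := by rw [hn]; rfl
  rcases t with _ | t
  · rfl
  · by_cases ht : t < n i
    · rw [pos_succ ht, pos_succ (hi ▸ ht)]
      rfl
    · rw [pos_last (by omega), pos_last (by omega)]
      rfl

/-- The bijection of hairs induced by a bijection of vertices. -/
def hairEquiv (a : Inn n ≃ Inn n') (ha : ∀ x, hairFlag h n x = hairFlag h' n' (a x)) :
    Hair h n ≃ Hair h' n' := a.subtypeEquiv fun x => by rw [ha]

/-- The isomorphism of standard graphs given by bijections of vertices and segments. -/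
def isoOfInn (a : Inn n ≃ Inn n') (ha : ∀ x, hairFlag h n x = hairFlag h' n' (a x))
    (e : Seg n ≃ Seg n') (c : Bool) (he : ∀ p b, segEnd n' (e p) (xor c b) = a (segEnd n p b)) :
    Iso (thetaGraph h n) (thetaGraph h' n') :=
  thetaIso ((hairEquiv a ha).trans (extE h' n')) (a.trans (intE h' n'))
    ((Equiv.sumCongr e (hairEquiv a ha)).trans (edgeE h' n'))
    (Sum.elim (fun _ => c) fun _ => false) (by
      rintro (p | x) b <;> rw [Equiv.trans_apply, endpt_edgeE]
      · simp [thetaEnd, he]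
      · cases b <;> simp [thetaEnd, hairEquiv])

theorem isoOfInn_int (a : Inn n ≃ Inn n') (ha : ∀ x, hairFlag h n x = hairFlag h' n' (a x))
    (e : Seg n ≃ Seg n') (c : Bool) (he : ∀ p b, segEnd n' (e p) (xor c b) = a (segEnd n p b))
    (x : Inn n) : (isoOfInn a ha e c he).int (intE h n x) = intE h' n' (a x) := by
  simp [isoOfInn, thetaIso]

theorem isoOfInn_flip (a : Inn n ≃ Inn n') (ha : ∀ x, hairFlag h n x = hairFlag h' n' (a x))
    (e : Seg n ≃ Seg n') (c : Bool) (he : ∀ p b, segEnd n' (e p) (xor c b) = a (segEnd n p b))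
    (j : Seg n ⊕ Hair h n) : (isoOfInn a ha e c he).flip (edgeE h n j) =
      (Sum.elim (fun _ => c) fun _ => false : Seg n ⊕ Hair h n → Bool) j := by
  simp [isoOfInn, thetaIso]

theorem cls_perm {m N : ℕ} (hm : Even m) (hN : Odd N) (h : Bool → Bool) (π : Equiv.Perm (Fin 3))
    (hn : n = n' ∘ π) : cls m N (thetaGraph h n) =
      ((arcSign π n : ℤ) : ℚ) • cls m N (thetaGraph h n') := by
  have ha : ∀ x, hairFlag h n x = hairFlag h n' (innPerm π hn x) := by rintro (b | p) <;> rfl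
  have he : ∀ p b, segEnd n' (segPerm π hn p) (xor false b) = innPerm π hn (segEnd n p b) := by
    intro p b
    rw [segEnd.eq_1 n, innPerm_pos, Bool.false_xor]
    rfl
  rw [cls_eq_of_iso m N (isoOfInn _ ha _ _ he), sign_of_perm hm hN _ π hn]
  · intro j
    rw [isoOfInn_flip]
    rcases j with p | x <;> rfl
  · intro b
    rw [isoOfInn_int]
    rfl
  · intro p
    rw [isoOfInn_int]
    rfl

/-- Reflection of the arcs. -/
def innFlip (n : Fin 3 → ℕ) : Inn n ≃ Inn n where
  toFun := Sum.map not fun p => ⟨(p.1.1, n p.1.1 - 1 - p.1.2), by have := p.2; dsimp only; omega⟩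
  invFun := Sum.map not fun p => ⟨(p.1.1, n p.1.1 - 1 - p.1.2), by have := p.2; dsimp only; omega⟩
  left_inv := by
    rintro (b | ⟨⟨i, t⟩, ht⟩)
    · simp
    · simp only [Sum.map_inr, Sum.inr.injEq, Subtype.mk.injEq, Prod.mk.injEq, true_and]
      dsimp only at ht
      omega
  right_inv := by
    rintro (b | ⟨⟨i, t⟩, ht⟩)
    · simp
    · simp only [Sum.map_inr, Sum.inr.injEq, Subtype.mk.injEq, Prod.mk.injEq, true_and]
      dsimp only at ht
      omega

def segFlip (n : Fin 3 → ℕ) : Seg n ≃ Seg n where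
  toFun p := ⟨(p.1.1, n p.1.1 - p.1.2), Nat.sub_le _ _⟩
  invFun p := ⟨(p.1.1, n p.1.1 - p.1.2), Nat.sub_le _ _⟩
  left_inv p := Subtype.ext (Prod.ext rfl (Nat.sub_sub_self p.2))
  right_inv p := Subtype.ext (Prod.ext rfl (Nat.sub_sub_self p.2))

theorem innFlip_pos (i : Fin 3) {t : ℕ} (ht : t ≤ n i + 1) :
    innFlip n (pos n i t) = pos n i (n i + 1 - t) := by
  rcases t with _ | t
  · rw [Nat.sub_zero, pos_last le_rfl]
    rfl
  · rcases (Nat.le_of_succ_le_succ ht).lt_or_eq with ht' | rfl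
    · obtain ⟨k, hk⟩ := Nat.exists_eq_add_of_lt ht'
      rw [pos_succ ht', show n i + 1 - (t + 1) = k + 1 by omega, pos_succ (by omega)]
      simp only [innFlip, Equiv.coe_fn_mk, Sum.map_inr]
      congr 3
      omega
    · rw [pos_last le_rfl, Nat.sub_self]
      rfl

/-- The reflection of a standard graph. -/
def thetaFlip (h : Bool → Bool) (n : Fin 3 → ℕ) :
    Iso (thetaGraph h n) (thetaGraph (fun b => h (!b)) n) :=
  isoOfInn (innFlip n) (by rintro (b | p) <;> simp [hairFlag, innFlip]) (segFlip n) true (by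
    rintro ⟨⟨i, t⟩, ht⟩ b
    rw [segEnd, segEnd, innFlip_pos]
    · dsimp only at ht
      cases b
      · simp [segFlip, Nat.sub_add_comm ht]
      · simp [segFlip]
    · dsimp only at ht ⊢
      have := b.toNat_lt
      omega)

theorem prod_fin_lt (k : ℕ) : (∏ t : Fin k, ∏ s : Fin k, if (t : ℕ) < s then -1 else 1 : ℤˣ) =
    (-1) ^ (k * (k - 1) / 2) := by
  rw [Finset.prod_comm, ← Finset.sum_range_id, ← Finset.prod_pow_eq_pow_sum, Finset.prod_range]
  refine Finset.prod_congr rfl fun s _ => ?_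
  rw [← Finset.prod_filter, Finset.prod_const]
  congr 1
  have : (Finset.univ.filter fun t : Fin k => (t : ℕ) < s) = Finset.Iio s := by
    ext; simp
  rw [this, Fin.card_Iio]

/-- Three contributions: reversing the `∑ i, n i + 3` segments gives `-∏ i, (-1) ^ n i`, exchanging
the two trivalent vertices gives `-1`, and reversing the vertices inside the arc `i` gives `(-1) ^
(n i * (n i - 1) / 2)`. Hairs are not reversed. -/
theorem sign_thetaFlip {m N : ℕ} (hm : Even m) (hN : Odd N) (h : Bool → Bool) (n : Fin 3 → ℕ) :
    (thetaFlip h n).sign m N = flipSign n := by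
  rw [sign_theta hm hN]
  have h1 : (∏ j, if (thetaFlip h n).flip (edgeE h n j) then -1 else 1 : ℤˣ) =
      - ∏ i, (-1) ^ n i := by
    simp only [thetaFlip, isoOfInn_flip, Fintype.prod_sum_type, Sum.elim_inl, Sum.elim_inr,
      Bool.false_eq_true, if_false, if_true, Finset.prod_const_one, mul_one, Finset.prod_const,
      Finset.card_univ, card_seg, Finset.prod_pow_eq_pow_sum]
    rw [pow_add, pow_succ, neg_one_sq, one_mul, mul_neg_one]
  have h2 : invSign (innRank n) (fun x => (thetaGraph (fun b => h (!b)) n).intRank x)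
      ((intE h n).trans (thetaFlip h n).int) = invSign (innRank n) (innRank n) (innFlip n) := by
    unfold invSign
    refine Finset.prod_congr rfl fun x _ => Finset.prod_congr rfl fun y _ => ?_
    congr 2
    apply propext
    simp only [Equiv.trans_apply, thetaFlip, isoOfInn_int, intRank_intE]
    omega
  rw [h1, h2, invSign_inn (innFlip n) not _ (fun _ => rfl) (fun _ => rfl)]
  simp only [Bool.not_true, if_true]
  rw [prod_mid_mid fun i t j s => if (i < j ∨ i = j ∧ t < s) ∧
    (j < i ∨ j = i ∧ n j - 1 - s < n i - 1 - t) then -1 else 1]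
  have h3 : ∀ i : Fin 3, (∏ t : Fin (n i), ∏ j, ∏ s : Fin (n j),
      if (i < j ∨ i = j ∧ (t : ℕ) < s) ∧ (j < i ∨ j = i ∧ n j - 1 - s < n i - 1 - t)
        then -1 else 1 : ℤˣ) = (-1) ^ (n i * (n i - 1) / 2) := by
    intro i
    rw [← prod_fin_lt]
    refine Finset.prod_congr rfl fun t _ => ?_
    rw [Finset.prod_eq_single i]
    · refine Finset.prod_congr rfl fun s _ => ?_
      congr 1
      apply propext
      have := t.2
      have := s.2
      simp only [lt_irrefl, false_or, true_and]
      omega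
    · intro j _ hj
      refine Finset.prod_eq_one fun s _ => if_neg ?_
      rintro ⟨h4 | h4, h5 | h5⟩
      · exact absurd h4 h5.not_gt
      · exact hj h5.1
      · exact hj h4.1.symm
      · exact hj h5.1
    · simp
  rw [Finset.prod_congr rfl fun i _ => h3 i, neg_one_mul, neg_mul_neg, ← Finset.prod_mul_distrib]
  refine Finset.prod_congr rfl fun i _ => ?_
  rw [← pow_add]
  congr 1
  rcases n i with _ | k
  · rfl
  · rw [Nat.add_sub_cancel, show (k + 1) * (k + 1 + 1) = (k + 1) * k + (k + 1) * 2 by ring,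
      Nat.add_mul_div_right _ _ two_pos, add_comm]

theorem cls_flip {m N : ℕ} (hm : Even m) (hN : Odd N) (h : Bool → Bool) (n : Fin 3 → ℕ) :
    cls m N (thetaGraph h n) =
      ((flipSign n : ℤ) : ℚ) • cls m N (thetaGraph (fun b => h (!b)) n) := by
  rw [cls_eq_of_iso m N (thetaFlip h n), sign_thetaFlip hm hN]

/-! ### The differential on standard graphs -/

namespace OGraph

theorem expand_endpt_zero (G : OGraph) (x : Fin G.numInt) (S : Finset G.HalfEdge) (b : Bool) :
    (G.expand x S).endpt (0 : Fin (G.numEdge + 1)) b =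
      if b then Sum.inr (0 : Fin (G.numInt + 1)) else Sum.inr x.succ := rfl

theorem expand_endpt_succ (G : OGraph) (x : Fin G.numInt) (S : Finset G.HalfEdge) (j : G.Edge)
    (b : Bool) : (G.expand x S).endpt (Fin.succ j) b =
      if (j, b) ∈ S then Sum.inr (0 : Fin (G.numInt + 1)) else Sum.map id Fin.succ (G.endpt j b) :=
  rfl

/-- Exchanging the two ends of the new edge of an expansion. -/
def expandSwap (G : OGraph) (x : Fin G.numInt) {S : Finset G.HalfEdge}
    (hS : S ⊆ G.halfEdgesAt (Sum.inr x)) :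
    Iso (G.expand x S) (G.expand x (G.halfEdgesAt (Sum.inr x) \ S)) where
  ext := Equiv.refl _
  int := Equiv.swap (0 : Fin (G.numInt + 1)) x.succ
  edge := Equiv.refl _
  flip := Fin.cases true fun _ => false
  endpt_eq := by
    intro j b
    change Fin (G.numEdge + 1) at j
    induction j using Fin.cases with
    | zero =>
      change (G.expand x (G.halfEdgesAt (Sum.inr x) \ S)).endpt (0 : Fin (G.numEdge + 1))
        (xor true b) = Sum.map (Equiv.refl _) (Equiv.swap (0 : Fin (G.numInt + 1)) x.succ)
          ((G.expand x S).endpt (0 : Fin (G.numEdge + 1)) b)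
      rw [expand_endpt_zero, expand_endpt_zero]
      cases b
      · exact congrArg Sum.inr (Equiv.swap_apply_right _ _).symm
      · exact congrArg Sum.inr (Equiv.swap_apply_left _ _).symm
    | succ j =>
      have hA : (j, b) ∈ G.halfEdgesAt (Sum.inr x) ↔ G.endpt j b = Sum.inr x := by
        simp [halfEdgesAt]
      change (G.expand x (G.halfEdgesAt (Sum.inr x) \ S)).endpt (Fin.succ j) (xor false b) =
        Sum.map (Equiv.refl _) (Equiv.swap (0 : Fin (G.numInt + 1)) x.succ)
          ((G.expand x S).endpt (Fin.succ j) b)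
      rw [Bool.false_xor, expand_endpt_succ, expand_endpt_succ]
      by_cases h1 : (j, b) ∈ S
      · have h2 := hA.1 (hS h1)
        rw [if_neg (fun h => (Finset.mem_sdiff.1 h).2 h1), if_pos h1, h2]
        exact congrArg Sum.inr (Equiv.swap_apply_left _ _).symm
      · rw [if_neg h1]
        by_cases h2 : G.endpt j b = Sum.inr x
        · rw [if_pos (Finset.mem_sdiff.2 ⟨hA.2 h2, h1⟩), h2]
          exact congrArg Sum.inr (Equiv.swap_apply_right _ _).symm
        · rw [if_neg (fun h => h2 (hA.1 (Finset.mem_sdiff.1 h).1))]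
          rcases h3 : G.endpt j b with a | y
          · rfl
          · refine congrArg Sum.inr (Equiv.swap_apply_of_ne_of_ne ?_ ?_).symm
            · exact Fin.succ_ne_zero y
            · exact fun h => h2 (by rw [h3, Fin.succ_injective _ h])

/-- The new edge is reversed and two odd vertices are transposed; the two signs cancel. Hence `S`
and its complement give the same class, as the factor `1 / 2` in `bdry` presumes. -/
theorem sign_expandSwap {m N : ℕ} (hm : Even m) (hN : Odd N) (G : OGraph) (x : Fin G.numInt)
    {S : Finset G.HalfEdge} (hS : S ⊆ G.halfEdgesAt (Sum.inr x)) :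
    (G.expandSwap x hS).sign m N = 1 := by
  rw [Iso.sign_eq hm hN]
  have h1 : (∏ j, if (G.expandSwap x hS).flip j then -1 else 1 : ℤˣ) = -1 := by
    refine (Fin.prod_univ_succ
      (fun j : Fin (G.numEdge + 1) => if (G.expandSwap x hS).flip j then -1 else 1)).trans ?_
    change (-1 : ℤˣ) * ∏ i : Fin G.numEdge, (if false = true then -1 else 1) = -1
    simp
  have h2 : invSign (G.expand x S).intRank (G.expand x (G.halfEdgesAt (Sum.inr x) \ S)).intRank
      (G.expandSwap x hS).int = -1 := by
    refine (invSign_perm (α := Fin (G.numInt + 1)) (G.expand x S).intRank_injective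
      (Equiv.swap 0 x.succ)).trans ?_
    exact Equiv.Perm.sign_swap (Fin.succ_ne_zero x).symm
  rw [h1, h2]
  rfl

/-- The sum of the expansions of a vertex; each unordered splitting is counted twice. -/
def expSum (m N : ℕ) (G : OGraph) (x : Fin G.numInt) : Space m N :=
  ∑ S ∈ G.splittings x, cls m N (G.expand x S)

theorem diff_eq_expSum (m N : ℕ) (G : OGraph) :
    diff m N (cls m N G) = (1 / 2 : ℚ) • ∑ x, expSum m N G x := by
  rw [diff_cls, bdry, map_smul, map_sum]
  simp only [map_sum]
  rfl

theorem expSum_iso (m N : ℕ) {G G' : OGraph} (f : Iso G G') (x : Fin G.numInt) :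
    expSum m N G x = ((f.sign m N : ℤ) : ℚ) • expSum m N G' (f.int x) := by
  unfold expSum
  rw [Finset.smul_sum]
  refine Finset.sum_equiv f.half.finsetCongr (fun S => ?_) (fun S _ => ?_)
  · simpa using f.mem_splittings x S
  · rw [cls_eq_of_iso m N (f.expand x S), f.sign_expand]
    rfl

/-- Both parts of a splitting need at least two half-edges, so only vertices of valence at least
four can be expanded. -/
theorem expSum_eq_zero (m N : ℕ) {G : OGraph} {x : Fin G.numInt}
    (hx : (G.halfEdgesAt (Sum.inr x)).card ≤ 3) : expSum m N G x = 0 := by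
  refine Finset.sum_eq_zero fun S hS => ?_
  exfalso
  simp only [splittings, Finset.mem_filter, Finset.mem_powerset] at hS
  have := Finset.card_sdiff_add_card_eq_card hS.1
  omega

end OGraph

/-- The admissible parts of a set of four elements are its two-element subsets. Those containing `a`
are the sets `{a, v i}`, and their complements are the others. In the application `a` is the
half-edge of the hair and the `v i` start the three arcs. -/
theorem sum_splittings {α M : Type*} [DecidableEq α] [AddCommMonoid M] (a : α) (v : Fin 3 → α)
    (hv : Function.Injective v) (ha : ∀ i, v i ≠ a) (f : Finset α → M)
    (hf : ∀ S ⊆ insert a (Finset.univ.image v), f S = f (insert a (Finset.univ.image v) \ S)) :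
    (∑ S ∈ (insert a (Finset.univ.image v)).powerset.filter fun S =>
      2 ≤ S.card ∧ 2 ≤ (insert a (Finset.univ.image v) \ S).card, f S) =
      2 • ∑ i, f {a, v i} := by
  set A := insert a (Finset.univ.image v) with hA
  have hAc : A.card = 4 := by
    rw [hA, Finset.card_insert_of_notMem (by simpa using ha), Finset.card_image_of_injective _ hv]
    simp
  have haA : a ∈ A := Finset.mem_insert_self _ _
  have hvA : ∀ i, v i ∈ A := fun i => by simp [hA]
  set F := A.powerset.filter fun S => 2 ≤ S.card ∧ 2 ≤ (A \ S).card with hF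
  have hmem : ∀ S, S ∈ F ↔ S ⊆ A ∧ S.card = 2 := by
    intro S
    simp only [hF, Finset.mem_filter, Finset.mem_powerset]
    refine and_congr_right fun hS => ?_
    have := Finset.card_sdiff_add_card_eq_card hS
    omega
  have h1 : ∑ S ∈ F with a ∈ S, f S = ∑ i, f {a, v i} := by
    symm
    refine Finset.sum_bij (fun i _ => {a, v i}) ?_ ?_ ?_ (fun _ _ => rfl)
    · intro i _
      rw [Finset.mem_filter, hmem]
      refine ⟨⟨?_, Finset.card_pair (ha i).symm⟩, by simp⟩
      intro x hx
      simp only [Finset.mem_insert, Finset.mem_singleton] at hx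
      rcases hx with rfl | rfl
      · exact haA
      · exact hvA i
    · intro i _ j _ hij
      have : v i ∈ ({a, v j} : Finset α) := by rw [← hij]; simp
      simp only [Finset.mem_insert, Finset.mem_singleton] at this
      exact hv (this.resolve_left (ha i))
    · intro S hS
      rw [Finset.mem_filter, hmem] at hS
      obtain ⟨⟨hSA, hSc⟩, haS⟩ := hS
      obtain ⟨w, hw⟩ := Finset.card_eq_one.1 (by rw [Finset.card_erase_of_mem haS, hSc] :
        (S.erase a).card = 1)
      have hwS : w ∈ S.erase a := by rw [hw]; simp
      have hwA := hSA (Finset.mem_of_mem_erase hwS)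
      rw [hA, Finset.mem_insert] at hwA
      obtain ⟨i, -, rfl⟩ := Finset.mem_image.1 (hwA.resolve_left (Finset.ne_of_mem_erase hwS))
      refine ⟨i, Finset.mem_univ _, ?_⟩
      rw [← hw, Finset.insert_erase haS]
  have h2 : ∑ S ∈ F with a ∉ S, f S = ∑ S ∈ F with a ∈ S, f S := by
    refine Finset.sum_nbij' (fun S => A \ S) (fun S => A \ S) ?_ ?_ ?_ ?_ ?_
    · intro S hS
      rw [Finset.mem_filter, hmem] at hS ⊢
      have := Finset.card_sdiff_add_card_eq_card hS.1.1
      exact ⟨⟨Finset.sdiff_subset, by omega⟩, Finset.mem_sdiff.2 ⟨haA, hS.2⟩⟩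
    · intro S hS
      rw [Finset.mem_filter, hmem] at hS ⊢
      have := Finset.card_sdiff_add_card_eq_card hS.1.1
      exact ⟨⟨Finset.sdiff_subset, by omega⟩, fun h => (Finset.mem_sdiff.1 h).2 hS.2⟩
    · intro S hS
      rw [Finset.mem_filter, hmem] at hS
      exact Finset.sdiff_sdiff_eq_self hS.1.1
    · intro S hS
      rw [Finset.mem_filter, hmem] at hS
      exact Finset.sdiff_sdiff_eq_self hS.1.1
    · intro S hS
      rw [Finset.mem_filter, hmem] at hS
      exact hf S hS.1.1
  rw [← Finset.sum_filter_add_sum_filter_not F (fun S => a ∈ S), h2, h1, two_smul]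

/-! ### Adding a hair at the beginning of an arc as a vertex expansion -/

/-- The graph obtained by adding a hair on the arc `i`. -/
abbrev addHair (n : Fin 3 → ℕ) (i : Fin 3) : Fin 3 → ℕ := n + Pi.single i 1

theorem addHair_apply (n : Fin 3 → ℕ) (i j : Fin 3) :
    addHair n i j = n j + (Pi.single i 1 : Fin 3 → ℕ) j := rfl

theorem lt_single {i j : Fin 3} {t : ℕ} (ht : t < (Pi.single i 1 : Fin 3 → ℕ) j) :
    j = i ∧ t = 0 := by
  by_cases hj : j = i
  · subst hj
    simpa using ht
  · simp [hj] at ht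

/-- The interior vertices after adding a hair at the beginning of the arc `i`. -/
def midAdd (n : Fin 3 → ℕ) (i : Fin 3) : Mid (addHair n i) ≃ Option (Mid n) where
  toFun p := if hp : p.1.2 < (Pi.single i 1 : Fin 3 → ℕ) p.1.1 then none else
    some ⟨(p.1.1, p.1.2 - (Pi.single i 1 : Fin 3 → ℕ) p.1.1), by
      have := p.2; rw [addHair_apply] at this; dsimp only; omega⟩
  invFun q := q.elim ⟨(i, 0), by simp⟩ fun q =>
    ⟨(q.1.1, q.1.2 + (Pi.single i 1 : Fin 3 → ℕ) q.1.1), by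
      have := q.2; rw [addHair_apply]; dsimp only; omega⟩
  left_inv p := by
    obtain ⟨⟨j, t⟩, ht⟩ := p
    dsimp only
    split_ifs with hp
    · obtain ⟨rfl, rfl⟩ := lt_single hp
      rfl
    · refine Subtype.ext (Prod.ext rfl ?_)
      exact Nat.sub_add_cancel (not_lt.1 hp)
  right_inv q := by
    rcases q with _ | ⟨⟨j, t⟩, ht⟩ <;> simp

/-- The edges after adding a hair at the beginning of the arc `i`. -/
def segAdd (n : Fin 3 → ℕ) (i : Fin 3) : Seg (addHair n i) ≃ Option (Seg n) where
  toFun p := if hp : p.1.2 < (Pi.single i 1 : Fin 3 → ℕ) p.1.1 then none else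
    some ⟨(p.1.1, p.1.2 - (Pi.single i 1 : Fin 3 → ℕ) p.1.1), by
      have := p.2; rw [addHair_apply] at this; dsimp only; omega⟩
  invFun q := q.elim ⟨(i, 0), by simp⟩ fun q =>
    ⟨(q.1.1, q.1.2 + (Pi.single i 1 : Fin 3 → ℕ) q.1.1), by
      have := q.2; rw [addHair_apply]; dsimp only; omega⟩
  left_inv p := by
    obtain ⟨⟨j, t⟩, ht⟩ := p
    dsimp only
    split_ifs with hp
    · obtain ⟨rfl, rfl⟩ := lt_single hp
      rfl
    · refine Subtype.ext (Prod.ext rfl ?_)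
      exact Nat.sub_add_cancel (not_lt.1 hp)
  right_inv q := by
    rcases q with _ | ⟨⟨j, t⟩, ht⟩ <;> simp

/-- The vertices after adding a hair at the beginning of the arc `i`. -/
def innAdd (n : Fin 3 → ℕ) (i : Fin 3) : Inn (addHair n i) ≃ Option (Inn n) where
  toFun := Sum.elim (fun b => some (Sum.inl b)) fun p => (midAdd n i p).map Sum.inr
  invFun q := q.elim (Sum.inr ((midAdd n i).symm none))
    (Sum.map id fun q => (midAdd n i).symm (some q))
  left_inv := by
    rintro (b | p)
    · rfl
    · obtain ⟨q, rfl⟩ := (midAdd n i).symm.surjective p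
      rcases q with _ | q <;> simp
  right_inv := by
    rintro (_ | b | q) <;> simp

theorem innAdd_pos_succ (i j : Fin 3) (t : ℕ) :
    (innAdd n i).symm (some (pos n j (t + 1))) =
      pos (addHair n i) j (t + 1 + (Pi.single i 1 : Fin 3 → ℕ) j) := by
  rw [add_right_comm]
  by_cases ht : t < n j
  · rw [pos_succ ht, pos_succ (by rw [addHair_apply]; omega)]
    rfl
  · rw [pos_last (by omega), pos_last (by rw [addHair_apply]; omega)]
    rfl

theorem innAdd_pos_zero {i j : Fin 3} (hj : j ≠ i) :
    (innAdd n i).symm (some (pos n j 0)) =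
      pos (addHair n i) j (0 + (Pi.single i 1 : Fin 3 → ℕ) j) := by
  rw [Pi.single_eq_of_ne hj]
  rfl

theorem innAdd_none (i : Fin 3) : (innAdd n i).symm none = pos (addHair n i) i 1 := by
  rw [pos_succ (by simp)]
  rfl

/-- The flags with the hair at `inl false` removed. -/
def dropHair (h : Bool → Bool) : Bool → Bool := fun b => b && h b

theorem hairFlag_some (i : Fin 3) (y : Inn n) (hy : y ≠ Sum.inl false) :
    hairFlag (dropHair h) (addHair n i) ((innAdd n i).symm (some y)) = hairFlag h n y := by
  rcases y with (_ | _) | q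
  · exact absurd rfl hy
  · rfl
  · rfl

/-- The hair at `inl false` becomes the new hair on the arc `i`. -/
def hairAdd (hf : h false = true) (n : Fin 3 → ℕ) (i : Fin 3) :
    Hair (dropHair h) (addHair n i) ≃ Hair h n where
  -- The default value serves the new vertex: its hair is the one that `inl false` has lost.
  toFun x := ⟨(innAdd n i x.1).getD (Sum.inl false), by
    obtain ⟨x, hx⟩ := x
    obtain ⟨y, rfl⟩ := (innAdd n i).symm.surjective x
    rw [Equiv.apply_symm_apply]
    rcases y with _ | y
    · exact hf
    · by_cases hy : y = Sum.inl false
      · subst hy; exact hf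
      · rwa [hairFlag_some i y hy] at hx⟩
  invFun y := if hy : y.1 = Sum.inl false then ⟨(innAdd n i).symm none, rfl⟩ else
    ⟨(innAdd n i).symm (some y.1), by rw [hairFlag_some i _ hy]; exact y.2⟩
  left_inv x := by
    obtain ⟨x, hx⟩ := x
    obtain ⟨y, rfl⟩ := (innAdd n i).symm.surjective x
    rcases y with _ | y
    · simp
    · have hy : y ≠ Sum.inl false := by
        rintro rfl
        exact absurd hx (by simp [innAdd, hairFlag, dropHair])
      simp [hy]
  right_inv y := by
    obtain ⟨y, hy⟩ := y
    by_cases h1 : y = Sum.inl false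
    · subst h1; simp
    · simp [h1]

theorem hairAdd_symm_coe (hf : h false = true) (i : Fin 3) (y : Hair h n) :
    ((hairAdd hf n i).symm y).1 =
      (innAdd n i).symm (if y.1 = Sum.inl false then none else some y.1) := by
  change (dite _ _ _ : Hair (dropHair h) (addHair n i)).1 = _
  split_ifs <;> rfl

/-- The edges after adding a hair at the beginning of the arc `i`. -/
def edgeAdd (hf : h false = true) (n : Fin 3 → ℕ) (i : Fin 3) :
    Seg (addHair n i) ⊕ Hair (dropHair h) (addHair n i) ≃ Option (Seg n ⊕ Hair h n) where
  toFun := Sum.elim (fun p => (segAdd n i p).map Sum.inl) fun x => some (Sum.inr (hairAdd hf n i x))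
  invFun q := q.elim (Sum.inl ((segAdd n i).symm none))
    (Sum.map (fun p => (segAdd n i).symm (some p)) (hairAdd hf n i).symm)
  left_inv := by
    rintro (p | x)
    · obtain ⟨q, rfl⟩ := (segAdd n i).symm.surjective p
      rcases q with _ | q <;> simp
    · simp
  right_inv := by
    rintro (_ | p | x) <;> simp

/-- The half-edges moved in the expansion that puts the hair at `inl false` on the arc `i`. -/
def moveSet (hf : h false = true) (n : Fin 3 → ℕ) (i : Fin 3) :
    Finset (thetaGraph h n).HalfEdge :=
  {(edgeE h n (Sum.inr ⟨Sum.inl false, hf⟩), false), (edgeE h n (Sum.inl (endSeg n false i)), false)}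

def succOption {α : Type*} {k : ℕ} (e : α ≃ Fin k) : Option α ≃ Fin (k + 1) :=
  (Equiv.optionCongr e).trans (finSuccEquiv k).symm

@[simp] theorem succOption_none {α : Type*} {k : ℕ} (e : α ≃ Fin k) : succOption e none = 0 := by
  simp [succOption]

@[simp] theorem succOption_some {α : Type*} {k : ℕ} (e : α ≃ Fin k) (a : α) :
    succOption e (some a) = (e a).succ := by
  simp [succOption]

/-- Expanding the vertex `inl false` moves its hair to one of the arcs. -/
def expandIso (hf : h false = true) (n : Fin 3 → ℕ) (i : Fin 3) :
    Iso (thetaGraph (dropHair h) (addHair n i))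
      ((thetaGraph h n).expand (intE h n (Sum.inl false)) (moveSet hf n i)) :=
  thetaIso (G := (thetaGraph h n).expand (intE h n (Sum.inl false)) (moveSet hf n i))
    ((hairAdd hf n i).trans (extE h n))
    ((innAdd n i).trans (succOption (intE h n)))
    ((edgeAdd hf n i).trans (succOption (edgeE h n))) (fun _ => false) (by
      intro j b
      obtain ⟨k, rfl⟩ := (edgeAdd hf n i).symm.surjective j
      rw [Bool.false_xor]
      change ((thetaGraph h n).expand (intE h n (Sum.inl false)) (moveSet hf n i)).endpt
        (succOption (edgeE h n) (edgeAdd hf n i ((edgeAdd hf n i).symm k))) b = _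
      rw [Equiv.apply_symm_apply]
      -- The cases are the new edge, which becomes the first segment of the arc `i`, the old
      -- segments, and the hairs.
      rcases k with _ | ⟨⟨⟨j, t⟩, ht⟩⟩ | y
      · rw [succOption_none]
        refine (expand_endpt_zero _ _ _ _).trans ?_
        cases b
        · change Sum.inr _ = Sum.inr (succOption (intE h n) (innAdd n i (Sum.inl false)))
          rw [show innAdd n i (Sum.inl false) = some (Sum.inl false) from rfl, succOption_some]
        · change Sum.inr _ = Sum.inr (succOption (intE h n) (innAdd n i (pos _ i 1)))
          rw [← innAdd_none, Equiv.apply_symm_apply, succOption_none]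
      · rw [succOption_some]
        refine (expand_endpt_succ _ _ _ _ _).trans ?_
        have hS : (edgeE h n (Sum.inl ⟨(j, t), ht⟩), b) ∈ moveSet hf n i ↔
            (j = i ∧ t = 0) ∧ b = false := by
          simp [moveSet, endSeg]
        change _ = Sum.inr (succOption (intE h n) (innAdd n i (pos (addHair n i) j
          (t + (Pi.single i 1 : Fin 3 → ℕ) j + b.toNat))))
        rw [endpt_edgeE]
        change ite _ _ (Sum.inr (intE h n (pos n j (t + b.toNat))).succ) = _
        by_cases h1 : (j = i ∧ t = 0) ∧ b = false
        · rw [if_pos (hS.2 h1)]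
          obtain ⟨⟨rfl, rfl⟩, rfl⟩ := h1
          rw [Pi.single_eq_same, show 0 + 1 + false.toNat = 1 from rfl, ← innAdd_none,
            Equiv.apply_symm_apply, succOption_none]
        · rw [if_neg (fun h => h1 (hS.1 h)), add_right_comm]
          -- An end that has not been moved is shifted by one on the arc `i`. It is not the starting
          -- point of that arc, since the half-edge there was moved.
          have h2 : (innAdd n i).symm (some (pos n j (t + b.toNat))) =
              pos (addHair n i) j (t + b.toNat + (Pi.single i 1 : Fin 3 → ℕ) j) := by
            rcases h3 : t + b.toNat with _ | s
            · apply innAdd_pos_zero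
              rintro rfl
              apply h1
              cases b
              · exact ⟨⟨rfl, by omega⟩, rfl⟩
              · simp at h3
            · exact innAdd_pos_succ i j s
          rw [← h2, Equiv.apply_symm_apply, succOption_some]
      · rw [succOption_some]
        refine (expand_endpt_succ _ _ _ _ _).trans ?_
        have hS : (edgeE h n (Sum.inr y), b) ∈ moveSet hf n i ↔
            y.1 = Sum.inl false ∧ b = false := by
          simp [moveSet, Subtype.ext_iff]
        rw [endpt_edgeE]
        cases b
        · change ite _ _ (Sum.inr (intE h n y.1).succ) =
            Sum.inr (succOption (intE h n) (innAdd n i ((hairAdd hf n i).symm y).1))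
          rw [hairAdd_symm_coe, Equiv.apply_symm_apply]
          by_cases h1 : y.1 = Sum.inl false
          · rw [if_pos (hS.2 ⟨h1, rfl⟩), if_pos h1, succOption_none]
          · rw [if_neg (fun h => h1 (hS.1 h).1), if_neg h1, succOption_some]
        · rw [if_neg (fun h => by simpa using (hS.1 h).2)]
          change Sum.inl (extE h n y) = Sum.inl (extE h n (hairAdd hf n i ((hairAdd hf n i).symm y)))
          rw [Equiv.apply_symm_apply])

/-- The sign with which a hair is added at the beginning of the arc `i`. -/
def leftSign (n : Fin 3 → ℕ) (i : Fin 3) : ℤˣ := ∏ j, if j < i then (-1) ^ n j else 1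

theorem innAdd_lt_iff (i : Fin 3) (x y : Inn n) :
    innRank (addHair n i) ((innAdd n i).symm (some x)) <
      innRank (addHair n i) ((innAdd n i).symm (some y)) ↔ innRank n x < innRank n y := by
  rcases x with b | p <;> rcases y with c | q
  · rfl
  · exact iff_of_true (innRank_inl_lt_inr _ _) (innRank_inl_lt_inr _ _)
  · exact iff_of_false (innRank_inl_lt_inr _ _).not_gt (innRank_inl_lt_inr _ _).not_gt
  · change innRank (addHair n i) (Sum.inr ((midAdd n i).symm (some p))) <
      innRank (addHair n i) (Sum.inr ((midAdd n i).symm (some q))) ↔ _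
    rw [innRank_mid_lt, innRank_mid_lt]
    change (p.1.1 < q.1.1 ∨ p.1.1 = q.1.1 ∧ p.1.2 + (Pi.single i 1 : Fin 3 → ℕ) p.1.1 <
      q.1.2 + (Pi.single i 1 : Fin 3 → ℕ) q.1.1) ↔ _
    refine or_congr_right (and_congr_right fun h1 => ?_)
    rw [h1]
    omega

/-- In the expansion the new vertex comes first; in the standard order it stands behind the two
trivalent vertices, whose signs cancel, and behind the vertices of the arcs `j < i`. The new edge
already has the standard direction. -/
theorem sign_expandIso {m N : ℕ} (hm : Even m) (hN : Odd N) (hf : h false = true)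
    (n : Fin 3 → ℕ) (i : Fin 3) : (expandIso hf n i).sign m N = leftSign n i := by
  rw [sign_theta hm hN]
  have h1 : ∀ j, (expandIso hf n i).flip (edgeE _ _ j) = false := fun _ => rfl
  simp only [h1, Bool.false_eq_true, if_false, Finset.prod_const_one, one_mul]
  have hit : ∀ q, (expandIso hf n i).int (intE _ _ ((innAdd n i).symm q)) =
      succOption (intE h n) q := by
    intro q
    change succOption (intE h n) (innAdd n i ((intE _ _).symm (intE _ _ _))) = _
    rw [Equiv.symm_apply_apply, Equiv.apply_symm_apply]
  have hr0 : ((thetaGraph h n).expand (intE h n (Sum.inl false)) (moveSet hf n i)).intRank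
      (0 : Fin ((thetaGraph h n).numInt + 1)) = 0 := rfl
  have hrs : ∀ y : Inn n, ((thetaGraph h n).expand (intE h n (Sum.inl false))
      (moveSet hf n i)).intRank (Fin.succ (intE h n y)) = 3 * innRank n y + 3 := by
    intro y
    change (thetaGraph h n).intRank (intE h n y) + 2 = _
    rw [intRank_intE]
  unfold invSign
  rw [← Fintype.prod_equiv (innAdd n i).symm _ _ fun q => rfl, Fintype.prod_option]
  simp only [← Fintype.prod_equiv (innAdd n i).symm _ _ fun q => rfl, Fintype.prod_option,
    Equiv.trans_apply, hit, succOption_none, succOption_some, hr0, hrs, innAdd_lt_iff]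
  have h2 : ∀ x y : Inn n, ¬ (innRank n x < innRank n y ∧
    3 * innRank n y + 3 < 3 * innRank n x + 3) := fun x y => by omega
  simp only [h2, Nat.not_lt_zero, and_false, if_false, Finset.prod_const_one, mul_one, one_mul,
    Nat.zero_lt_succ, and_true]
  rw [Fintype.prod_sum_type, Fintype.prod_bool]
  have h3 : ∀ b, innRank (addHair n i) ((innAdd n i).symm (some (Sum.inl b))) <
      innRank (addHair n i) ((innAdd n i).symm none) := fun b => innRank_inl_lt_inr _ _
  have h4 : ∀ p : Mid n, innRank (addHair n i) ((innAdd n i).symm (some (Sum.inr p))) <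
      innRank (addHair n i) ((innAdd n i).symm none) ↔ p.1.1 < i := by
    intro p
    change innRank (addHair n i) (Sum.inr ((midAdd n i).symm (some p))) <
      innRank (addHair n i) (Sum.inr ((midAdd n i).symm none)) ↔ _
    rw [innRank_mid_lt]
    change (p.1.1 < i ∨ p.1.1 = i ∧ _ < 0) ↔ _
    simp
  simp only [h3, h4, if_true]
  rw [prod_mid fun j _ => if j < i then -1 else 1, leftSign]
  simp only [Finset.prod_const, Finset.card_univ, Fintype.card_fin]
  rw [show (-1 : ℤˣ) * -1 = 1 from rfl, one_mul]
  exact Finset.prod_congr rfl fun j _ => by split_ifs <;> simp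

theorem halfEdgesAt_inl_true (hf : h false = true) (n : Fin 3 → ℕ) :
    (thetaGraph h n).halfEdgesAt (Sum.inr (intE h n (Sum.inl false))) =
      insert (edgeE h n (Sum.inr ⟨Sum.inl false, hf⟩), false)
        (Finset.univ.image fun i => (edgeE h n (Sum.inl (endSeg n false i)), false)) := by
  ext ⟨j, b⟩
  obtain ⟨j, rfl⟩ := (edgeE h n).surjective j
  rw [mem_halfEdgesAt_int]
  rcases j with p | y
  · simp only [thetaEnd, Sum.elim_inl, Sum.inr.injEq, Finset.mem_insert, Prod.mk.injEq,
      (edgeE h n).injective.eq_iff, Finset.mem_image, Finset.mem_univ, true_and, reduceCtorEq,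
      false_and, false_or, Sum.inl.injEq]
    constructor
    · intro hp
      obtain ⟨rfl, h2⟩ := segEnd_eq_inl hp
      exact ⟨_, h2.symm, rfl⟩
    · rintro ⟨i, rfl, rfl⟩
      exact segEnd_endSeg _ _
  · cases b <;> simp [thetaEnd, Subtype.ext_iff]

theorem card_halfEdgesAt_mid (q : Mid n) :
    ((thetaGraph h n).halfEdgesAt (Sum.inr (intE h n (Sum.inr q)))).card ≤ 3 := by
  classical
  have : (thetaGraph h n).halfEdgesAt (Sum.inr (intE h n (Sum.inr q))) ⊆
      {(edgeE h n (Sum.inl ⟨q.1, q.2.le⟩), true),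
        (edgeE h n (Sum.inl ⟨(q.1.1, q.1.2 + 1), q.2⟩), false),
        (edgeE h n (Sum.inr ⟨Sum.inr q, rfl⟩), false)} := by
    rintro ⟨j, b⟩ hj
    obtain ⟨j, rfl⟩ := (edgeE h n).surjective j
    rw [mem_halfEdgesAt_int] at hj
    rcases j with p | y
    · rcases segEnd_eq_mid (Sum.inr_injective hj) with h1 | h1
      all_goals
        rw [Prod.mk.injEq] at h1
        obtain ⟨rfl, rfl⟩ := h1
        simp
    · cases b
      · have : y = ⟨Sum.inr q, rfl⟩ := Subtype.ext (by simpa [thetaEnd] using hj)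
        subst this
        simp
      · simp [thetaEnd] at hj
  exact (Finset.card_le_card this).trans Finset.card_le_three

theorem card_halfEdgesAt_inl {b : Bool} (hb : h b = false) (n : Fin 3 → ℕ) :
    ((thetaGraph h n).halfEdgesAt (Sum.inr (intE h n (Sum.inl b)))).card ≤ 3 := by
  classical
  have : (thetaGraph h n).halfEdgesAt (Sum.inr (intE h n (Sum.inl b))) ⊆
      Finset.univ.image fun i => (edgeE h n (Sum.inl (endSeg n b i)), b) := by
    rintro ⟨j, c⟩ hj
    obtain ⟨j, rfl⟩ := (edgeE h n).surjective j
    rw [mem_halfEdgesAt_int] at hj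
    rcases j with p | ⟨y, hy⟩
    · obtain ⟨rfl, h2⟩ := segEnd_eq_inl (Sum.inr_injective hj)
      rw [h2]
      simp
    · cases c
      · have hyb : y = Sum.inl b := by simpa [thetaEnd] using hj
        subst hyb
        exact absurd (hb.symm.trans hy) (by simp)
      · simp [thetaEnd] at hj
  refine (Finset.card_le_card this).trans (Finset.card_image_le.trans ?_)
  simp

theorem expSum_inl_false {m N : ℕ} (hm : Even m) (hN : Odd N) (hf : h false = true)
    (n : Fin 3 → ℕ) : expSum m N (thetaGraph h n) (intE h n (Sum.inl false)) =
      (2 : ℚ) • ∑ i, ((leftSign n i : ℤ) : ℚ) •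
        cls m N (thetaGraph (dropHair h) (addHair n i)) := by
  have hA := halfEdgesAt_inl_true hf n
  unfold expSum splittings
  have hswap : ∀ S ⊆ (thetaGraph h n).halfEdgesAt (Sum.inr (intE h n (Sum.inl false))),
      cls m N ((thetaGraph h n).expand (intE h n (Sum.inl false)) S) =
      cls m N ((thetaGraph h n).expand (intE h n (Sum.inl false))
        ((thetaGraph h n).halfEdgesAt (Sum.inr (intE h n (Sum.inl false))) \ S)) := by
    intro S hS
    rw [cls_eq_of_iso m N ((thetaGraph h n).expandSwap _ hS), sign_expandSwap hm hN]
    simp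
  rw [hA] at hswap ⊢
  rw [sum_splittings _ (fun i => (edgeE h n (Sum.inl (endSeg n false i)), false)) ?_ ?_
    (fun S => cls m N ((thetaGraph h n).expand (intE h n (Sum.inl false)) S)) hswap]
  · rw [two_smul, two_smul]
    have : ∀ i, cls m N ((thetaGraph h n).expand (intE h n (Sum.inl false))
        {(edgeE h n (Sum.inr ⟨Sum.inl false, hf⟩), false),
          (edgeE h n (Sum.inl (endSeg n false i)), false)}) =
        ((leftSign n i : ℤ) : ℚ) • cls m N (thetaGraph (dropHair h) (addHair n i)) := by
      intro i
      have h1 := cls_eq_of_iso m N (expandIso hf n i).symm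
      rw [Iso.sign_symm hm hN, sign_expandIso hm hN] at h1
      exact h1
    rw [Finset.sum_congr rfl fun i _ => this i]
  · intro i j hij
    exact endSeg_injective false (Sum.inl_injective ((edgeE h n).injective (congrArg Prod.fst hij)))
  · intro i
    simp

/-- The vertices inside the arcs have valence three, so only the two trivalent vertices of the frame
can contribute. -/
theorem diff_theta (m N : ℕ) (h : Bool → Bool) (n : Fin 3 → ℕ) :
    diff m N (cls m N (thetaGraph h n)) = (1 / 2 : ℚ) •
      (expSum m N (thetaGraph h n) (intE h n (Sum.inl true)) +
      expSum m N (thetaGraph h n) (intE h n (Sum.inl false))) := by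
  rw [diff_eq_expSum, ← Fintype.sum_equiv (intE h n) _ _ fun x => rfl, Fintype.sum_sum_type,
    Fintype.sum_bool]
  congr 1
  rw [add_eq_left]
  exact Finset.sum_eq_zero fun q _ => expSum_eq_zero m N (card_halfEdgesAt_mid q)

/-! ### The differential on the generators -/

/-- The classes of the standard graphs of defect zero. -/
def gen0 (m N : ℕ) (n : Fin 3 → ℕ) : Space m N := cls m N (thetaGraph (fun _ => false) n)

/-- The classes of the standard graphs of defect one with a hair at `inl false`. -/
def gen1 (m N : ℕ) (n : Fin 3 → ℕ) : Space m N := cls m N (thetaGraph not n)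

/-- The classes of the standard graphs of defect two. -/
def gen2 (m N : ℕ) (n : Fin 3 → ℕ) : Space m N := cls m N (thetaGraph (fun _ => true) n)

theorem diff_gen0 (m N : ℕ) (n : Fin 3 → ℕ) : diff m N (gen0 m N n) = 0 := by
  rw [gen0, diff_theta, expSum_eq_zero m N (card_halfEdgesAt_inl rfl n),
    expSum_eq_zero m N (card_halfEdgesAt_inl rfl n)]
  simp

theorem diff_gen1 {m N : ℕ} (hm : Even m) (hN : Odd N) (n : Fin 3 → ℕ) :
    diff m N (gen1 m N n) = ∑ i, ((leftSign n i : ℤ) : ℚ) • gen0 m N (addHair n i) := by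
  have hd : dropHair not = fun _ => false := by funext b; cases b <;> rfl
  rw [gen1, diff_theta, expSum_eq_zero m N (card_halfEdgesAt_inl rfl n),
    expSum_inl_false hm hN rfl, zero_add, hd, smul_smul]
  norm_num
  rfl

/-- The reflection carries the expansions at `inl true` to those at `inl false`, whence the factor
`1 + flipSign n`. An expansion at `inl false` leaves the hair at `inl true`; a second reflection,
with the sign of the enlarged triple, brings it to the normal position used in `gen1`. -/
theorem diff_gen2 {m N : ℕ} (hm : Even m) (hN : Odd N) (n : Fin 3 → ℕ) :
    diff m N (gen2 m N n) = (1 + ((flipSign n : ℤ) : ℚ)) •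
      ∑ i, (((leftSign n i : ℤ) : ℚ) * ((flipSign (addHair n i) : ℤ) : ℚ)) •
        gen1 m N (addHair n i) := by
  have hd : dropHair (fun _ => true) = id := by funext b; cases b <;> rfl
  have h1 : expSum m N (thetaGraph (fun _ => true) n)
      (intE (fun _ => true) n (Sum.inl true)) = ((flipSign n : ℤ) : ℚ) •
      expSum m N (thetaGraph (fun _ => true) n) (intE (fun _ => true) n (Sum.inl false)) := by
    rw [expSum_iso m N (thetaFlip (fun _ => true) n), sign_thetaFlip hm hN]
    congr 2
    rw [thetaFlip, isoOfInn_int]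
    rfl
  rw [gen2, diff_theta, h1, expSum_inl_false hm hN rfl, hd]
  have h2 : ∀ i, cls m N (thetaGraph id (addHair n i)) =
      ((flipSign (addHair n i) : ℤ) : ℚ) • gen1 m N (addHair n i) := fun i => by
    rw [cls_flip hm hN]
    rfl
  simp only [h2, smul_smul]
  rw [← add_smul, smul_smul]
  congr 1
  ring

/-! ### Equivariant functions of three natural numbers -/

/-- Rational functions of three natural numbers. -/
abbrev Fn : Type := ℕ → ℕ → ℕ → ℚ

/-- The axioms for the sign `s a b` of exchanging arcs with `a` and `b` hairs and the sign `w a` of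
passing an arc with `a` hairs. -/
structure IsSignRule (s : ℕ → ℕ → ℚ) (w : ℕ → ℚ) : Prop where
  symm : ∀ a b, s a b = s b a
  mul_self : ∀ a b, s a b * s a b = 1
  wsq : ∀ a, w a * w a = 1
  succ : ∀ a b, s (a + 1) b = w b * s a b

/-- The functions supported in `P` that are multiplied by the signs `s` under exchange of adjacent
arguments. -/
def skewFn (s : ℕ → ℕ → ℚ) (P : ℕ → ℕ → ℕ → Prop) : Submodule ℚ Fn where
  carrier := {φ | (∀ a b c, φ a b c = s a b * φ b a c) ∧ (∀ a b c, φ a b c = s b c * φ a c b) ∧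
    ∀ a b c, φ a b c ≠ 0 → P a b c}
  zero_mem' := by simp
  add_mem' := by
    rintro φ ψ ⟨h1, h2, h3⟩ ⟨k1, k2, k3⟩
    refine ⟨fun a b c => ?_, fun a b c => ?_, fun a b c h => ?_⟩
    · simp only [Pi.add_apply, mul_add, ← h1, ← k1]
    · simp only [Pi.add_apply, mul_add, ← h2, ← k2]
    · by_contra hP
      have e1 : φ a b c = 0 := by_contra fun h => hP (h3 _ _ _ h)
      have e2 : ψ a b c = 0 := by_contra fun h => hP (k3 _ _ _ h)
      exact h (by simp [e1, e2])
  smul_mem' := by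
    rintro q φ ⟨h1, h2, h3⟩
    refine ⟨fun a b c => ?_, fun a b c => ?_, fun a b c h => h3 a b c (right_ne_zero_of_mul h)⟩
    · simp only [Pi.smul_apply, smul_eq_mul, mul_left_comm _ q, ← h1]
    · simp only [Pi.smul_apply, smul_eq_mul, mul_left_comm _ q, ← h2]

/-- The signed exchange of the first two arguments. -/
def swapL (s : ℕ → ℕ → ℚ) : Module.End ℚ Fn where
  toFun φ a b c := s a b * φ b a c
  map_add' φ ψ := by funext a b c; simp [mul_add]
  map_smul' q φ := by funext a b c; simp [mul_left_comm]

/-- The signed exchange of the last two arguments. -/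
def swapR (s : ℕ → ℕ → ℚ) : Module.End ℚ Fn where
  toFun φ a b c := s b c * φ a c b
  map_add' φ ψ := by funext a b c; simp [mul_add]
  map_smul' q φ := by funext a b c; simp [mul_left_comm]

/-- The sum of all signed permutations of the arguments. -/
def symSum (s : ℕ → ℕ → ℚ) : Module.End ℚ Fn :=
  1 + swapL s + swapR s + swapL s * swapR s + swapR s * swapL s + swapL s * swapR s * swapL s

/-- The dual of adding a hair. -/
def addDual (w : ℕ → ℚ) : Module.End ℚ Fn where
  toFun φ a b c := φ (a + 1) b c + w a * φ a (b + 1) c + w a * w b * φ a b (c + 1)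
  map_add' φ ψ := by funext a b c; simp only [Pi.add_apply]; ring
  map_smul' q φ := by funext a b c; simp only [Pi.smul_apply, smul_eq_mul, RingHom.id_apply]; ring

/-- The restriction of a function to the triples with a given sum. -/
def trunc (d : ℕ) : Module.End ℚ Fn where
  toFun φ a b c := if a + b + c = d then φ a b c else 0
  map_add' φ ψ := by funext a b c; simp only [Pi.add_apply]; split_ifs <;> simp
  map_smul' q φ := by funext a b c; simp

variable {s : ℕ → ℕ → ℚ} {w : ℕ → ℚ}

theorem swapL_mul_self (hs : IsSignRule s w) : swapL s * swapL s = 1 := by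
  ext φ a b c
  change s a b * (s b a * φ a b c) = φ a b c
  rw [hs.symm b a, ← mul_assoc, hs.mul_self, one_mul]

theorem swapR_mul_self (hs : IsSignRule s w) : swapR s * swapR s = 1 := by
  ext φ a b c
  change s b c * (s c b * φ a b c) = φ a b c
  rw [hs.symm c b, ← mul_assoc, hs.mul_self, one_mul]

theorem swap_braid : swapR s * swapL s * swapR s = swapL s * swapR s * swapL s := by
  ext φ a b c
  change s b c * (s a c * (s a b * φ c b a)) = s a b * (s a c * (s b c * φ c b a))
  ring

/-- The axiom `succ` matches the change of the exchange sign caused by one more hair with the sign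
of passing an arc. Thus `addDual` commutes with all signed permutations. -/
theorem addDual_swapL (hs : IsSignRule s w) : addDual w * swapL s = swapL s * addDual w := by
  ext φ a b c
  change s (a + 1) b * φ b (a + 1) c + w a * (s a (b + 1) * φ (b + 1) a c) +
      w a * w b * (s a b * φ b a (c + 1)) =
    s a b * (φ (b + 1) a c + w b * φ b (a + 1) c + w b * w a * φ b a (c + 1))
  rw [hs.symm a (b + 1), hs.succ, hs.succ, hs.symm b a]
  linear_combination (s a b * φ (b + 1) a c) * hs.wsq a

theorem addDual_swapR (hs : IsSignRule s w) : addDual w * swapR s = swapR s * addDual w := by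
  ext φ a b c
  change s b c * φ (a + 1) c b + w a * (s (b + 1) c * φ a c (b + 1)) +
      w a * w b * (s b (c + 1) * φ a (c + 1) b) =
    s b c * (φ (a + 1) c b + w a * φ a (c + 1) b + w a * w c * φ a c (b + 1))
  rw [hs.symm b (c + 1), hs.succ, hs.succ, hs.symm c b]
  linear_combination (w a * s b c * φ a (c + 1) b) * hs.wsq b

theorem swapL_symSum (hs : IsSignRule s w) : swapL s * symSum s = symSum s := by
  simp only [symSum, mul_add, mul_one, ← mul_assoc, swapL_mul_self hs, one_mul]
  abel

theorem swapR_symSum (hs : IsSignRule s w) : swapR s * symSum s = symSum s := by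
  simp only [symSum, mul_add, mul_one, ← mul_assoc, swapR_mul_self hs, one_mul, swap_braid]
  simp only [mul_assoc, swapL_mul_self hs, mul_one]
  abel

theorem addDual_symSum (hs : IsSignRule s w) : addDual w * symSum s = symSum s * addDual w := by
  have h1 := addDual_swapL hs
  have h2 := addDual_swapR hs
  have c1 : Commute (addDual w) (swapL s) := h1
  have c2 : Commute (addDual w) (swapR s) := h2
  exact (((((Commute.one_right _).add_right c1).add_right c2).add_right (c1.mul_right c2)).add_right
    (c2.mul_right c1)).add_right ((c1.mul_right c2).mul_right c1)

theorem symSum_apply (φ : Fn) (a b c : ℕ) : symSum s φ a b c = φ a b c + s a b * φ b a c +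
    s b c * φ a c b + s a b * (s a c * φ b c a) + s b c * (s a c * φ c a b) +
    s a b * (s a c * (s b c * φ c b a)) := rfl

theorem symSum_mem (hs : IsSignRule s w) {P : ℕ → ℕ → ℕ → Prop} (h1 : ∀ a b c, P a b c → P b a c)
    (h2 : ∀ a b c, P a b c → P a c b) {φ : Fn} (h : ∀ a b c, φ a b c ≠ 0 → P a b c) :
    symSum s φ ∈ skewFn s P := by
  refine ⟨fun a b c => ?_, fun a b c => ?_, fun a b c hne => ?_⟩
  · exact (congrFun (congrFun (congrFun (LinearMap.congr_fun (swapL_symSum hs) φ) a) b) c).symm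
  · exact (congrFun (congrFun (congrFun (LinearMap.congr_fun (swapR_symSum hs) φ) a) b) c).symm
  · by_contra hP
    have key : ∀ x y z, (P x y z → P a b c) → φ x y z = 0 := fun x y z hxyz =>
      by_contra fun hx => hP (hxyz (h _ _ _ hx))
    refine hne ?_
    rw [symSum_apply, key a b c id, key b a c (h1 _ _ _), key a c b (h2 _ _ _),
      key b c a fun h => h1 _ _ _ (h2 _ _ _ h), key c a b fun h => h2 _ _ _ (h1 _ _ _ h),
      key c b a fun h => h1 _ _ _ (h2 _ _ _ (h1 _ _ _ h))]
    simp

theorem symSum_of_mem {P : ℕ → ℕ → ℕ → Prop} {φ : Fn} (h : φ ∈ skewFn s P) :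
    symSum s φ = (6 : ℚ) • φ := by
  obtain ⟨h1, h2, -⟩ := h
  have e1 : swapL s φ = φ := by funext a b c; exact (h1 a b c).symm
  have e2 : swapR s φ = φ := by funext a b c; exact (h2 a b c).symm
  simp only [symSum, LinearMap.add_apply, Module.End.mul_apply, Module.End.one_apply, e1, e2]
  module

/-- The triples with sum `d`. -/
def HasSum3 (d a b c : ℕ) : Prop := a + b + c = d

theorem addDual_mem (hs : IsSignRule s w) {d : ℕ} {φ : Fn} (h : φ ∈ skewFn s (HasSum3 (d + 1))) :
    addDual w φ ∈ skewFn s (HasSum3 d) := by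
  obtain ⟨h1, h2, h3⟩ := h
  have e1 : swapL s φ = φ := by funext a b c; exact (h1 a b c).symm
  have e2 : swapR s φ = φ := by funext a b c; exact (h2 a b c).symm
  refine ⟨fun a b c => ?_, fun a b c => ?_, fun a b c hne => ?_⟩
  · have := LinearMap.congr_fun (addDual_swapL hs) φ
    rw [Module.End.mul_apply, e1] at this
    exact congrFun (congrFun (congrFun this a) b) c
  · have := LinearMap.congr_fun (addDual_swapR hs) φ
    rw [Module.End.mul_apply, e2] at this
    exact congrFun (congrFun (congrFun this a) b) c
  · by_contra hP
    have key : ∀ x y z, x + y + z = a + b + c + 1 → φ x y z = 0 := fun x y z hxyz =>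
      by_contra fun hx => hP (by have := h3 _ _ _ hx; unfold HasSum3 at *; omega)
    refine hne ?_
    change φ (a + 1) b c + w a * φ a (b + 1) c + w a * w b * φ a b (c + 1) = 0
    rw [key _ _ _ (by ring), key _ _ _ (by ring), key _ _ _ (by ring)]
    simp

/-- A right inverse of `addDual`. -/
def addDualInv (w : ℕ → ℚ) (φ : Fn) : Fn
  -- The values at first argument zero are free; the equation then determines all others.
  | 0, _, _ => 0
  | a + 1, b, c => φ a b c - (w a * addDualInv w φ a (b + 1) c +
      w a * w b * addDualInv w φ a b (c + 1))

theorem addDual_addDualInv (φ : Fn) : addDual w (addDualInv w φ) = φ := by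
  funext a b c
  change addDualInv w φ (a + 1) b c + w a * addDualInv w φ a (b + 1) c +
    w a * w b * addDualInv w φ a b (c + 1) = φ a b c
  rw [addDualInv]
  ring

theorem addDual_trunc (d : ℕ) (φ : Fn) : addDual w (trunc (d + 1) φ) = trunc d (addDual w φ) := by
  funext a b c
  have h1 : a + 1 + b + c = d + 1 ↔ a + b + c = d := by omega
  have h2 : a + (b + 1) + c = d + 1 ↔ a + b + c = d := by omega
  have h3 : a + b + (c + 1) = d + 1 ↔ a + b + c = d := by omega
  simp only [addDual, trunc, LinearMap.coe_mk, AddHom.coe_mk, h1, h2, h3]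
  split_ifs <;> simp

/-- `addDualInv` gives a preimage that need not be equivariant. Averaging over the six signed
permutations repairs this and keeps it a preimage, because `addDual` commutes with `symSum` and `φ`
is already equivariant. -/
theorem exists_addDual (hs : IsSignRule s w) {d : ℕ} {φ : Fn} (h : φ ∈ skewFn s (HasSum3 d)) :
    ∃ ψ ∈ skewFn s (HasSum3 (d + 1)), addDual w ψ = φ := by
  refine ⟨(1 / 6 : ℚ) • symSum s (trunc (d + 1) (addDualInv w φ)),
    Submodule.smul_mem _ _ (symSum_mem hs ?_ ?_ ?_), ?_⟩
  · intro a b c h; unfold HasSum3 at *; omega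
  · intro a b c h; unfold HasSum3 at *; omega
  · intro a b c hne
    by_contra hP
    exact hne (if_neg hP)
  · have ht : trunc d φ = φ := by
      funext a b c
      change (if a + b + c = d then φ a b c else 0) = φ a b c
      split_ifs with hd
      · rfl
      · exact (by_contra fun hx => hd (h.2.2 a b c (Ne.symm hx)))
    rw [map_smul, ← Module.End.mul_apply, addDual_symSum hs, Module.End.mul_apply, addDual_trunc,
      addDual_addDualInv, ht, symSum_of_mem h, smul_smul]
    norm_num

/-! ### Dimensions -/

/-- A triple ordered by `r` on which equivariant functions supported in `P` need not vanish. -/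
def IsCanon (s : ℕ → ℕ → ℚ) (r : ℕ → ℕ → Prop) (P : ℕ → ℕ → ℕ → Prop) (a b c : ℕ) : Prop :=
  r a b ∧ r b c ∧ P a b c ∧ (a = b → s a a = 1) ∧ (b = c → s b b = 1)

/-- The set of ordered triples. -/
def canonSet (s : ℕ → ℕ → ℚ) (r : ℕ → ℕ → Prop) (P : ℕ → ℕ → ℕ → Prop) : Set (ℕ × ℕ × ℕ) :=
  {t | IsCanon s r P t.1 t.2.1 t.2.2}

theorem canonSet_finite {r : ℕ → ℕ → Prop} {P : ℕ → ℕ → ℕ → Prop} {d : ℕ}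
    (hP : ∀ a b c, P a b c → a + b + c = d) : (canonSet s r P).Finite := by
  refine (Finset.finite_toSet (Finset.range (d + 1) ×ˢ Finset.range (d + 1) ×ˢ
    Finset.range (d + 1))).subset fun t ht => ?_
  have := hP _ _ _ ht.2.2.1
  simp only [Finset.coe_product, Set.mem_prod, Finset.coe_range, Set.mem_Iio]
  omega

/-- Evaluation of functions on the ordered triples. -/
def canonEval (s : ℕ → ℕ → ℚ) (r : ℕ → ℕ → Prop) (P : ℕ → ℕ → ℕ → Prop) :
    skewFn s P →ₗ[ℚ] (canonSet s r P → ℚ) where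
  toFun φ t := φ.1 t.1.1 t.1.2.1 t.1.2.2
  map_add' _ _ := rfl
  map_smul' _ _ := rfl

/-- Exchanges of neighbours sort any triple, and a sorted triple with a repeated entry of sign `-1`
forces the value zero. -/
theorem canonEval_injective {r : ℕ → ℕ → Prop} [Std.Total r]
    {P : ℕ → ℕ → ℕ → Prop} : Function.Injective (canonEval s r P) := by
  rw [← LinearMap.ker_eq_bot, LinearMap.ker_eq_bot']
  rintro ⟨φ, h1, h2, h3⟩ h0
  have key : ∀ a b c, r a b → r b c → φ a b c = 0 := by
    intro a b c hab hbc
    by_contra hne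
    refine hne (congrFun h0 ⟨(a, b, c), hab, hbc, h3 _ _ _ hne, ?_, ?_⟩)
    · intro e
      change a = b at e
      subst e
      exact (mul_left_eq_self₀.1 (h1 a a c).symm).resolve_right hne
    · intro e
      change b = c at e
      subst e
      exact (mul_left_eq_self₀.1 (h2 a b b).symm).resolve_right hne
  refine Subtype.ext ?_
  funext a b c
  change φ a b c = 0
  rcases Std.Total.total (r := r) a b with hab | hab <;>
    rcases Std.Total.total (r := r) b c with hbc | hbc <;>
    rcases Std.Total.total (r := r) a c with hac | hac
  · exact key _ _ _ hab hbc
  · exact key _ _ _ hab hbc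
  · rw [h2, key _ _ _ hac hbc, mul_zero]
  · rw [h2, h1, key _ _ _ hac hab, mul_zero, mul_zero]
  · rw [h1, key _ _ _ hab hac, mul_zero]
  · rw [h1, h2, key _ _ _ hbc hac, mul_zero, mul_zero]
  · rw [h1, h2, h1, key _ _ _ hbc hab, mul_zero, mul_zero, mul_zero]
  · rw [h1, h2, h1, key _ _ _ hbc hab, mul_zero, mul_zero, mul_zero]

/-- The prescribed values on the sorted triples are extended by zero and symmetrised. -/
theorem canonEval_surjective (hs : IsSignRule s w) {r : ℕ → ℕ → Prop} [Std.Antisymm r]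
    [IsTrans ℕ r]
    {P : ℕ → ℕ → ℕ → Prop} (h1 : ∀ a b c, P a b c → P b a c)
    (h2 : ∀ a b c, P a b c → P a c b) : Function.Surjective (canonEval s r P) := by
  classical
  intro g
  -- The weights `1 / 6`, `1 / 2` and `1` are the inverse orders of the stabilisers; they compensate
  -- for repeated terms in `symSum`.
  let G : Fn := fun a b c => if h : IsCanon s r P a b c then
    (if a = b then if b = c then 1 / 6 else 1 / 2 else if b = c then 1 / 2 else 1) *
      g ⟨(a, b, c), h⟩ else 0
  have hG : ∀ a b c, G a b c ≠ 0 → IsCanon s r P a b c := fun a b c h =>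
    by_contra fun hc => h (dif_neg hc)
  have hG0 : ∀ a b c, ¬ (r a b ∧ r b c) → G a b c = 0 := fun a b c h =>
    by_contra fun hc => h ⟨(hG a b c hc).1, (hG a b c hc).2.1⟩
  refine ⟨⟨symSum s G, symSum_mem hs h1 h2 fun a b c h => (hG a b c h).2.2.1⟩, ?_⟩
  funext ⟨⟨a, b, c⟩, hc⟩
  change symSum s G a b c = g ⟨(a, b, c), hc⟩
  have hGc : G a b c = (if a = b then if b = c then 1 / 6 else 1 / 2 else
      if b = c then 1 / 2 else 1) * g ⟨(a, b, c), hc⟩ := dif_pos hc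
  obtain ⟨rab, rbc, -, sab, sbc⟩ := id hc
  dsimp only at rab rbc sab sbc
  have rac : r a c := _root_.trans rab rbc
  have anti : ∀ {x y}, r x y → r y x → x = y := fun h h' => antisymm h h'
  rw [symSum_apply]
  by_cases hab : a = b
  · by_cases hbc : b = c
    · subst hab hbc
      rw [hGc, sab rfl, if_pos rfl, if_pos rfl]
      ring
    · subst hab
      have nca : ¬ r c a := fun h => hbc (anti rac h)
      rw [hG0 a c a (by tauto), hG0 c a a (by tauto), hGc, sab rfl, if_pos rfl, if_neg hbc]
      ring
  · have nba : ¬ r b a := fun h => hab (anti rab h)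
    have nca : ¬ r c a := fun h => hab (anti rab (_root_.trans rbc h))
    by_cases hbc : b = c
    · subst hbc
      rw [hG0 b a b (by tauto), hG0 b b a (by tauto), hGc, sbc rfl, if_neg hab, if_pos rfl]
      ring
    · have ncb : ¬ r c b := fun h => hbc (anti rbc h)
      rw [hG0 b a c (by tauto), hG0 a c b (by tauto), hG0 b c a (by tauto), hG0 c a b (by tauto),
        hG0 c b a (by tauto), hGc, if_neg hab, if_neg hbc]
      ring

/-- The order `r` is left open: `≤` suits the constant signs, while for the Koszul signs it is
convenient to put the odd entries first. -/
theorem finrank_skewFn (hs : IsSignRule s w) (r : ℕ → ℕ → Prop) [Std.Total r] [Std.Antisymm r]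
    [IsTrans ℕ r] {P : ℕ → ℕ → ℕ → Prop} {d : ℕ} (h1 : ∀ a b c, P a b c → P b a c)
    (h2 : ∀ a b c, P a b c → P a c b) (hP : ∀ a b c, P a b c → a + b + c = d) :
    Module.finrank ℚ (skewFn s P) = (canonSet s r P).ncard := by
  have := (canonSet_finite (s := s) (r := r) hP).fintype
  rw [(LinearEquiv.ofBijective (canonEval s r P)
    ⟨canonEval_injective, canonEval_surjective hs h1 h2⟩).finrank_eq,
    Module.finrank_fintype_fun_eq_card, Set.ncard_eq_toFinset_card', Set.toFinset_card]

theorem finite_skewFn {P : ℕ → ℕ → ℕ → Prop} {d : ℕ}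
    (hP : ∀ a b c, P a b c → a + b + c = d) : Module.Finite ℚ (skewFn s P) := by
  have := (canonSet_finite (s := s) (r := (· ≤ ·)) hP).fintype
  exact Module.Finite.of_injective (canonEval s (· ≤ ·) P) (canonEval_injective)

theorem finrank_map_add {V W : Type*} [AddCommGroup V] [Module ℚ V] [AddCommGroup W] [Module ℚ W]
    (f : V →ₗ[ℚ] W) (A : Submodule ℚ V) [Module.Finite ℚ A] :
    Module.finrank ℚ (A.map f) + Module.finrank ℚ ↥(A ⊓ LinearMap.ker f) = Module.finrank ℚ A := by
  rw [← (f.domRestrict A).finrank_range_add_finrank_ker, LinearMap.range_domRestrict,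
    LinearMap.ker_domRestrict, ← Submodule.map_comap_subtype]
  congr 1
  exact (Submodule.equivSubtypeMap A ((LinearMap.ker f).comap A.subtype)).finrank_eq.symm

/-- The dimension of the kernel of `addDual` in a given degree. -/
theorem finrank_ker_addDual (hs : IsSignRule s w) (d : ℕ) :
    Module.finrank ℚ (skewFn s (HasSum3 d)) +
      Module.finrank ℚ ↥(skewFn s (HasSum3 (d + 1)) ⊓ LinearMap.ker (addDual w)) =
      Module.finrank ℚ (skewFn s (HasSum3 (d + 1))) := by
  have := finite_skewFn (s := s) (P := HasSum3 (d + 1)) fun _ _ _ h => h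
  have e : skewFn s (HasSum3 d) = (skewFn s (HasSum3 (d + 1))).map (addDual w) := by
    ext φ
    exact ⟨fun h => exists_addDual hs h, by rintro ⟨ψ, hψ, rfl⟩; exact addDual_mem hs hψ⟩
  rw [e, finrank_map_add]

/-- Submodules that correspond under a linear map have the same dimension. -/
theorem finrank_eq_of_map {A B : Submodule ℚ Fn} (f : Fn →ₗ[ℚ] Fn) (h1 : ∀ x ∈ A, f x ∈ B)
    (h2 : ∀ x ∈ A, f x = 0 → x = 0) (h3 : ∀ y ∈ B, ∃ x ∈ A, f x = y) :
    Module.finrank ℚ A = Module.finrank ℚ B := by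
  refine (LinearEquiv.ofBijective (f.restrict h1) ⟨?_, ?_⟩).finrank_eq
  · rw [← LinearMap.ker_eq_bot, LinearMap.ker_eq_bot']
    rintro ⟨x, hx⟩ h0
    exact Subtype.ext (h2 x hx (congrArg Subtype.val h0))
  · rintro ⟨y, hy⟩
    obtain ⟨x, hx, rfl⟩ := h3 y hy
    exact ⟨⟨x, hx⟩, rfl⟩

/-! ### The kernel in the flip-invariant functions -/

/-- The sign of a transposition of two arcs. -/
def koszul (a b : ℕ) : ℚ := (-1) ^ (a * b)

/-- The sign of an arc. -/
def par (a : ℕ) : ℚ := (-1) ^ a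

theorem isSignRule_koszul : IsSignRule koszul par where
  symm a b := by rw [koszul, koszul, mul_comm]
  mul_self a b := by rw [koszul, ← mul_pow]; norm_num
  wsq a := by rw [par, ← mul_pow]; norm_num
  succ a b := by rw [koszul, koszul, par, ← pow_add]; ring

theorem isSignRule_one : IsSignRule 1 1 := by constructor <;> simp

theorem isSignRule_neg_one : IsSignRule (-1) 1 := by constructor <;> simp

@[simp] theorem par_even (x : ℕ) : par (2 * x) = 1 := by simp [par, pow_mul]

@[simp] theorem par_odd (x : ℕ) : par (2 * x + 1) = -1 := by simp [par, pow_mul, pow_succ]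

@[simp] theorem koszul_even_left (x b : ℕ) : koszul (2 * x) b = 1 := by
  simp [koszul, mul_assoc, pow_mul]

@[simp] theorem koszul_even_right (x b : ℕ) : koszul b (2 * x) = 1 := by
  rw [isSignRule_koszul.symm, koszul_even_left]

@[simp] theorem koszul_odd (x y : ℕ) : koszul (2 * x + 1) (2 * y + 1) = -1 := by
  rw [isSignRule_koszul.succ, koszul_even_left, par_odd, mul_one]

/-- Triangular numbers. -/
def tri (a : ℕ) : ℕ := a * (a + 1) / 2

theorem even_tri_even (x : ℕ) : tri (2 * x) % 2 = x % 2 := by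
  have : tri (2 * x) = x + 2 * (x * x) := by
    rw [tri]; refine Nat.div_eq_of_eq_mul_right two_pos ?_; ring
  omega

theorem even_tri_odd (x : ℕ) : tri (2 * x + 1) % 2 = (x + 1) % 2 := by
  have : tri (2 * x + 1) = (x + 1) + 2 * (x * (x + 1)) := by
    rw [tri]; refine Nat.div_eq_of_eq_mul_right two_pos ?_; ring
  omega

/-- The triples with sum `d` for which the flip of the two vertices has the sign `1`. -/
def EvenTri (d a b c : ℕ) : Prop := a + b + c = d ∧ Even (tri a + tri b + tri c)

/-- The flip-invariant equivariant functions that are killed by `addDual`. -/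
def kerFn (k : ℕ) : Submodule ℚ Fn := skewFn koszul (EvenTri k) ⊓ LinearMap.ker (addDual par)

theorem mem_kerFn {k : ℕ} {φ : Fn} : φ ∈ kerFn k ↔ φ ∈ skewFn koszul (EvenTri k) ∧
    ∀ a b c, φ (a + 1) b c + par a * φ a (b + 1) c + par a * par b * φ a b (c + 1) = 0 := by
  rw [kerFn, Submodule.mem_inf, LinearMap.mem_ker]
  refine and_congr_right fun _ => ⟨fun h a b c => congrFun (congrFun (congrFun h a) b) c,
    fun h => ?_⟩
  funext a b c
  exact h a b c

/-- Extension of a function from half-sums to triples with exactly one odd entry. -/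
def oneOdd : Module.End ℚ Fn where
  toFun φ a b c := if a % 2 + b % 2 + c % 2 = 1 then φ ((a + 1) / 2) ((b + 1) / 2) ((c + 1) / 2)
    else 0
  map_add' φ ψ := by funext a b c; simp only [Pi.add_apply]; split_ifs <;> simp
  map_smul' q φ := by funext a b c; simp

/-- Extension of a function from half-sums to triples with exactly two odd entries. -/
def twoOdd : Module.End ℚ Fn where
  toFun φ a b c := if a % 2 + b % 2 + c % 2 = 2 then
    (if b % 2 = 0 then -1 else 1) * φ (a / 2) (b / 2) (c / 2) else 0
  map_add' φ ψ := by funext a b c; simp only [Pi.add_apply, mul_add]; split_ifs <;> simp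
  map_smul' q φ := by
    funext a b c; simp only [Pi.smul_apply, smul_eq_mul, RingHom.id_apply]; split_ifs <;> ring

theorem cases_parity (a : ℕ) : ∃ x, a = 2 * x ∨ a = 2 * x + 1 := Nat.even_or_odd' a

/-- The kernel equation at three even entries is the unsigned equation for the halves. At two odd
entries it says that two values with the same halves agree. At one or three odd entries all terms
vanish. Koszul signs are trivial when at most one entry is odd. -/
theorem oneOdd_mem (j : ℕ) {φ : Fn} (h : φ ∈ skewFn 1 (HasSum3 (2 * j + 2)) ⊓
    LinearMap.ker (addDual 1)) : oneOdd φ ∈ kerFn (4 * j + 3) := by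
  obtain ⟨⟨h1, h2, h3⟩, h4⟩ := h
  have h4' : ∀ a b c, φ (a + 1) b c + φ a (b + 1) c + φ a b (c + 1) = 0 := fun a b c => by
    simpa [addDual] using congrFun (congrFun (congrFun (LinearMap.mem_ker.1 h4) a) b) c
  simp only [Pi.one_apply, one_mul] at h1 h2
  have e1 : ∀ x, (2 * x + 1) / 2 = x := fun x => by omega
  have e2 : ∀ x, (2 * x + 1 + 1) / 2 = x + 1 := fun x => by omega
  have e3 : ∀ x, (2 * x + 1 + 1 + 1) / 2 = x + 1 := fun x => by omega
  have e4 : ∀ x, (2 * x + 1) % 2 = 1 := fun x => by omega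
  have e5 : ∀ x, (2 * x + 1 + 1) % 2 = 0 := fun x => by omega
  refine mem_kerFn.2 ⟨⟨fun a b c => ?_, fun a b c => ?_, fun a b c hne => ?_⟩, fun a b c => ?_⟩
  · obtain ⟨x, rfl | rfl⟩ := cases_parity a <;> obtain ⟨y, rfl | rfl⟩ := cases_parity b <;>
      obtain ⟨z, rfl | rfl⟩ := cases_parity c <;> simp [oneOdd, e1, e2, e4, h1 _ (y + 1), h1 _ y]
  · obtain ⟨x, rfl | rfl⟩ := cases_parity a <;> obtain ⟨y, rfl | rfl⟩ := cases_parity b <;>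
      obtain ⟨z, rfl | rfl⟩ := cases_parity c <;> simp [oneOdd, e1, e2, e4, h2 _ _ z, h2 _ _ (z + 1)]
  · have hs : a % 2 + b % 2 + c % 2 = 1 := by_contra fun hc => hne (if_neg hc)
    have hf : φ ((a + 1) / 2) ((b + 1) / 2) ((c + 1) / 2) ≠ 0 := fun h0 =>
      hne ((if_pos hs).trans h0)
    have := h3 _ _ _ hf
    unfold HasSum3 at this
    rw [EvenTri, Nat.even_iff]
    obtain ⟨x, rfl | rfl⟩ := cases_parity a <;> obtain ⟨y, rfl | rfl⟩ := cases_parity b <;>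
      obtain ⟨z, rfl | rfl⟩ := cases_parity c <;>
      [have h' := even_tri_even x; have h' := even_tri_even x; have h' := even_tri_even x;
       have h' := even_tri_even x; have h' := even_tri_odd x; have h' := even_tri_odd x;
       have h' := even_tri_odd x; have h' := even_tri_odd x] <;>
      have h1 := even_tri_even y <;> have h2 := even_tri_even z <;> have h3 := even_tri_odd y <;>
      have h4 := even_tri_odd z <;> omega
  · have := h4' (a / 2) (b / 2) (c / 2)
    obtain ⟨x, rfl | rfl⟩ := cases_parity a <;> obtain ⟨y, rfl | rfl⟩ := cases_parity b <;>
      obtain ⟨z, rfl | rfl⟩ := cases_parity c <;> simp [oneOdd, e1, e2, e3, e4, e5] at this ⊢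
    exact this

/-- For the sum `4 * j + 3` exactly one entry is odd. The kernel equations at two odd entries show
that the value depends only on the entries halved and rounded up, which are symmetric arguments with
sum `2 * j + 2`. -/
theorem kerFn_three (j : ℕ) : Module.finrank ℚ (kerFn (4 * j + 3)) = Module.finrank ℚ
    ↥(skewFn 1 (HasSum3 (2 * j + 2)) ⊓ LinearMap.ker (addDual 1)) := by
  refine (finrank_eq_of_map oneOdd (fun φ h => oneOdd_mem j h) ?_ ?_).symm
  · rintro φ ⟨⟨h1, h2, h3⟩, -⟩ h0
    have h0' : ∀ a b c, oneOdd φ a b c = 0 := fun a b c => by rw [h0]; rfl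
    have e1 : ∀ x, (2 * x + 1 + 1) / 2 = x + 1 := fun x => by omega
    have e2 : ∀ x, (2 * x + 1) / 2 = x := fun x => by omega
    simp only [Pi.one_apply, one_mul] at h1 h2
    have key : ∀ a b c, φ (a + 1) b c = 0 := fun a b c => by
      have := h0' (2 * a + 1) (2 * b) (2 * c)
      simpa [oneOdd, e1, e2, Nat.add_mod] using this
    funext a b c
    change φ a b c = 0
    by_contra hne
    have := h3 _ _ _ hne
    unfold HasSum3 at this
    refine hne ?_
    obtain _ | a := a
    · obtain _ | b := b
      · obtain _ | c := c
        · omega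
        · rw [h2, h1]; exact key _ _ _
      · rw [h1]; exact key _ _ _
    · exact key _ _ _
  · intro φ hφ
    obtain ⟨⟨h1, h2, h3⟩, h4⟩ := mem_kerFn.1 hφ
    have z1 : ∀ a b c, φ a b c ≠ 0 → a % 2 + b % 2 + c % 2 = 1 := by
      intro a b c hne
      have := h3 _ _ _ hne
      rw [EvenTri, Nat.even_iff] at this
      by_contra hc
      have hs : a % 2 = 1 ∧ b % 2 = 1 ∧ c % 2 = 1 := by omega
      have h1 := even_tri_odd (a / 2)
      have h2 := even_tri_odd (b / 2)
      have h3 := even_tri_odd (c / 2)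
      rw [show 2 * (a / 2) + 1 = a by omega] at h1
      rw [show 2 * (b / 2) + 1 = b by omega] at h2
      rw [show 2 * (c / 2) + 1 = c by omega] at h3
      omega
    have z2 : ∀ a b c, a % 2 + b % 2 + c % 2 ≠ 1 → φ a b c = 0 := fun a b c h =>
      by_contra fun hne => h (z1 _ _ _ hne)
    have k1 : ∀ x y z, φ (2 * x + 1) (2 * (y + 1)) (2 * z) = φ (2 * (x + 1)) (2 * y + 1) (2 * z) := by
      intro x y z
      have := h4 (2 * x + 1) (2 * y + 1) (2 * z)
      rw [z2 (2 * x + 1) (2 * y + 1) (2 * z + 1) (by omega)] at this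
      simp only [par_odd] at this
      rw [show 2 * (x + 1) = 2 * x + 1 + 1 by ring, show 2 * (y + 1) = 2 * y + 1 + 1 by ring]
      linarith
    have k2 : ∀ x y z, φ (2 * x) (2 * y + 1) (2 * (z + 1)) = φ (2 * x) (2 * (y + 1)) (2 * z + 1) := by
      intro x y z
      have := h4 (2 * x) (2 * y + 1) (2 * z + 1)
      rw [z2 (2 * x + 1) (2 * y + 1) (2 * z + 1) (by omega)] at this
      simp only [par_odd, par_even] at this
      rw [show 2 * (y + 1) = 2 * y + 1 + 1 by ring, show 2 * (z + 1) = 2 * z + 1 + 1 by ring]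
      linarith
    have k3 : ∀ x y z, φ (2 * x + 1) (2 * y) (2 * (z + 1)) = φ (2 * (x + 1)) (2 * y) (2 * z + 1) := by
      intro x y z
      have := h4 (2 * x + 1) (2 * y) (2 * z + 1)
      rw [z2 (2 * x + 1) (2 * y + 1) (2 * z + 1) (by omega)] at this
      simp only [par_odd, par_even] at this
      rw [show 2 * (x + 1) = 2 * x + 1 + 1 by ring, show 2 * (z + 1) = 2 * z + 1 + 1 by ring]
      linarith
    -- The value at the halves is read off by lowering a nonzero doubled entry by one; by `k1`, `k2`
    -- and `k3` it does not matter which one. The value at `(0, 0, 0)` is zero, as that triple lies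
    -- outside the support.
    let F : Fn := fun x y z => if x = 0 then if y = 0 then if z = 0 then 0 else
      φ (2 * x) (2 * y) (2 * z - 1) else φ (2 * x) (2 * y - 1) (2 * z)
      else φ (2 * x - 1) (2 * y) (2 * z)
    have F1 : ∀ x y z, F (x + 1) y z = φ (2 * x + 1) (2 * y) (2 * z) := fun x y z => rfl
    have F2 : ∀ x y z, F x (y + 1) z = φ (2 * x) (2 * y + 1) (2 * z) := by
      rintro (_ | x) y z
      · rfl
      · exact k1 x y z
    have F3 : ∀ x y z, F x y (z + 1) = φ (2 * x) (2 * y) (2 * z + 1) := by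
      rintro (_ | x) (_ | y) z
      · rfl
      · exact k2 0 y z
      · exact k3 x 0 z
      · exact k3 x (y + 1) z
    have hF : oneOdd F = φ := by
      funext a b c
      by_cases hs : a % 2 + b % 2 + c % 2 = 1
      · change (if _ then _ else _) = _
        rw [if_pos hs]
        have e1 : ∀ x, (2 * x + 1 + 1) / 2 = x + 1 := fun x => by omega
        have e2 : ∀ x, (2 * x + 1) / 2 = x := fun x => by omega
        obtain ⟨x, rfl | rfl⟩ := cases_parity a <;> obtain ⟨y, rfl | rfl⟩ := cases_parity b <;>
          obtain ⟨z, rfl | rfl⟩ := cases_parity c <;> try omega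
        · rw [e1, e2, e2]; exact F3 x y z
        · rw [e1, e2, e2]; exact F2 x y z
        · rw [e1, e2, e2]; exact F1 x y z
      · rw [z2 _ _ _ hs]
        exact if_neg hs
    have F0 : F 0 0 0 = 0 := rfl
    refine ⟨F, ⟨⟨fun x y z => ?_, fun x y z => ?_, fun x y z hne => ?_⟩, ?_⟩, hF⟩
    · rw [Pi.one_apply, Pi.one_apply, one_mul]
      obtain _ | x := x
      · obtain _ | y := y
        · rfl
        · rw [F1, F2, h1, koszul_even_left, one_mul]
      · rw [F1, F2, h1, koszul_even_right, one_mul]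
    · rw [Pi.one_apply, Pi.one_apply, one_mul]
      obtain _ | y := y
      · obtain _ | z := z
        · rfl
        · rw [F2, F3, h2, koszul_even_left, one_mul]
      · rw [F2, F3, h2, koszul_even_right, one_mul]
    · unfold HasSum3
      obtain _ | x := x
      · obtain _ | y := y
        · obtain _ | z := z
          · exact absurd rfl hne
          · rw [F3] at hne
            have := (h3 _ _ _ hne).1
            omega
        · rw [F2] at hne
          have := (h3 _ _ _ hne).1
          omega
      · rw [F1] at hne
        have := (h3 _ _ _ hne).1
        omega
    · rw [SetLike.mem_coe, LinearMap.mem_ker]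
      funext x y z
      change F (x + 1) y z + 1 * F x (y + 1) z + 1 * 1 * F x y (z + 1) = 0
      have := h4 (2 * x) (2 * y) (2 * z)
      simp only [par_even] at this
      rw [F1, F2, F3, this]

/-- Now the unsigned equation arises at three odd entries, and the equations at one odd entry relate
the three positions of the even entry. The sign `-1` for an even middle entry absorbs the signs
`par`; two odd entries have Koszul sign `-1`, hence the alternating functions. -/
theorem twoOdd_mem (j : ℕ) {φ : Fn} (h : φ ∈ skewFn (-1) (HasSum3 (2 * j)) ⊓
    LinearMap.ker (addDual 1)) : twoOdd φ ∈ kerFn (4 * j + 2) := by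
  obtain ⟨⟨h1, h2, h3⟩, h4⟩ := h
  have h4' : ∀ a b c, φ (a + 1) b c + φ a (b + 1) c + φ a b (c + 1) = 0 := fun a b c => by
    simpa [addDual] using congrFun (congrFun (congrFun (LinearMap.mem_ker.1 h4) a) b) c
  simp only [Pi.neg_apply, Pi.one_apply, neg_mul, one_mul] at h1 h2
  have e1 : ∀ x, (2 * x + 1) / 2 = x := fun x => by omega
  have e2 : ∀ x, (2 * x + 1 + 1) / 2 = x + 1 := fun x => by omega
  have e4 : ∀ x, (2 * x + 1) % 2 = 1 := fun x => by omega
  have e5 : ∀ x, (2 * x + 1 + 1) % 2 = 0 := fun x => by omega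
  refine mem_kerFn.2 ⟨⟨fun a b c => ?_, fun a b c => ?_, fun a b c hne => ?_⟩, fun a b c => ?_⟩
  · obtain ⟨x, rfl | rfl⟩ := cases_parity a <;> obtain ⟨y, rfl | rfl⟩ := cases_parity b <;>
      obtain ⟨z, rfl | rfl⟩ := cases_parity c <;> simp [twoOdd, e1, e4, h1 _ y]
  · obtain ⟨x, rfl | rfl⟩ := cases_parity a <;> obtain ⟨y, rfl | rfl⟩ := cases_parity b <;>
      obtain ⟨z, rfl | rfl⟩ := cases_parity c <;> simp [twoOdd, e1, e4, h2 _ _ z]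
  · have hs : a % 2 + b % 2 + c % 2 = 2 := by_contra fun hc => hne (if_neg hc)
    have hf : φ (a / 2) (b / 2) (c / 2) ≠ 0 := fun h0 =>
      hne ((if_pos hs).trans (by rw [h0, mul_zero]))
    have := h3 _ _ _ hf
    unfold HasSum3 at this
    rw [EvenTri, Nat.even_iff]
    obtain ⟨x, rfl | rfl⟩ := cases_parity a <;> obtain ⟨y, rfl | rfl⟩ := cases_parity b <;>
      obtain ⟨z, rfl | rfl⟩ := cases_parity c <;>
      [have h' := even_tri_even x; have h' := even_tri_even x; have h' := even_tri_even x;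
       have h' := even_tri_even x; have h' := even_tri_odd x; have h' := even_tri_odd x;
       have h' := even_tri_odd x; have h' := even_tri_odd x] <;>
      have h1 := even_tri_even y <;> have h2 := even_tri_even z <;> have h3 := even_tri_odd y <;>
      have h4 := even_tri_odd z <;> omega
  · have := h4' (a / 2) (b / 2) (c / 2)
    obtain ⟨x, rfl | rfl⟩ := cases_parity a <;> obtain ⟨y, rfl | rfl⟩ := cases_parity b <;>
      obtain ⟨z, rfl | rfl⟩ := cases_parity c <;> simp [twoOdd, e1, e2, e4, e5] at this ⊢
    exact this

/-- For the sum `4 * j + 2` exactly two entries are odd. The values with even last entry determine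
the others by `k1` and `k2`, and the entries halved and rounded down have sum `2 * j`. -/
theorem kerFn_two (j : ℕ) : Module.finrank ℚ (kerFn (4 * j + 2)) = Module.finrank ℚ
    ↥(skewFn (-1) (HasSum3 (2 * j)) ⊓ LinearMap.ker (addDual 1)) := by
  refine (finrank_eq_of_map twoOdd (fun φ h => twoOdd_mem j h) ?_ ?_).symm
  · rintro φ - h0
    funext a b c
    have := congrFun (congrFun (congrFun h0 (2 * a + 1)) (2 * b + 1)) (2 * c)
    have e2 : ∀ x, (2 * x + 1) / 2 = x := fun x => by omega
    simpa [twoOdd, e2, Nat.add_mod] using this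
  · intro φ hφ
    obtain ⟨⟨h1, h2, h3⟩, h4⟩ := mem_kerFn.1 hφ
    have z1 : ∀ a b c, φ a b c ≠ 0 → a % 2 + b % 2 + c % 2 = 2 := by
      intro a b c hne
      have := h3 _ _ _ hne
      rw [EvenTri, Nat.even_iff] at this
      by_contra hc
      have hs : a % 2 = 0 ∧ b % 2 = 0 ∧ c % 2 = 0 := by omega
      have h1 := even_tri_even (a / 2)
      have h2 := even_tri_even (b / 2)
      have h3 := even_tri_even (c / 2)
      rw [show 2 * (a / 2) = a by omega] at h1
      rw [show 2 * (b / 2) = b by omega] at h2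
      rw [show 2 * (c / 2) = c by omega] at h3
      omega
    have z2 : ∀ a b c, a % 2 + b % 2 + c % 2 ≠ 2 → φ a b c = 0 := fun a b c h =>
      by_contra fun hne => h (z1 _ _ _ hne)
    have k1 : ∀ x y z, φ (2 * x) (2 * y + 1) (2 * z + 1) = φ (2 * x + 1) (2 * y + 1) (2 * z) := by
      intro x y z
      have := h4 (2 * x) (2 * y + 1) (2 * z)
      rw [z2 (2 * x) (2 * y + 1 + 1) (2 * z) (by omega)] at this
      simp only [par_odd, par_even] at this
      linarith
    have k2 : ∀ x y z, φ (2 * x + 1) (2 * y) (2 * z + 1) = - φ (2 * x + 1) (2 * y + 1) (2 * z) := by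
      intro x y z
      have := h4 (2 * x + 1) (2 * y) (2 * z)
      rw [z2 (2 * x + 1 + 1) (2 * y) (2 * z) (by omega)] at this
      simp only [par_odd, par_even] at this
      linarith
    have e2 : ∀ x, (2 * x + 1) / 2 = x := fun x => by omega
    refine ⟨fun x y z => φ (2 * x + 1) (2 * y + 1) (2 * z), ⟨⟨fun x y z => ?_, fun x y z => ?_,
      fun x y z hne => ?_⟩, ?_⟩, ?_⟩
    · dsimp only
      rw [h1, koszul_odd]
      rfl
    · dsimp only
      rw [h2, koszul_even_right, one_mul, k2]
      simp
    · have := (h3 _ _ _ hne).1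
      unfold HasSum3
      omega
    · rw [SetLike.mem_coe, LinearMap.mem_ker]
      funext x y z
      change φ (2 * (x + 1) + 1) (2 * y + 1) (2 * z) + 1 * φ (2 * x + 1) (2 * (y + 1) + 1) (2 * z) +
        1 * 1 * φ (2 * x + 1) (2 * y + 1) (2 * (z + 1)) = 0
      have := h4 (2 * x + 1) (2 * y + 1) (2 * z + 1)
      simp only [par_odd] at this
      have a1 := k1 (x + 1) y z
      have a2 := k2 x (y + 1) z
      rw [show 2 * x + 1 + 1 = 2 * (x + 1) by ring, show 2 * y + 1 + 1 = 2 * (y + 1) by ring,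
        show 2 * z + 1 + 1 = 2 * (z + 1) by ring] at this
      linarith
    · funext a b c
      by_cases hs : a % 2 + b % 2 + c % 2 = 2
      · change (if _ then _ else _) = _
        rw [if_pos hs]
        obtain ⟨x, rfl | rfl⟩ := cases_parity a <;> obtain ⟨y, rfl | rfl⟩ := cases_parity b <;>
          obtain ⟨z, rfl | rfl⟩ := cases_parity c <;> try omega
        · simp [e2, k1, Nat.add_mod]
        · simp [e2, k2]
        · simp [e2, Nat.add_mod]
      · rw [z2 _ _ _ hs]
        exact if_neg hs

/-- All entries in the support are even, so only one of the three terms of the kernel equation can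
be nonzero. This kills every value with a positive entry, and positivity of the sum excludes `(0, 0,
0)`. -/
theorem kerFn_zero {j : ℕ} (hj : 0 < j) : kerFn (4 * j) = ⊥ := by
  rw [eq_bot_iff]
  intro φ hφ
  obtain ⟨⟨h1, h2, h3⟩, h4⟩ := mem_kerFn.1 hφ
  have z1 : ∀ a b c, φ a b c ≠ 0 → a % 2 = 0 ∧ b % 2 = 0 ∧ c % 2 = 0 := by
    intro a b c hne
    have := h3 _ _ _ hne
    rw [EvenTri, Nat.even_iff] at this
    obtain ⟨x, rfl | rfl⟩ := cases_parity a <;> obtain ⟨y, rfl | rfl⟩ := cases_parity b <;>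
      obtain ⟨z, rfl | rfl⟩ := cases_parity c <;>
      [have h' := even_tri_even x; have h' := even_tri_even x; have h' := even_tri_even x;
       have h' := even_tri_even x; have h' := even_tri_odd x; have h' := even_tri_odd x;
       have h' := even_tri_odd x; have h' := even_tri_odd x] <;>
      have h1 := even_tri_even y <;> have h2 := even_tri_even z <;> have h3 := even_tri_odd y <;>
      have h4 := even_tri_odd z <;> omega
  have key : ∀ a b c, φ (a + 1) b c = 0 := by
    intro a b c
    by_contra hne
    have hp := z1 _ _ _ hne
    have e1 : φ a (b + 1) c = 0 := by_contra fun h => by have := z1 _ _ _ h; omega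
    have e2 : φ a b (c + 1) = 0 := by_contra fun h => by have := z1 _ _ _ h; omega
    have := h4 a b c
    rw [e1, e2] at this
    exact hne (by simpa using this)
  rw [Submodule.mem_bot]
  funext a b c
  change φ a b c = 0
  by_contra hne
  have := (h3 _ _ _ hne).1
  obtain _ | a := a
  · obtain _ | b := b
    · obtain _ | c := c
      · omega
      · rw [h2, h1, key] at hne; simp at hne
    · rw [h1, key] at hne; simp at hne
  · exact hne (key _ _ _)

/-- All entries in the support are odd, so again the kernel equation has at most one nonzero term.
-/
theorem kerFn_one (j : ℕ) : kerFn (4 * j + 1) = ⊥ := by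
  rw [eq_bot_iff]
  intro φ hφ
  obtain ⟨⟨h1, h2, h3⟩, h4⟩ := mem_kerFn.1 hφ
  have z1 : ∀ a b c, φ a b c ≠ 0 → a % 2 = 1 ∧ b % 2 = 1 ∧ c % 2 = 1 := by
    intro a b c hne
    have := h3 _ _ _ hne
    rw [EvenTri, Nat.even_iff] at this
    obtain ⟨x, rfl | rfl⟩ := cases_parity a <;> obtain ⟨y, rfl | rfl⟩ := cases_parity b <;>
      obtain ⟨z, rfl | rfl⟩ := cases_parity c <;>
      [have h' := even_tri_even x; have h' := even_tri_even x; have h' := even_tri_even x;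
       have h' := even_tri_even x; have h' := even_tri_odd x; have h' := even_tri_odd x;
       have h' := even_tri_odd x; have h' := even_tri_odd x] <;>
      have h1 := even_tri_even y <;> have h2 := even_tri_even z <;> have h3 := even_tri_odd y <;>
      have h4 := even_tri_odd z <;> omega
  rw [Submodule.mem_bot]
  funext a b c
  change φ a b c = 0
  by_contra hne
  have hp := z1 _ _ _ hne
  obtain _ | a := a
  · omega
  · have e1 : φ a (b + 1) c = 0 := by_contra fun h => by have := z1 _ _ _ h; omega
    have e2 : φ a b (c + 1) = 0 := by_contra fun h => by have := z1 _ _ _ h; omega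
    have := h4 a b c
    rw [e1, e2] at this
    exact hne (by simpa using this)

/-! ### Functionals on the space of graphs -/

theorem hairFlag_of_iso (f : Iso (thetaGraph h n) (thetaGraph h' n')) {x : Inn n} {y : Inn n'}
    (hxy : f.int (intE h n x) = intE h' n' y) (hx : hairFlag h n x = true) :
    hairFlag h' n' y = true := by
  have hc : ∀ j b, Sum.map (extE h' n') (intE h' n')
      (thetaEnd h' n' ((edgeE h' n').symm (f.edge (edgeE h n j))) (xor (f.flip (edgeE h n j)) b)) =
      Sum.map f.ext f.int (Sum.map (extE h n) (intE h n) (thetaEnd h n j b)) := by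
    intro j b
    rw [← endpt_edgeE, ← endpt_edgeE, Equiv.apply_symm_apply, f.endpt_eq]
  have h1 := hc (Sum.inr ⟨x, hx⟩) true
  have h2 := hc (Sum.inr ⟨x, hx⟩) false
  rcases hz : (edgeE h' n').symm (f.edge (edgeE h n (Sum.inr ⟨x, hx⟩))) with p | z <;>
    rw [hz] at h1 h2
  · simp [thetaEnd] at h1
  · cases hfl : f.flip (edgeE h n (Sum.inr ⟨x, hx⟩))
    · rw [hfl] at h2
      simp only [thetaEnd, Sum.elim_inr, Bool.false_xor, Bool.false_eq_true, if_false,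
        Sum.map_inr, Sum.inr.injEq, hxy, EmbeddingLike.apply_eq_iff_eq] at h2
      rw [← h2]
      exact z.2
    · rw [hfl] at h1
      simp [thetaEnd] at h1

theorem iso_hair (f : Iso (thetaGraph h n) (thetaGraph h' n'))
    (hf : f.int (intE h n (Sum.inl false)) = intE h' n' (Sum.inl false)) : h = h' := by
  have hft : f.int (intE h n (Sum.inl true)) = intE h' n' (Sum.inl true) := by
    obtain ⟨c, hc⟩ := iso_inl f true
    cases c
    · rw [← hf] at hc
      simp at hc
    · exact hc
  have key : ∀ b, f.int (intE h n (Sum.inl b)) = intE h' n' (Sum.inl b) := by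
    rintro (_ | _)
    · exact hf
    · exact hft
  funext b
  have k1 : h b = true → h' b = true := hairFlag_of_iso f (key b)
  have k2 : h' b = true → h b = true := hairFlag_of_iso f.symm (x := Sum.inl b) (y := Sum.inl b)
    (by rw [← key b]; exact f.int.symm_apply_apply _)
  cases hb : h b <;> cases hb' : h' b <;> simp_all

/-- Composed with the reflection if necessary, the isomorphism fixes `inl false` and hence permutes
the arcs. So compatibility with these two kinds of isomorphisms suffices. -/
theorem eq_sign_mul_of_iso {m N : ℕ} (hm : Even m) (hN : Odd N)
    {ψ : (Bool → Bool) → (Fin 3 → ℕ) → ℚ}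
    (h1 : ∀ h n n' (π : Equiv.Perm (Fin 3)), n = n' ∘ π → ψ h n = ((arcSign π n : ℤ) : ℚ) * ψ h n')
    (h2 : ∀ h n, ψ h n = ((flipSign n : ℤ) : ℚ) * ψ (fun b => h (!b)) n)
    (f : Iso (thetaGraph h n) (thetaGraph h' n')) :
    ψ h n = ((f.sign m N : ℤ) : ℚ) * ψ h' n' := by
  obtain ⟨c, hc⟩ := iso_inl f false
  cases c
  · obtain ⟨π, hπ, hs⟩ := iso_fix hm hN f hc
    rw [hs, iso_hair f hc]
    exact h1 _ _ _ _ hπ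
  · have hg : (f.trans (thetaFlip h' n')).int (intE h n (Sum.inl false)) =
        intE (fun b => h' (!b)) n' (Sum.inl false) := by
      change (thetaFlip h' n').int (f.int _) = _
      rw [hc, thetaFlip, isoOfInn_int]
      rfl
    obtain ⟨π, hπ, hs⟩ := iso_fix hm hN _ hg
    have e : ψ h n' = ψ (fun b => h' (!b)) n' := congrArg (fun g => ψ g n') (iso_hair _ hg)
    rw [h1 _ _ _ _ hπ, ← hs, e, Iso.sign_trans hm hN, sign_thetaFlip hm hN, h2 h' n']
    push_cast
    ring

/-- A function on the standard graphs that is compatible with the permutations of the arcs and with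
the exchange of the two vertices defines a functional. -/
theorem exists_functional {m N : ℕ} (hm : Even m) (hN : Odd N)
    {ψ : (Bool → Bool) → (Fin 3 → ℕ) → ℚ}
    (h1 : ∀ h n n' (π : Equiv.Perm (Fin 3)), n = n' ∘ π → ψ h n = ((arcSign π n : ℤ) : ℚ) * ψ h n')
    (h2 : ∀ h n, ψ h n = ((flipSign n : ℤ) : ℚ) * ψ (fun b => h (!b)) n) :
    ∃ Φ : Module.Dual ℚ (Space m N), ∀ h n, Φ (cls m N (thetaGraph h n)) = ψ h n := by
  classical
  have hsq : ∀ u : ℤˣ, ((u : ℤ) : ℚ) * ((u : ℤ) : ℚ) = 1 := fun u => by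
    rcases Int.units_eq_one_or u with rfl | rfl <;> simp
  -- A standard model and an isomorphism to it are chosen for every graph that has one; by
  -- `eq_sign_mul_of_iso` the signed value does not depend on the choice.
  let F : OGraph → ℚ := fun G =>
    if hG : ∃ p : (Bool → Bool) × (Fin 3 → ℕ), Nonempty (Iso (thetaGraph p.1 p.2) G) then
      ((hG.choose_spec.some.sign m N : ℤ) : ℚ) * ψ hG.choose.1 hG.choose.2 else 0
  have hF : ∀ {G G' : OGraph} (f : Iso G G'), F G = ((f.sign m N : ℤ) : ℚ) * F G' := by
    intro G G' f
    by_cases hG : ∃ p : (Bool → Bool) × (Fin 3 → ℕ), Nonempty (Iso (thetaGraph p.1 p.2) G)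
    · have hG' : ∃ p : (Bool → Bool) × (Fin 3 → ℕ), Nonempty (Iso (thetaGraph p.1 p.2) G') :=
        ⟨hG.choose, ⟨hG.choose_spec.some.trans f⟩⟩
      simp only [F, dif_pos hG, dif_pos hG']
      have := eq_sign_mul_of_iso hm hN h1 h2
        ((hG.choose_spec.some.trans f).trans hG'.choose_spec.some.symm)
      rw [Iso.sign_trans hm hN, Iso.sign_trans hm hN, Iso.sign_symm hm hN] at this
      rw [this]
      push_cast
      linear_combination ((f.sign m N : ℤ) : ℚ) * ((hG'.choose_spec.some.sign m N : ℤ) : ℚ) *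
        ψ hG'.choose.1 hG'.choose.2 * hsq (hG.choose_spec.some.sign m N)
    · have hG' : ¬ ∃ p : (Bool → Bool) × (Fin 3 → ℕ), Nonempty (Iso (thetaGraph p.1 p.2) G') :=
        fun ⟨p, ⟨g⟩⟩ => hG ⟨p, ⟨g.trans f.symm⟩⟩
      simp only [F, dif_neg hG, dif_neg hG', mul_zero]
  have hker : orientRel m N ≤ LinearMap.ker (Finsupp.linearCombination ℚ F) := by
    rw [orientRel, Submodule.span_le]
    rintro _ ⟨G, G', f, rfl⟩
    rw [SetLike.mem_coe, LinearMap.mem_ker, map_sub, map_smul, Finsupp.linearCombination_single,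
      Finsupp.linearCombination_single, one_smul, one_smul, hF f, smul_eq_mul, sub_self]
  refine ⟨(orientRel m N).liftQ _ hker, fun h n => ?_⟩
  rw [cls, Submodule.mkQ_apply, Submodule.liftQ_apply, Finsupp.linearCombination_single, one_smul]
  have hG : ∃ p : (Bool → Bool) × (Fin 3 → ℕ),
    Nonempty (Iso (thetaGraph p.1 p.2) (thetaGraph h n)) := ⟨(h, n), ⟨Iso.refl _⟩⟩
  simp only [F, dif_pos hG]
  rw [eq_sign_mul_of_iso hm hN h1 h2 hG.choose_spec.some, ← mul_assoc, hsq, one_mul]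

/-! ### Generators indexed by triples and their functionals -/

/-- The sign of the exchange of the two vertices of the frame. -/
def flp (a b c : ℕ) : ℚ := (-1) ^ (tri a + tri b + tri c)

/-- The class of a standard graph. -/
def gen (m N : ℕ) (h : Bool → Bool) (a b c : ℕ) : Space m N := cls m N (thetaGraph h ![a, b, c])

theorem flipSign_eq (n : Fin 3 → ℕ) : ((flipSign n : ℤ) : ℚ) = flp (n 0) (n 1) (n 2) := by
  simp [flipSign, flp, Fin.prod_univ_three, tri, pow_add]

theorem flp_mul_self (a b c : ℕ) : flp a b c * flp a b c = 1 := by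
  rw [flp, ← mul_pow]; norm_num

theorem gen_eq (m N : ℕ) (h : Bool → Bool) (n : Fin 3 → ℕ) :
    cls m N (thetaGraph h n) = gen m N h (n 0) (n 1) (n 2) := by
  rw [gen]
  congr 2
  funext i
  fin_cases i <;> rfl

/-- The two exchanges of neighbours generate all permutations; each of the six is written as a
product of them and compared with `arcSign`. -/
theorem skew_perm {φ : Fn} {P : ℕ → ℕ → ℕ → Prop} (hφ : φ ∈ skewFn koszul P) (π : Equiv.Perm (Fin 3))
    (hn : n = n' ∘ π) :
    φ (n 0) (n 1) (n 2) = ((arcSign π n : ℤ) : ℚ) * φ (n' 0) (n' 1) (n' 2) := by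
  obtain ⟨h1, h2, -⟩ := hφ
  have h01 : π 0 ≠ π 1 := fun h => absurd (π.injective h) (by decide)
  have h02 : π 0 ≠ π 2 := fun h => absurd (π.injective h) (by decide)
  have h12 : π 1 ≠ π 2 := fun h => absurd (π.injective h) (by decide)
  subst hn
  simp only [arcSign, Fin.prod_univ_three, Function.comp_apply]
  have k3 : ∀ x : Fin 3, x = 0 ∨ x = 1 ∨ x = 2 := by decide
  rcases k3 (π 0) with e0 | e0 | e0 <;> rcases k3 (π 1) with e1 | e1 | e1 <;>
    rcases k3 (π 2) with e2 | e2 | e2 <;> rw [e0, e1] at h01 <;> rw [e0, e2] at h02 <;>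
    rw [e1, e2] at h12 <;> (try exact absurd rfl h01) <;> (try exact absurd rfl h02) <;>
    try exact absurd rfl h12
  all_goals rw [e0, e1, e2]; generalize n' 0 = a; generalize n' 1 = b; generalize n' 2 = c
  · simp
  · rw [h2 a c b]; simp [koszul]
  · rw [h1 b a c]; simp [koszul]
  · rw [h2 b c a, h1 b a c]; simp [koszul]; ring
  · rw [h1 c a b, h2 a c b]; simp [koszul]; ring
  · rw [h1 c b a, h2 b c a, h1 b a c]; simp [koszul]; ring

theorem flipSign_comp (n' : Fin 3 → ℕ) (π : Equiv.Perm (Fin 3)) :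
    flipSign (n' ∘ π) = flipSign n' :=
  Equiv.prod_comp π fun i => (-1 : ℤˣ) ^ (n' i * (n' i + 1) / 2)

/-- Equivariance is the only constraint on functionals. For equal flags the reflection maps a graph
to itself, so the support must lie in `EvenTri`. For one hair at a trivalent vertex it merely
defines the value with the hair at the other vertex. -/
theorem exists_functional_gen {m N : ℕ} (hm : Even m) (hN : Odd N) {φ₀ φ₁ φ₂ : Fn}
    {P : ℕ → ℕ → ℕ → Prop} {k₀ k₂ : ℕ} (h0 : φ₀ ∈ skewFn koszul (EvenTri k₀))
    (h1 : φ₁ ∈ skewFn koszul P) (h2 : φ₂ ∈ skewFn koszul (EvenTri k₂)) :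
    ∃ Φ : Module.Dual ℚ (Space m N), ∀ a b c, Φ (gen m N (fun _ => false) a b c) = φ₀ a b c ∧
      Φ (gen m N not a b c) = φ₁ a b c ∧ Φ (gen m N (fun _ => true) a b c) = φ₂ a b c := by
  have heven : ∀ {k : ℕ} {φ : Fn}, φ ∈ skewFn koszul (EvenTri k) → ∀ n : Fin 3 → ℕ,
      φ (n 0) (n 1) (n 2) = ((flipSign n : ℤ) : ℚ) * φ (n 0) (n 1) (n 2) := by
    intro k φ hφ n
    rw [flipSign_eq]
    by_cases hne : φ (n 0) (n 1) (n 2) = 0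
    · rw [hne, mul_zero]
    · rw [flp, (hφ.2.2 _ _ _ hne).2.neg_one_pow, one_mul]
  let ψ : (Bool → Bool) → (Fin 3 → ℕ) → ℚ := fun h n =>
    if h false then if h true then φ₂ (n 0) (n 1) (n 2) else φ₁ (n 0) (n 1) (n 2)
    else if h true then ((flipSign n : ℤ) : ℚ) * φ₁ (n 0) (n 1) (n 2) else φ₀ (n 0) (n 1) (n 2)
  obtain ⟨Φ, hΦ⟩ := exists_functional (ψ := ψ) hm hN (by
    intro h n n' π hn
    have hs : flipSign n = flipSign n' := by rw [hn, flipSign_comp]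
    simp only [ψ]
    rw [hs, skew_perm h0 π hn, skew_perm h1 π hn, skew_perm h2 π hn]
    split_ifs <;> ring) (by
    intro h n
    have hsq := flp_mul_self (n 0) (n 1) (n 2)
    rw [← flipSign_eq] at hsq
    simp only [ψ, Bool.not_false, Bool.not_true]
    split_ifs
    · exact heven h2 n
    · rw [← mul_assoc, hsq, one_mul]
    · rfl
    · exact heven h0 n)
  exact ⟨Φ, fun a b c => ⟨hΦ _ _, hΦ _ _, hΦ _ _⟩⟩

theorem gen_swapL {m N : ℕ} (hm : Even m) (hN : Odd N) (h : Bool → Bool) (a b c : ℕ) :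
    gen m N h a b c = koszul a b • gen m N h b a c := by
  have hn : ![a, b, c] = ![b, a, c] ∘ Equiv.swap (0 : Fin 3) 1 := by
    funext i; fin_cases i <;> rfl
  rw [gen, cls_perm hm hN h _ hn]
  congr 1
  have e0 : Equiv.swap (0 : Fin 3) 1 0 = 1 := by decide
  have e1 : Equiv.swap (0 : Fin 3) 1 1 = 0 := by decide
  have e2 : Equiv.swap (0 : Fin 3) 1 2 = 2 := by decide
  simp [arcSign, Fin.prod_univ_three, e2, koszul]

theorem gen_swapR {m N : ℕ} (hm : Even m) (hN : Odd N) (h : Bool → Bool) (a b c : ℕ) :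
    gen m N h a b c = koszul b c • gen m N h a c b := by
  have hn : ![a, b, c] = ![a, c, b] ∘ Equiv.swap (1 : Fin 3) 2 := by
    funext i; fin_cases i <;> rfl
  rw [gen, cls_perm hm hN h _ hn]
  congr 1
  have e0 : Equiv.swap (1 : Fin 3) 2 0 = 0 := by decide
  simp [arcSign, Fin.prod_univ_three, e0, koszul]

theorem gen_flip {m N : ℕ} (hm : Even m) (hN : Odd N) (h : Bool → Bool) (a b c : ℕ) :
    gen m N h a b c = flp a b c • gen m N (fun x => h (!x)) a b c := by
  rw [gen, cls_flip hm hN, flipSign_eq]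
  rfl

theorem diff_false (m N a b c : ℕ) : diff m N (gen m N (fun _ => false) a b c) = 0 := diff_gen0 _ _ _

theorem addHair_zero (a b c : ℕ) : addHair ![a, b, c] 0 = ![a + 1, b, c] := by
  funext i; fin_cases i <;> rfl

theorem addHair_one (a b c : ℕ) : addHair ![a, b, c] 1 = ![a, b + 1, c] := by
  funext i; fin_cases i <;> rfl

theorem addHair_two (a b c : ℕ) : addHair ![a, b, c] 2 = ![a, b, c + 1] := by
  funext i; fin_cases i <;> rfl

theorem leftSign_zero (a b c : ℕ) : ((leftSign ![a, b, c] 0 : ℤ) : ℚ) = 1 := by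
  simp [leftSign]

theorem leftSign_one (a b c : ℕ) : ((leftSign ![a, b, c] 1 : ℤ) : ℚ) = par a := by
  simp [leftSign, par]

theorem leftSign_two (a b c : ℕ) : ((leftSign ![a, b, c] 2 : ℤ) : ℚ) = par a * par b := by
  simp [leftSign, Fin.prod_univ_three, par]

theorem diff_not {m N : ℕ} (hm : Even m) (hN : Odd N) (a b c : ℕ) :
    diff m N (gen m N not a b c) = gen m N (fun _ => false) (a + 1) b c +
      par a • gen m N (fun _ => false) a (b + 1) c +
      (par a * par b) • gen m N (fun _ => false) a b (c + 1) := by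
  refine (diff_gen1 hm hN _).trans ?_
  rw [Fin.sum_univ_three, addHair_zero, addHair_one, addHair_two, leftSign_zero, leftSign_one,
    leftSign_two, one_smul]
  rfl

theorem diff_true {m N : ℕ} (hm : Even m) (hN : Odd N) (a b c : ℕ) :
    diff m N (gen m N (fun _ => true) a b c) = (1 + flp a b c) •
      (flp (a + 1) b c • gen m N not (a + 1) b c +
      (par a * flp a (b + 1) c) • gen m N not a (b + 1) c +
      (par a * par b * flp a b (c + 1)) • gen m N not a b (c + 1)) := by
  refine (diff_gen2 hm hN _).trans ?_
  rw [Fin.sum_univ_three, addHair_zero, addHair_one, addHair_two, leftSign_zero, leftSign_one,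
    leftSign_two, one_mul]
  simp only [flipSign_eq]
  rfl

/-! ### Generators of the chain spaces -/

theorem defect_eq {G : OGraph} (hG : G.IsTwoLoopHairy) :
    G.defect = (G.numExt : ℤ) + 2 - G.numInt := by
  have h2 := hG.two_loop
  have hsum : ∑ u : G.Vert, G.valence u = 2 * G.numEdge := by
    have := Finset.card_eq_sum_card_fiberwise (s := (Finset.univ : Finset G.HalfEdge))
      (t := (Finset.univ : Finset G.Vert)) (f := fun h => G.endpt h.1 h.2) (by simp)
    rw [Finset.card_univ] at this
    simp only [Fintype.card_prod, Fintype.card_fin, Fintype.card_bool] at this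
    rw [mul_comm, this]
    rfl
  rw [Fintype.sum_sum_type] at hsum
  simp only [hG.uni.valence_ext, Finset.sum_const, Finset.card_univ, Fintype.card_fin,
    smul_eq_mul, mul_one] at hsum
  simp only [OGraph.defect, Finset.sum_sub_distrib, Finset.sum_const, Finset.card_univ,
    Fintype.card_fin, nsmul_eq_mul]
  simp only [OGraph.loops] at h2
  zify at hsum
  push_cast at h2 hsum
  linarith

/-- A standard graph has `∑ j, n j + numHair h` external and `∑ j, n j + 2` internal vertices, so by
`defect_eq` its defect is `numHair h`. -/
theorem chains_eq (m N i k : ℕ) : chains m N i k = Submodule.span ℚ {z | ∃ h n,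
    numHair h = i ∧ ∑ j, n j + i = k ∧ 0 < k ∧ z = cls m N (thetaGraph h n)} := by
  have hc : ∀ h n, ((thetaGraph h n).numExt = ∑ j, n j + numHair h) ∧
      (thetaGraph h n).numInt = ∑ j, n j + 2 := fun h n => ⟨card_hair h n, card_inn n⟩
  apply le_antisymm
  · rw [chains, Submodule.span_le]
    rintro _ ⟨G, hG, hi, hk, rfl⟩
    obtain ⟨h, n, ⟨f⟩⟩ := exists_iso_theta hG
    have e1 : (thetaGraph h n).numExt = G.numExt := by
      simpa using Fintype.card_congr f.ext
    have e2 : (thetaGraph h n).numInt = G.numInt := by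
      simpa using Fintype.card_congr f.int
    rw [defect_eq hG] at hi
    have hpos := hG.uni.ext_nonempty
    obtain ⟨c1, c2⟩ := hc h n
    have : cls m N G = ((f.symm.sign m N : ℤ) : ℚ) • cls m N (thetaGraph h n) :=
      cls_eq_of_iso m N f.symm
    rw [SetLike.mem_coe, this]
    exact Submodule.smul_mem _ _ (Submodule.subset_span ⟨h, n, by omega, by omega, by omega, rfl⟩)
  · rw [Submodule.span_le]
    rintro _ ⟨h, n, hi, hk, hpos, rfl⟩
    have hG := isTwoLoopHairy_theta (h := h) (n := n) (by omega)
    obtain ⟨c1, c2⟩ := hc h n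
    refine Submodule.subset_span ⟨_, hG, ?_, by omega, rfl⟩
    rw [defect_eq hG, c1, c2]
    push_cast
    omega

/-- The standard flags with `i` hairs. -/
def flags : ℕ → Bool → Bool
  | 0 => fun _ => false
  | 1 => not
  | _ => fun _ => true

/-- In defect one the reflection moves the only hair at a trivalent vertex to `inl false`, so one
choice of flags suffices for each defect. -/
theorem chains_eq_span {m N : ℕ} (hm : Even m) (hN : Odd N) {i d : ℕ} (hi : i ≤ 2)
    (hpos : 0 < d + i) : chains m N i (d + i) =
      Submodule.span ℚ {z | ∃ a b c, a + b + c = d ∧ z = gen m N (flags i) a b c} := by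
  rw [chains_eq]
  apply le_antisymm
  · rw [Submodule.span_le]
    rintro _ ⟨h, n, hh, hs, -, rfl⟩
    rw [SetLike.mem_coe, gen_eq]
    rw [Fin.sum_univ_three] at hs
    have hmem : gen m N (flags i) (n 0) (n 1) (n 2) ∈
        Submodule.span ℚ {z | ∃ a b c, a + b + c = d ∧ z = gen m N (flags i) a b c} :=
      Submodule.subset_span ⟨_, _, _, by omega, rfl⟩
    have hfun : ∀ g : Bool → Bool, h false = g false → h true = g true → h = g := fun g h1 h2 => by
      funext b; cases b <;> assumption
    unfold numHair at hh
    cases h0 : h false <;> cases h1 : h true <;> rw [h0, h1] at hh <;> subst hh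
    · rw [hfun (flags 0) h0 h1]
      exact hmem
    · rw [gen_flip hm hN]
      refine Submodule.smul_mem _ _ ?_
      have : (fun x => h (!x)) = flags 1 := by
        funext b; cases b
        · exact h1
        · exact h0
      rw [this]
      exact hmem
    · rw [hfun (flags 1) h0 h1]
      exact hmem
    · rw [hfun (flags 2) h0 h1]
      exact hmem
  · refine Submodule.span_mono ?_
    rintro _ ⟨a, b, c, hs, rfl⟩
    refine ⟨flags i, ![a, b, c], ?_, ?_, hpos, rfl⟩
    · interval_cases i <;> rfl
    · rw [Fin.sum_univ_three]
      exact congrArg (· + i) hs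

theorem chains_eq_bot (m N : ℕ) {i k : ℕ} (h : 2 < i ∨ k < i ∨ k = 0) : chains m N i k = ⊥ := by
  rw [chains_eq, Submodule.span_eq_bot]
  rintro _ ⟨g, n, hg, hs, hpos, -⟩
  unfold numHair at hg
  have h1 := (g false).toNat_lt
  have h2 := (g true).toNat_lt
  omega

/-! ### Dimensions of chains and homology -/

/-- A subquotient whose functionals, evaluated on generators, form the space `K`. -/
theorem finrank_of_functionals {W : Type*} [AddCommGroup W] [Module ℚ W] {g : ℕ → ℕ → ℕ → W}
    {d : ℕ} {A B : Submodule ℚ W}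
    (hA : A = Submodule.span ℚ {z | ∃ a b c, a + b + c = d ∧ z = g a b c}) (hB : B ≤ A)
    {K : Submodule ℚ Fn} [Module.Finite ℚ K]
    (h1 : ∀ Φ : Module.Dual ℚ W, (∀ b ∈ B, Φ b = 0) →
      (fun a b c => if a + b + c = d then Φ (g a b c) else 0) ∈ K)
    (h2 : ∀ φ ∈ K, ∃ Φ : Module.Dual ℚ W, (∀ b ∈ B, Φ b = 0) ∧ ∀ a b c, Φ (g a b c) = φ a b c)
    (h3 : ∀ φ ∈ K, ∀ a b c, φ a b c ≠ 0 → a + b + c = d) :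
    Module.Finite ℚ (A ⧸ B.submoduleOf A) ∧
      Module.finrank ℚ (A ⧸ B.submoduleOf A) = Module.finrank ℚ K := by
  have mem : ∀ a b c, a + b + c = d → g a b c ∈ A := fun a b c h => by
    rw [hA]
    exact Submodule.subset_span ⟨a, b, c, h, rfl⟩
  -- A functional on the quotient is the same as the restriction to `A` of a functional on `W` that
  -- vanishes on `B`.
  have hext : ∀ Ψ : Module.Dual ℚ (A ⧸ B.submoduleOf A), ∃ Φ : Module.Dual ℚ W,
      (∀ b ∈ B, Φ b = 0) ∧ ∀ x : A, Φ x = Ψ ((B.submoduleOf A).mkQ x) := by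
    intro Ψ
    obtain ⟨Φ, hΦ⟩ := LinearMap.exists_extend (Ψ ∘ₗ (B.submoduleOf A).mkQ)
    have h : ∀ x : A, Φ x = Ψ ((B.submoduleOf A).mkQ x) := fun x => LinearMap.congr_fun hΦ x
    refine ⟨Φ, fun b hb => ?_, h⟩
    have := h ⟨b, hB hb⟩
    rwa [Submodule.mkQ_apply, (Submodule.Quotient.mk_eq_zero _).2
      (show (⟨b, hB hb⟩ : A) ∈ B.submoduleOf A from hb), map_zero] at this
  let R : Module.Dual ℚ (A ⧸ B.submoduleOf A) →ₗ[ℚ] Fn :=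
    { toFun := fun Ψ a b c => if h : a + b + c = d then
        Ψ ((B.submoduleOf A).mkQ ⟨g a b c, mem a b c h⟩) else 0
      map_add' := fun Ψ Ψ' => by
        funext a b c
        simp only [Pi.add_apply]
        split_ifs <;> simp
      map_smul' := fun q Ψ => by
        funext a b c
        simp only [Pi.smul_apply]
        split_ifs <;> simp }
  have hR : ∀ Ψ, R Ψ ∈ K := fun Ψ => by
    obtain ⟨Φ, h0, h⟩ := hext Ψ
    convert h1 Φ h0 using 1
    funext a b c
    change (if h : a + b + c = d then _ else 0) = _
    split_ifs with hd
    · exact (h _).symm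
    · rfl
  have hinj : Function.Injective (R.codRestrict K hR) := by
    rw [← LinearMap.ker_eq_bot, LinearMap.ker_eq_bot']
    intro Ψ h0
    obtain ⟨Φ, -, h⟩ := hext Ψ
    have hker : A ≤ LinearMap.ker Φ := by
      conv_lhs => rw [hA]
      rw [Submodule.span_le]
      rintro _ ⟨a, b, c, hd, rfl⟩
      have := congrFun (congrFun (congrFun (congrArg Subtype.val h0) a) b) c
      change (if h : a + b + c = d then _ else 0) = (0 : ℚ) at this
      rw [dif_pos hd] at this
      rw [SetLike.mem_coe, LinearMap.mem_ker, ← this]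
      exact h ⟨_, mem a b c hd⟩
    refine Submodule.linearMap_qext _ (LinearMap.ext fun x => ?_)
    exact (h x).symm.trans (hker x.2)
  have hsurj : Function.Surjective (R.codRestrict K hR) := by
    rintro ⟨φ, hφ⟩
    obtain ⟨Φ, h0, h⟩ := h2 φ hφ
    refine ⟨(B.submoduleOf A).liftQ (Φ ∘ₗ A.subtype) fun x hx => h0 _ hx, Subtype.ext ?_⟩
    funext a b c
    change (if h : a + b + c = d then _ else 0) = φ a b c
    split_ifs with hd
    · exact h a b c
    · exact (by_contra fun hne => hd (h3 φ hφ a b c (Ne.symm hne)))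
  let e := LinearEquiv.ofBijective (R.codRestrict K hR) ⟨hinj, hsurj⟩
  have : Module.Finite ℚ (Module.Dual ℚ (A ⧸ B.submoduleOf A)) := Module.Finite.equiv e.symm
  exact ⟨Module.finite_dual_iff ℚ |>.1 this, by rw [← Subspace.dual_finrank_eq, e.finrank_eq]⟩

theorem finrank_span_of_functionals {W : Type*} [AddCommGroup W] [Module ℚ W] {g : ℕ → ℕ → ℕ → W}
    {d : ℕ} {A : Submodule ℚ W}
    (hA : A = Submodule.span ℚ {z | ∃ a b c, a + b + c = d ∧ z = g a b c})
    {K : Submodule ℚ Fn} [Module.Finite ℚ K]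
    (h1 : ∀ Φ : Module.Dual ℚ W, (fun a b c => if a + b + c = d then Φ (g a b c) else 0) ∈ K)
    (h2 : ∀ φ ∈ K, ∃ Φ : Module.Dual ℚ W, ∀ a b c, Φ (g a b c) = φ a b c)
    (h3 : ∀ φ ∈ K, ∀ a b c, φ a b c ≠ 0 → a + b + c = d) :
    Module.Finite ℚ A ∧ Module.finrank ℚ A = Module.finrank ℚ K := by
  have hb : (⊥ : Submodule ℚ W).submoduleOf A = ⊥ := by
    simp [Submodule.submoduleOf]
  obtain ⟨h4, h5⟩ := finrank_of_functionals hA (bot_le : ⊥ ≤ A) (fun Φ _ => h1 Φ) (fun φ hφ => by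
    obtain ⟨Φ, hΦ⟩ := h2 φ hφ
    exact ⟨Φ, fun b hb => by rw [(Submodule.mem_bot ℚ).1 hb, map_zero], hΦ⟩) h3
  let e := Submodule.quotEquivOfEqBot _ hb
  exact ⟨Module.Finite.equiv e, by rw [← h5, e.finrank_eq]⟩

theorem dual_gen_mem {m N : ℕ} (hm : Even m) (hN : Odd N) (h : Bool → Bool) (d : ℕ)
    (Φ : Module.Dual ℚ (Space m N)) :
    (fun a b c => if a + b + c = d then Φ (gen m N h a b c) else 0) ∈ skewFn koszul (HasSum3 d) := by
  refine ⟨fun a b c => ?_, fun a b c => ?_, fun a b c hne => by_contra fun hd => hne (if_neg hd)⟩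
  · dsimp only
    rw [gen_swapL hm hN, map_smul, smul_eq_mul, mul_ite, mul_zero, add_comm a b]
  · dsimp only
    rw [gen_swapR hm hN, map_smul, smul_eq_mul, mul_ite, mul_zero, add_right_comm a b]

/-- The reflection is an odd automorphism of this graph, so its class equals its own negative. -/
theorem gen_eq_zero {m N : ℕ} (hm : Even m) (hN : Odd N) {h : Bool → Bool}
    (hh : (fun x => h (!x)) = h) {a b c : ℕ} (hf : flp a b c = -1) : gen m N h a b c = 0 := by
  have := gen_flip (m := m) (N := N) hm hN h a b c
  rw [hh, hf, neg_one_smul] at this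
  have h2 : (2 : ℚ) • gen m N h a b c = 0 := by
    rw [two_smul]
    exact add_eq_zero_iff_eq_neg.2 this
  exact (smul_eq_zero_iff_right two_ne_zero).1 h2

theorem flp_cases (a b c : ℕ) : (Even (tri a + tri b + tri c) ∧ flp a b c = 1) ∨ flp a b c = -1 := by
  rcases Nat.even_or_odd (tri a + tri b + tri c) with h | h
  · exact Or.inl ⟨h, h.neg_one_pow⟩
  · exact Or.inr h.neg_one_pow

theorem dual_gen_mem_even {m N : ℕ} (hm : Even m) (hN : Odd N) {h : Bool → Bool}
    (hh : (fun x => h (!x)) = h) (d : ℕ) (Φ : Module.Dual ℚ (Space m N)) :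
    (fun a b c => if a + b + c = d then Φ (gen m N h a b c) else 0) ∈ skewFn koszul (EvenTri d) := by
  obtain ⟨h1, h2, h3⟩ := dual_gen_mem hm hN h d Φ
  refine ⟨h1, h2, fun a b c hne => ⟨h3 a b c hne, ?_⟩⟩
  rcases flp_cases a b c with hf | hf
  · exact hf.1
  · refine absurd ?_ hne
    dsimp only
    rw [gen_eq_zero hm hN hh hf, map_zero, ite_self]

instance finite_evenTri (d : ℕ) : Module.Finite ℚ (skewFn koszul (EvenTri d)) :=
  finite_skewFn fun _ _ _ h => h.1

instance finite_hasSum3 (s : ℕ → ℕ → ℚ) (d : ℕ) : Module.Finite ℚ (skewFn s (HasSum3 d)) :=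
  finite_skewFn fun _ _ _ h => h

theorem chains_zero {m N : ℕ} (hm : Even m) (hN : Odd N) {k : ℕ} (hk : 0 < k) :
    Module.Finite ℚ (chains m N 0 k) ∧
      Module.finrank ℚ (chains m N 0 k) = Module.finrank ℚ (skewFn koszul (EvenTri k)) :=
  finrank_span_of_functionals (chains_eq_span (d := k) hm hN (Nat.zero_le 2) hk)
    (fun Φ => dual_gen_mem_even hm hN rfl k Φ)
    (fun φ hφ => by
      obtain ⟨Φ, hΦ⟩ := exists_functional_gen (k₂ := k) (P := EvenTri k) hm hN hφ
        (Submodule.zero_mem _) (Submodule.zero_mem _)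
      exact ⟨Φ, fun a b c => (hΦ a b c).1⟩)
    fun φ hφ a b c hne => (hφ.2.2 a b c hne).1

theorem chains_one {m N : ℕ} (hm : Even m) (hN : Odd N) (d : ℕ) :
    Module.Finite ℚ (chains m N 1 (d + 1)) ∧
      Module.finrank ℚ (chains m N 1 (d + 1)) = Module.finrank ℚ (skewFn koszul (HasSum3 d)) :=
  finrank_span_of_functionals (chains_eq_span (d := d) hm hN (Nat.le_succ 1) (Nat.succ_pos d))
    (fun Φ => dual_gen_mem hm hN not d Φ)
    (fun φ hφ => by
      obtain ⟨Φ, hΦ⟩ := exists_functional_gen (k₀ := d) (k₂ := d) hm hN (Submodule.zero_mem _) hφ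
        (Submodule.zero_mem _)
      exact ⟨Φ, fun a b c => (hΦ a b c).2.1⟩)
    fun φ hφ a b c hne => hφ.2.2 a b c hne

theorem chains_two {m N : ℕ} (hm : Even m) (hN : Odd N) (d : ℕ) :
    Module.Finite ℚ (chains m N 2 (d + 2)) ∧
      Module.finrank ℚ (chains m N 2 (d + 2)) = Module.finrank ℚ (skewFn koszul (EvenTri d)) :=
  finrank_span_of_functionals (chains_eq_span (d := d) hm hN le_rfl (Nat.succ_pos _))
    (fun Φ => dual_gen_mem_even hm hN rfl d Φ)
    (fun φ hφ => by
      obtain ⟨Φ, hΦ⟩ := exists_functional_gen (k₀ := d) (P := EvenTri d) hm hN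
        (Submodule.zero_mem _) (Submodule.zero_mem _) hφ
      exact ⟨Φ, fun a b c => (hΦ a b c).2.2⟩)
    fun φ hφ a b c hne => (hφ.2.2 a b c hne).1

theorem finite_chains {m N : ℕ} (hm : Even m) (hN : Odd N) (i k : ℕ) :
    Module.Finite ℚ (chains m N i k) := by
  by_cases h : 2 < i ∨ k < i ∨ k = 0
  · rw [chains_eq_bot m N h]
    infer_instance
  · obtain ⟨d, rfl⟩ := Nat.exists_eq_add_of_le' (by omega : i ≤ k)
    have hi : i = 0 ∨ i = 1 ∨ i = 2 := by omega
    rcases hi with rfl | rfl | rfl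
    · exact (chains_zero hm hN (by omega)).1
    · exact (chains_one hm hN d).1
    · exact (chains_two hm hN d).1

/-! ### The complex -/

theorem boundaries_zero {m N : ℕ} (hm : Even m) (hN : Odd N) (d : ℕ) :
    boundaries m N 0 (d + 1) = Submodule.span ℚ {z | ∃ a b c, a + b + c = d ∧
      z = gen m N (fun _ => false) (a + 1) b c + par a • gen m N (fun _ => false) a (b + 1) c +
        (par a * par b) • gen m N (fun _ => false) a b (c + 1)} := by
  rw [boundaries, chains_eq_span (d := d) hm hN (Nat.le_succ 1) (Nat.succ_pos d),
    Submodule.map_span]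
  congr 1
  ext z
  constructor
  · rintro ⟨_, ⟨a, b, c, hd, rfl⟩, rfl⟩
    exact ⟨a, b, c, hd, diff_not hm hN a b c⟩
  · rintro ⟨a, b, c, hd, rfl⟩
    exact ⟨_, ⟨a, b, c, hd, rfl⟩, diff_not hm hN a b c⟩

theorem cycles_zero {m N : ℕ} (hm : Even m) (hN : Odd N) {k : ℕ} (hk : 0 < k) :
    cycles m N 0 k = chains m N 0 k := by
  refine inf_eq_left.2 ?_
  rw [show chains m N 0 k = _ from chains_eq_span (d := k) hm hN (Nat.zero_le 2) hk, Submodule.span_le]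
  rintro _ ⟨a, b, c, -, rfl⟩
  exact diff_false m N a b c

theorem boundaries_zero_le {m N : ℕ} (hm : Even m) (hN : Odd N) (d : ℕ) :
    boundaries m N 0 (d + 1) ≤ cycles m N 0 (d + 1) := by
  rw [cycles_zero hm hN (Nat.succ_pos d), boundaries_zero hm hN, Submodule.span_le,
    chains_eq_span (d := d + 1) hm hN (Nat.zero_le 2) (Nat.succ_pos d)]
  rintro _ ⟨a, b, c, hd, rfl⟩
  have key : ∀ x y z, x + y + z = d + 1 → gen m N (fun _ => false) x y z ∈ Submodule.span ℚ
      {z | ∃ a b c, a + b + c = d + 1 ∧ z = gen m N (flags 0) a b c} := fun x y z h =>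
    Submodule.subset_span ⟨x, y, z, h, rfl⟩
  exact Submodule.add_mem _ (Submodule.add_mem _ (key _ _ _ (by omega))
    (Submodule.smul_mem _ _ (key _ _ _ (by omega)))) (Submodule.smul_mem _ _ (key _ _ _ (by omega)))

theorem par_sq (a : ℕ) : par a = 1 ∨ par a = -1 := neg_one_pow_eq_or ℚ a

theorem par_succ (a : ℕ) : par (a + 1) = - par a := by rw [par, par, pow_succ, mul_neg_one]

theorem flp_fst (a b c : ℕ) : flp (a + 1) b c = - (par a * flp a b c) := by
  have : tri (a + 1) = tri a + (a + 1) := by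
    rw [tri, tri, show (a + 1) * (a + 1 + 1) = a * (a + 1) + (a + 1) * 2 by ring,
      Nat.add_mul_div_right _ _ two_pos]
  rw [flp, flp, par, this, pow_add, pow_add, pow_add, pow_add, pow_add, pow_succ]
  ring

theorem flp_snd (a b c : ℕ) : flp a (b + 1) c = - (par b * flp a b c) := by
  have e : ∀ x y, flp a x y = flp x a y := fun x y => by rw [flp, flp, add_comm (tri a)]
  rw [e, e, flp_fst]

theorem flp_trd (a b c : ℕ) : flp a b (c + 1) = - (par c * flp a b c) := by
  have e : ∀ x y, flp a x y = flp a y x := fun x y => by rw [flp, flp, add_right_comm]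
  rw [e b (c + 1), e b c, flp_snd]

/-- If `flp a b c = -1`, the factor `1 + flp a b c` vanishes. Otherwise two hairs added to one arc
give a generator with an odd reflection, hence zero. Hairs added to two different arcs give an odd
reflection if the arcs have different parities, and two cancelling terms if they have the same
parity. -/
theorem diff_diff_true {m N : ℕ} (hm : Even m) (hN : Odd N) (a b c : ℕ) :
    diff m N (diff m N (gen m N (fun _ => true) a b c)) = 0 := by
  rw [diff_true hm hN, map_smul]
  rcases flp_cases a b c with ⟨-, hf⟩ | hf
  · have hz : ∀ {x y z}, flp x y z = -1 → gen m N (fun _ => false) x y z = 0 := fun h =>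
      gen_eq_zero hm hN rfl h
    have z1 : gen m N (fun _ => false) (a + 1 + 1) b c = 0 := hz (by
      rw [flp_fst, flp_fst, hf, par_succ]; rcases par_sq a with h | h <;> rw [h] <;> norm_num)
    have z2 : gen m N (fun _ => false) a (b + 1 + 1) c = 0 := hz (by
      rw [flp_snd, flp_snd, hf, par_succ]; rcases par_sq b with h | h <;> rw [h] <;> norm_num)
    have z3 : gen m N (fun _ => false) a b (c + 1 + 1) = 0 := hz (by
      rw [flp_trd, flp_trd, hf, par_succ]; rcases par_sq c with h | h <;> rw [h] <;> norm_num)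
    have z4 : par a = par b ∨ gen m N (fun _ => false) (a + 1) (b + 1) c = 0 := by
      rcases par_sq a with h | h <;> rcases par_sq b with h' | h' <;> rw [h, h'] <;>
        first
        | exact Or.inl rfl
        | exact Or.inr (hz (by rw [flp_fst, flp_snd, hf, h, h']; norm_num))
    have z5 : par a = par c ∨ gen m N (fun _ => false) (a + 1) b (c + 1) = 0 := by
      rcases par_sq a with h | h <;> rcases par_sq c with h' | h' <;> rw [h, h'] <;>
        first
        | exact Or.inl rfl
        | exact Or.inr (hz (by rw [flp_fst, flp_trd, hf, h, h']; norm_num))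
    have z6 : par b = par c ∨ gen m N (fun _ => false) a (b + 1) (c + 1) = 0 := by
      rcases par_sq b with h | h <;> rcases par_sq c with h' | h' <;> rw [h, h'] <;>
        first
        | exact Or.inl rfl
        | exact Or.inr (hz (by rw [flp_snd, flp_trd, hf, h, h']; norm_num))
    simp only [map_add, map_smul, diff_not hm hN, flp_fst, flp_snd, flp_trd, par_succ, z1, z2, z3, hf]
    rcases par_sq a with h | h <;> rcases par_sq b with h' | h' <;>
      rcases par_sq c with h'' | h'' <;> rw [h, h'] at z4 <;> rw [h, h''] at z5 <;>
      rw [h', h''] at z6 <;> norm_num at z4 z5 z6 <;> simp only [*] <;> module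
  · rw [hf]
    simp

theorem boundaries_le_cycles {m N : ℕ} (hm : Even m) (hN : Odd N) (i k : ℕ) :
    boundaries m N i k ≤ cycles m N i k := by
  by_cases h : 2 < i + 1 ∨ k < i + 1 ∨ k = 0
  · rw [boundaries, chains_eq_bot m N h, Submodule.map_bot]
    exact bot_le
  · have hi : i = 0 ∨ i = 1 := by omega
    rcases hi with rfl | rfl
    · obtain ⟨d, rfl⟩ := Nat.exists_eq_add_of_le' (by omega : 1 ≤ k)
      exact boundaries_zero_le hm hN d
    · obtain ⟨d, rfl⟩ := Nat.exists_eq_add_of_le' (by omega : 2 ≤ k)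
      have key : ∀ x y z, x + y + z = d + 1 → gen m N not x y z ∈ chains m N 1 (d + 2) := by
        intro x y z h
        rw [chains_eq_span (d := d + 1) hm hN (Nat.le_succ 1) (Nat.succ_pos _)]
        exact Submodule.subset_span ⟨x, y, z, h, rfl⟩
      rw [boundaries, chains_eq_span (d := d) hm hN le_rfl (Nat.succ_pos _), Submodule.map_span,
        Submodule.span_le]
      rintro _ ⟨_, ⟨a, b, c, hd, rfl⟩, rfl⟩
      refine ⟨?_, diff_diff_true hm hN a b c⟩
      change diff m N (gen m N (fun _ => true) a b c) ∈ _
      rw [diff_true hm hN]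
      exact Submodule.smul_mem _ _ (Submodule.add_mem _ (Submodule.add_mem _
        (Submodule.smul_mem _ _ (key _ _ _ (by omega)))
        (Submodule.smul_mem _ _ (key _ _ _ (by omega))))
        (Submodule.smul_mem _ _ (key _ _ _ (by omega))))

instance finite_kerFn (k : ℕ) : Module.Finite ℚ (kerFn k) :=
  Module.Finite.of_injective (Submodule.inclusion (inf_le_left : kerFn k ≤ skewFn koszul (EvenTri k)))
    (Submodule.inclusion_injective _)

/-- All chains of defect zero are cycles, and a functional vanishes on the boundaries exactly if its
function on the generators is killed by `addDual`. So the homology is dual to `kerFn`. -/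
theorem finrank_homology_zero {m N : ℕ} (hm : Even m) (hN : Odd N) (d : ℕ) :
    Module.finrank ℚ (Homology m N 0 (d + 1)) = Module.finrank ℚ (kerFn (d + 1)) := by
  refine (finrank_of_functionals (g := gen m N (fun _ => false)) (d := d + 1) ?_
    (boundaries_zero_le hm hN d) ?_ ?_ ?_).2
  · rw [cycles_zero hm hN (Nat.succ_pos d)]
    exact chains_eq_span (d := d + 1) hm hN (Nat.zero_le 2) (Nat.succ_pos d)
  · intro Φ hΦ
    refine mem_kerFn.2 ⟨dual_gen_mem_even hm hN rfl _ Φ, fun a b c => ?_⟩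
    by_cases hd : a + b + c = d
    · rw [if_pos (by omega), if_pos (by omega), if_pos (by omega)]
      have hb := hΦ (diff m N (gen m N not a b c)) ⟨_, ?_, rfl⟩
      · rw [diff_not hm hN] at hb
        simpa using hb
      · rw [chains_eq_span (d := d) hm hN (Nat.le_succ 1) (Nat.succ_pos d)]
        exact Submodule.subset_span ⟨a, b, c, hd, rfl⟩
    · rw [if_neg (by omega), if_neg (by omega), if_neg (by omega)]
      ring
  · intro φ hφ
    obtain ⟨h1, h2⟩ := mem_kerFn.1 hφ
    obtain ⟨Φ, hΦ⟩ := exists_functional_gen (k₂ := d) (P := EvenTri d) hm hN h1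
        (Submodule.zero_mem _) (Submodule.zero_mem _)
    refine ⟨Φ, ?_, fun a b c => (hΦ a b c).1⟩
    have : boundaries m N 0 (d + 1) ≤ LinearMap.ker Φ := by
      rw [boundaries_zero hm hN, Submodule.span_le]
      rintro _ ⟨a, b, c, -, rfl⟩
      rw [SetLike.mem_coe, LinearMap.mem_ker, map_add, map_add, map_smul, map_smul, (hΦ _ _ _).1,
        (hΦ _ _ _).1, (hΦ _ _ _).1]
      exact h2 a b c
    exact fun b hb => this hb
  · exact fun φ hφ a b c hne => ((mem_kerFn.1 hφ).1.2.2 a b c hne).1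

/-- The differential is injective on the chains of defect two. -/
theorem cycles_two {m N : ℕ} (hm : Even m) (hN : Odd N) (d : ℕ) : cycles m N 2 (d + 2) = ⊥ := by
  rw [eq_bot_iff]
  rintro x ⟨hx, h0⟩
  rw [Submodule.mem_bot, ← Module.forall_dual_apply_eq_zero_iff ℚ]
  intro Φ
  -- Every functional on the chains of defect two factors through the differential, so all of them
  -- vanish on cycles. The factorisation comes from the surjectivity of `addDual`.
  obtain ⟨ψ, ⟨p1, p2, p3⟩, hψ⟩ := exists_addDual isSignRule_koszul
    (dual_gen_mem hm hN (fun _ => true) d Φ)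
  -- The factor `1 / 2` cancels `1 + flp a b c = 2`, and the sign cancels the reflection signs in
  -- `diff_true`.
  have hψ' : (fun a b c => 1 / 2 * flp a b c * ψ a b c) ∈ skewFn koszul (HasSum3 (d + 1)) := by
    refine ⟨fun a b c => ?_, fun a b c => ?_, fun a b c h => p3 a b c (right_ne_zero_of_mul h)⟩
    · dsimp only
      rw [p1, flp, flp, add_comm (tri a)]
      ring
    · dsimp only
      rw [p2, flp, flp, add_right_comm (tri a)]
      ring
  obtain ⟨Φ', hΦ'⟩ := exists_functional_gen (m := m) (N := N) (k₀ := d) (k₂ := d) hm hN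
    (Submodule.zero_mem _) hψ' (Submodule.zero_mem _)
  have key : chains m N 2 (d + 2) ≤ LinearMap.ker (Φ - Φ' ∘ₗ diff m N) := by
    rw [chains_eq_span (d := d) hm hN le_rfl (Nat.succ_pos _), Submodule.span_le]
    rintro _ ⟨a, b, c, hd, rfl⟩
    change Φ (gen m N (fun _ => true) a b c) - Φ' (diff m N (gen m N (fun _ => true) a b c)) = 0
    rw [diff_true hm hN]
    rcases flp_cases a b c with ⟨-, hf⟩ | hf
    · have h1 := congrFun (congrFun (congrFun hψ a) b) c
      change ψ (a + 1) b c + par a * ψ a (b + 1) c + par a * par b * ψ a b (c + 1) =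
        if a + b + c = d then _ else 0 at h1
      rw [if_pos hd] at h1
      simp only [map_add, map_smul, (hΦ' _ _ _).2.1, smul_eq_mul, hf]
      rw [← h1]
      linear_combination (-ψ (a + 1) b c) * flp_mul_self (a + 1) b c -
        par a * ψ a (b + 1) c * flp_mul_self a (b + 1) c -
        par a * par b * ψ a b (c + 1) * flp_mul_self a b (c + 1)
    · rw [gen_eq_zero hm hN rfl hf, hf]
      simp
  have := key hx
  rw [LinearMap.mem_ker, LinearMap.sub_apply, LinearMap.comp_apply, LinearMap.mem_ker.1 h0, map_zero,
    sub_zero] at this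
  exact this

/-- The Euler characteristic argument for the dimension of the homology in defect one. -/
theorem finrank_homology_one {m N : ℕ} (hm : Even m) (hN : Odd N) (d : ℕ) :
    Module.finrank ℚ (Homology m N 1 (d + 1)) + Module.finrank ℚ (chains m N 0 (d + 1)) +
      Module.finrank ℚ (chains m N 2 (d + 1)) =
    Module.finrank ℚ (chains m N 1 (d + 1)) + Module.finrank ℚ (Homology m N 0 (d + 1)) := by
  have hfin := finite_chains (m := m) (N := N) hm hN
  have hfc : ∀ i, Module.Finite ℚ (cycles m N i (d + 1)) := fun i =>
    Module.Finite.of_injective (Submodule.inclusion inf_le_left) (Submodule.inclusion_injective _)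
  have hq : ∀ i, Module.finrank ℚ (Homology m N i (d + 1)) +
      Module.finrank ℚ (boundaries m N i (d + 1)) = Module.finrank ℚ (cycles m N i (d + 1)) := by
    intro i
    rw [← Submodule.finrank_quotient_add_finrank
      ((boundaries m N i (d + 1)).submoduleOf (cycles m N i (d + 1))),
      (Submodule.submoduleOfEquivOfLe (boundaries_le_cycles hm hN i (d + 1))).finrank_eq]
  have hb : ∀ i, Module.finrank ℚ (boundaries m N i (d + 1)) +
      Module.finrank ℚ (cycles m N (i + 1) (d + 1)) =
      Module.finrank ℚ (chains m N (i + 1) (d + 1)) := fun i => finrank_map_add (diff m N) _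
  have h2 : cycles m N 2 (d + 1) = ⊥ := by
    obtain _ | d := d
    · rw [cycles, chains_eq_bot m N (by omega), bot_inf_eq]
    · exact cycles_two hm hN d
  have q0 := hq 0
  have q1 := hq 1
  have b0 := hb 0
  have b1 := hb 1
  have c0 : Module.finrank ℚ (cycles m N 0 (d + 1)) = Module.finrank ℚ (chains m N 0 (d + 1)) := by
    rw [cycles_zero hm hN (Nat.succ_pos d)]
  have c2 : Module.finrank ℚ (cycles m N 2 (d + 1)) = 0 := by rw [h2, finrank_bot]
  simp only [Nat.reduceAdd] at b0 b1
  omega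

/-! ### Counting triples -/

/-- The weakly increasing triples with sum `e`. -/
def incr (e : ℤ) : Set (ℕ × ℕ × ℕ) := {t | t.1 ≤ t.2.1 ∧ t.2.1 ≤ t.2.2 ∧ (t.1 + t.2.1 + t.2.2 : ℤ) = e}

/-- The triples with sum `e` whose last two entries are weakly increasing. -/
def halfIncr (e : ℤ) : Set (ℕ × ℕ × ℕ) := {t | t.2.1 ≤ t.2.2 ∧ (t.1 + t.2.1 + t.2.2 : ℤ) = e}

theorem halfIncr_finite (e : ℤ) : (halfIncr e).Finite := by
  refine (Finset.finite_toSet (Finset.range (e.toNat + 1) ×ˢ Finset.range (e.toNat + 1) ×ˢ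
    Finset.range (e.toNat + 1))).subset fun t ht => ?_
  have := ht.2
  simp only [Finset.coe_product, Set.mem_prod, Finset.coe_range, Set.mem_Iio]
  omega

theorem incr_finite (e : ℤ) : (incr e).Finite := (halfIncr_finite e).subset fun _ ht => ht.2

theorem incr_neg {e : ℤ} (he : e < 0) : (incr e).ncard = 0 := by
  have : incr e = ∅ := by
    ext t
    simp only [incr, Set.mem_ofPred_eq, Set.mem_empty_iff_false, iff_false]
    omega
  rw [this, Set.ncard_empty]

theorem halfIncr_neg {e : ℤ} (he : e < 0) : (halfIncr e).ncard = 0 := by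
  have : halfIncr e = ∅ := by
    ext t
    simp only [halfIncr, Set.mem_ofPred_eq, Set.mem_empty_iff_false, iff_false]
    omega
  rw [this, Set.ncard_empty]

theorem ncard_pairs {e : ℤ} (he : 0 ≤ e) :
    ({t | t.1 = 0 ∧ t.2.1 ≤ t.2.2 ∧ (t.1 + t.2.1 + t.2.2 : ℤ) = e} : Set (ℕ × ℕ × ℕ)).ncard =
      e / 2 + 1 := by
  have : ({t | t.1 = 0 ∧ t.2.1 ≤ t.2.2 ∧ (t.1 + t.2.1 + t.2.2 : ℤ) = e} : Set (ℕ × ℕ × ℕ)) =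
      (fun y : ℕ => (0, y, (e - y).toNat)) '' (Finset.range ((e / 2).toNat + 1) : Set ℕ) := by
    ext ⟨x, y, z⟩
    simp only [Set.mem_ofPred_eq, Finset.coe_range, Set.mem_image, Set.mem_Iio, Prod.mk.injEq]
    constructor
    · rintro ⟨h1, h2, h3⟩
      exact ⟨y, by omega, by omega, rfl, by omega⟩
    · rintro ⟨y', h1, rfl, rfl, rfl⟩
      omega
  rw [this, Set.ncard_image_of_injective _ fun a b hab => (Prod.ext_iff.1 (Prod.ext_iff.1 hab).2).1,
    Set.ncard_coe_finset, Finset.card_range]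
  omega

/-- Either the smallest entry is zero and a pair remains, or one can be subtracted from all three
entries. -/
theorem incr_step {e : ℤ} (he : -3 ≤ e) :
    ((incr (e + 3)).ncard : ℤ) = (incr e).ncard + (e + 3) / 2 + 1 := by
  have hun : incr (e + 3) = (fun t : ℕ × ℕ × ℕ => (t.1 + 1, t.2.1 + 1, t.2.2 + 1)) '' incr e ∪
      {t | t.1 = 0 ∧ t.2.1 ≤ t.2.2 ∧ (t.1 + t.2.1 + t.2.2 : ℤ) = e + 3} := by
    ext ⟨x, y, z⟩
    simp only [incr, Set.mem_ofPred_eq, Set.mem_union, Set.mem_image, Prod.mk.injEq, Prod.exists]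
    constructor
    · rintro ⟨h1, h2, h3⟩
      obtain _ | x := x
      · exact Or.inr ⟨rfl, h2, h3⟩
      · exact Or.inl ⟨x, y - 1, z - 1, by omega, rfl, by omega, by omega⟩
    · rintro (⟨x, y, z, h1, rfl, rfl, rfl⟩ | h1) <;> omega
  rw [hun, Set.ncard_union_eq ?_ ((incr_finite e).image _) ((incr_finite (e + 3)).subset ?_),
    Set.ncard_image_of_injective, Nat.cast_add, ncard_pairs (by omega)]
  · ring
  · rintro ⟨x, y, z⟩ ⟨x', y', z'⟩ h
    simpa using h
  · rw [Set.disjoint_left]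
    rintro _ ⟨t, -, rfl⟩ ⟨h, -⟩
    simp at h
  · rw [hun]
    exact Set.subset_union_right

/-- Either the first entry is zero, or one can be subtracted from it. -/
theorem halfIncr_step {e : ℤ} (he : -1 ≤ e) :
    ((halfIncr (e + 1)).ncard : ℤ) = (halfIncr e).ncard + (e + 1) / 2 + 1 := by
  have hun : halfIncr (e + 1) = (fun t : ℕ × ℕ × ℕ => (t.1 + 1, t.2.1, t.2.2)) '' halfIncr e ∪
      {t | t.1 = 0 ∧ t.2.1 ≤ t.2.2 ∧ (t.1 + t.2.1 + t.2.2 : ℤ) = e + 1} := by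
    ext ⟨x, y, z⟩
    simp only [halfIncr, Set.mem_ofPred_eq, Set.mem_union, Set.mem_image, Prod.mk.injEq, Prod.exists]
    constructor
    · rintro ⟨h1, h2⟩
      obtain _ | x := x
      · exact Or.inr ⟨rfl, h1, h2⟩
      · exact Or.inl ⟨x, y, z, by omega, rfl, rfl, rfl⟩
    · rintro (⟨x, y, z, h1, rfl, rfl, rfl⟩ | h1) <;> omega
  rw [hun, Set.ncard_union_eq ?_ ((halfIncr_finite e).image _)
    ((halfIncr_finite (e + 1)).subset ?_), Set.ncard_image_of_injective, Nat.cast_add,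
    ncard_pairs (by omega)]
  · ring
  · rintro ⟨x, y, z⟩ ⟨x', y', z'⟩ h
    simpa using h
  · rw [Set.disjoint_left]
    rintro _ ⟨t, -, rfl⟩ ⟨h, -⟩
    simp at h
  · rw [hun]
    exact Set.subset_union_right

/-! ### Sorted triples with a prescribed number of odd entries -/

/-- The order in which the odd numbers precede the even numbers. -/
def oddFirst (a b : ℕ) : Prop := b % 2 < a % 2 ∨ (a % 2 = b % 2 ∧ a ≤ b)

instance : Std.Total oddFirst := ⟨fun a b => by unfold oddFirst; omega⟩

instance : Std.Antisymm oddFirst := ⟨fun a b => by unfold oddFirst; omega⟩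

instance : IsTrans ℕ oddFirst := ⟨fun a b c => by unfold oddFirst; omega⟩

/-- The triples with sum `d` and `o` odd entries. -/
def NumOdd (o d a b c : ℕ) : Prop := a + b + c = d ∧ a % 2 + b % 2 + c % 2 = o

/-- The number of ordered triples with sum `d` and `o` odd entries. -/
def numCanon (o d : ℕ) : ℕ := (canonSet koszul oddFirst (NumOdd o d)).ncard

theorem mem_canonSet_koszul {o d a b c : ℕ} : (a, b, c) ∈ canonSet koszul oddFirst (NumOdd o d) ↔
    oddFirst a b ∧ oddFirst b c ∧ NumOdd o d a b c ∧ (a = b → a % 2 = 0) ∧ (b = c → b % 2 = 0) := by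
  have h : ∀ x, koszul x x = 1 ↔ x % 2 = 0 := by
    intro x
    obtain ⟨y, rfl | rfl⟩ := cases_parity x
    · simp
    · rw [koszul_odd]
      norm_num
  simp only [canonSet, Set.mem_ofPred_eq, IsCanon, h]

theorem numCanon_zero (e : ℕ) : numCanon 0 (2 * e) = (incr e).ncard := by
  have : canonSet koszul oddFirst (NumOdd 0 (2 * e)) =
      (fun t : ℕ × ℕ × ℕ => (2 * t.1, 2 * t.2.1, 2 * t.2.2)) '' incr e := by
    ext ⟨a, b, c⟩
    simp only [mem_canonSet_koszul, oddFirst, NumOdd, incr, Set.mem_image, Set.mem_ofPred_eq,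
      Prod.exists, Prod.mk.injEq]
    constructor
    · intro h
      exact ⟨a / 2, b / 2, c / 2, by omega⟩
    · rintro ⟨x, y, z, h⟩
      omega
  rw [numCanon, this, Set.ncard_image_of_injective]
  rintro ⟨x, y, z⟩ ⟨x', y', z'⟩ h
  simp only [Prod.mk.injEq] at h ⊢
  omega

theorem numCanon_one (e : ℕ) : numCanon 1 (2 * e + 1) = (halfIncr e).ncard := by
  have : canonSet koszul oddFirst (NumOdd 1 (2 * e + 1)) =
      (fun t : ℕ × ℕ × ℕ => (2 * t.1 + 1, 2 * t.2.1, 2 * t.2.2)) '' halfIncr e := by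
    ext ⟨a, b, c⟩
    simp only [mem_canonSet_koszul, oddFirst, NumOdd, halfIncr, Set.mem_image, Set.mem_ofPred_eq,
      Prod.exists, Prod.mk.injEq]
    constructor
    · intro h
      exact ⟨a / 2, b / 2, c / 2, by omega⟩
    · rintro ⟨x, y, z, h⟩
      omega
  rw [numCanon, this, Set.ncard_image_of_injective]
  rintro ⟨x, y, z⟩ ⟨x', y', z'⟩ h
  simp only [Prod.mk.injEq] at h ⊢
  omega

/-- The two odd entries must be distinct because exchanging equal odd entries has sign `-1`; they
are written `2 * y + 1 < 2 * z + 3` with `y ≤ z`. -/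
theorem numCanon_two (e : ℕ) : numCanon 2 (2 * e) = (halfIncr (e - 2)).ncard := by
  have : canonSet koszul oddFirst (NumOdd 2 (2 * e)) =
      (fun t : ℕ × ℕ × ℕ => (2 * t.2.1 + 1, 2 * t.2.2 + 3, 2 * t.1)) '' halfIncr (e - 2) := by
    ext ⟨a, b, c⟩
    simp only [mem_canonSet_koszul, oddFirst, NumOdd, halfIncr, Set.mem_image, Set.mem_ofPred_eq,
      Prod.exists, Prod.mk.injEq]
    constructor
    · intro h
      exact ⟨c / 2, a / 2, b / 2 - 1, by omega⟩
    · rintro ⟨x, y, z, h⟩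
      omega
  rw [numCanon, this, Set.ncard_image_of_injective]
  rintro ⟨x, y, z⟩ ⟨x', y', z'⟩ h
  simp only [Prod.mk.injEq] at h ⊢
  omega

/-- Three distinct odd entries: removing the staircase `1, 3, 5` and halving leaves a weakly
increasing triple with sum `e - 4`. -/
theorem numCanon_three (e : ℕ) : numCanon 3 (2 * e + 1) = (incr (e - 4)).ncard := by
  have : canonSet koszul oddFirst (NumOdd 3 (2 * e + 1)) =
      (fun t : ℕ × ℕ × ℕ => (2 * t.1 + 1, 2 * t.2.1 + 3, 2 * t.2.2 + 5)) '' incr (e - 4) := by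
    ext ⟨a, b, c⟩
    simp only [mem_canonSet_koszul, oddFirst, NumOdd, incr, Set.mem_image, Set.mem_ofPred_eq,
      Prod.exists, Prod.mk.injEq]
    constructor
    · intro h
      exact ⟨a / 2, b / 2 - 1, c / 2 - 2, by omega⟩
    · rintro ⟨x, y, z, h⟩
      omega
  rw [numCanon, this, Set.ncard_image_of_injective]
  rintro ⟨x, y, z⟩ ⟨x', y', z'⟩ h
  simp only [Prod.mk.injEq] at h ⊢
  omega

theorem tri_mod_two (x : ℕ) : tri x % 2 = (x / 2 + x % 2) % 2 := by
  obtain ⟨y, rfl | rfl⟩ := cases_parity x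
  · rw [even_tri_even]
    omega
  · rw [even_tri_odd]
    omega

/-- Modulo two `tri x` is `x / 2 + x % 2`. With `o` odd entries the sum of the three values is
therefore `(d + o) / 2`, which is even exactly if `o` is `-d`, that is `3 * d`, modulo four. -/
theorem evenTri_iff (d a b c : ℕ) : EvenTri d a b c ↔ NumOdd (3 * d % 4) d a b c := by
  rw [EvenTri, NumOdd, Nat.even_iff]
  have h1 := tri_mod_two a
  have h2 := tri_mod_two b
  have h3 := tri_mod_two c
  refine and_congr_right fun hd => ?_
  rcases Nat.mod_two_eq_zero_or_one a with ha | ha <;>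
    rcases Nat.mod_two_eq_zero_or_one b with hb | hb <;>
    rcases Nat.mod_two_eq_zero_or_one c with hc | hc <;> rw [ha] at h1 ⊢ <;> rw [hb] at h2 ⊢ <;>
    rw [hc] at h3 ⊢ <;> omega

theorem finrank_evenTri (d : ℕ) :
    Module.finrank ℚ (skewFn koszul (EvenTri d)) = numCanon (3 * d % 4) d := by
  have : EvenTri d = NumOdd (3 * d % 4) d := by
    funext a b c
    exact propext (evenTri_iff d a b c)
  rw [this, numCanon]
  refine finrank_skewFn isSignRule_koszul oddFirst (d := d) ?_ ?_ fun _ _ _ h => h.1 <;>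
    · intro a b c
      unfold NumOdd
      omega

/-- The number of odd entries has the parity of `d`, which leaves two of the values `0, 1, 2, 3`. -/
theorem finrank_hasSum3 (d : ℕ) : Module.finrank ℚ (skewFn koszul (HasSum3 d)) =
    numCanon (3 * d % 4) d + numCanon ((3 * d + 2) % 4) d := by
  rw [finrank_skewFn isSignRule_koszul oddFirst (d := d), numCanon, numCanon,
    ← Set.ncard_union_eq _ (canonSet_finite (d := d) fun _ _ _ h => h.1)
      (canonSet_finite (d := d) fun _ _ _ h => h.1)]
  · congr 1
    ext ⟨a, b, c⟩
    have : HasSum3 d a b c ↔ NumOdd (3 * d % 4) d a b c ∨ NumOdd ((3 * d + 2) % 4) d a b c := by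
      unfold HasSum3 NumOdd
      rw [← and_or_left]
      refine ⟨fun h => ⟨h, ?_⟩, fun h => h.1⟩
      rcases Nat.mod_two_eq_zero_or_one a with ha | ha <;>
        rcases Nat.mod_two_eq_zero_or_one b with hb | hb <;>
        rcases Nat.mod_two_eq_zero_or_one c with hc | hc <;> rw [ha, hb, hc] <;> omega
    simp only [canonSet, Set.mem_union, Set.mem_ofPred_eq, IsCanon, this]
    tauto
  · rw [Set.disjoint_left]
    rintro ⟨a, b, c⟩ ⟨-, -, ⟨-, h1⟩, -⟩ ⟨-, -, ⟨-, h2⟩, -⟩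
    omega
  · intro a b c
    unfold HasSum3
    omega
  · intro a b c
    unfold HasSum3
    omega
  · exact fun _ _ _ h => h

theorem finrank_sym (d : ℕ) : Module.finrank ℚ (skewFn 1 (HasSum3 d)) = (incr d).ncard := by
  rw [finrank_skewFn isSignRule_one (· ≤ ·) (d := d)]
  · congr 1
    ext ⟨a, b, c⟩
    simp only [canonSet, incr, Set.mem_ofPred_eq, IsCanon, HasSum3, Pi.one_apply, implies_true,
      and_true]
    omega
  · intro a b c
    unfold HasSum3
    omega
  · intro a b c
    unfold HasSum3
    omega
  · exact fun _ _ _ h => h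

/-- The sorted triples are strictly increasing; the staircase `0, 1, 2` is subtracted. -/
theorem finrank_alt (d : ℕ) : Module.finrank ℚ (skewFn (-1) (HasSum3 d)) = (incr (d - 3)).ncard := by
  have : canonSet (-1) (· ≤ ·) (HasSum3 d) =
      (fun t : ℕ × ℕ × ℕ => (t.1, t.2.1 + 1, t.2.2 + 2)) '' incr (d - 3) := by
    ext ⟨a, b, c⟩
    have hne : ∀ x, (-1 : ℕ → ℕ → ℚ) x x = 1 ↔ False := fun x => by
      rw [Pi.neg_apply, Pi.neg_apply, Pi.one_apply, Pi.one_apply]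
      norm_num
    simp only [canonSet, incr, Set.mem_ofPred_eq, IsCanon, HasSum3, hne, Set.mem_image, Prod.exists,
      Prod.mk.injEq]
    constructor
    · intro h
      have h4 : a ≠ b := h.2.2.2.1
      have h5 : b ≠ c := h.2.2.2.2
      exact ⟨a, b - 1, c - 2, by omega⟩
    · rintro ⟨x, y, z, h⟩
      omega
  rw [finrank_skewFn isSignRule_neg_one (· ≤ ·) (d := d), this, Set.ncard_image_of_injective]
  · rintro ⟨x, y, z⟩ ⟨x', y', z'⟩ h
    simpa using h
  · intro a b c
    unfold HasSum3
    omega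
  · intro a b c
    unfold HasSum3
    omega
  · exact fun _ _ _ h => h

/-! ### Betti numbers -/

theorem incr_step_six {e : ℤ} (he : -3 ≤ e) :
    ((incr (e + 6)).ncard : ℤ) = (incr e).ncard + (e + 3) / 2 + (e + 6) / 2 + 2 := by
  have h1 := incr_step he
  have h2 := incr_step (e := e + 3) (by omega)
  rw [show e + 3 + 3 = e + 6 by ring] at h2
  omega

theorem incr_neg' {e : ℤ} (he : e < 0) : ((incr e).ncard : ℤ) = 0 := by
  rw [incr_neg he]
  rfl

/-- Values of the counting function on small arguments. -/
theorem incr_small : ((incr 0).ncard : ℤ) = 1 ∧ ((incr 1).ncard : ℤ) = 1 ∧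
    ((incr 2).ncard : ℤ) = 2 ∧ ((incr 3).ncard : ℤ) = 3 ∧ ((incr 4).ncard : ℤ) = 4 ∧
    ((incr 5).ncard : ℤ) = 5 ∧ ((incr 6).ncard : ℤ) = 7 := by
  have h0 : ((incr 0).ncard : ℤ) = (incr (-3)).ncard + 0 / 2 + 1 := by
    have h := incr_step (e := -3) (by norm_num)
    rwa [show (-3 : ℤ) + 3 = 0 by norm_num] at h
  have h1 : ((incr 1).ncard : ℤ) = (incr (-2)).ncard + 1 / 2 + 1 := by
    have h := incr_step (e := -2) (by norm_num)
    rwa [show (-2 : ℤ) + 3 = 1 by norm_num] at h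
  have h2 : ((incr 2).ncard : ℤ) = (incr (-1)).ncard + 2 / 2 + 1 := by
    have h := incr_step (e := -1) (by norm_num)
    rwa [show (-1 : ℤ) + 3 = 2 by norm_num] at h
  have h3 : ((incr 3).ncard : ℤ) = (incr 0).ncard + 3 / 2 + 1 := incr_step (e := 0) (by norm_num)
  have h4 : ((incr 4).ncard : ℤ) = (incr 1).ncard + 4 / 2 + 1 := incr_step (e := 1) (by norm_num)
  have h5 : ((incr 5).ncard : ℤ) = (incr 2).ncard + 5 / 2 + 1 := incr_step (e := 2) (by norm_num)
  have h6 : ((incr 6).ncard : ℤ) = (incr 3).ncard + 6 / 2 + 1 := incr_step (e := 3) (by norm_num)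
  have k1 := incr_neg' (e := -1) (by norm_num)
  have k2 := incr_neg' (e := -2) (by norm_num)
  have k3 := incr_neg' (e := -3) (by norm_num)
  omega

/-- The values of the counting function, up to a quadratic polynomial. -/
theorem incr_closed (t : ℕ) : ∃ q : ℤ, ((incr (6 * t)).ncard : ℤ) = q ∧
    ((incr (6 * t + 1)).ncard : ℤ) = q + t ∧ ((incr (6 * t + 2)).ncard : ℤ) = q + 2 * t + 1 ∧
    ((incr (6 * t + 3)).ncard : ℤ) = q + 3 * t + 2 ∧
    ((incr (6 * t + 4)).ncard : ℤ) = q + 4 * t + 3 ∧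
    ((incr (6 * t + 5)).ncard : ℤ) = q + 5 * t + 4 ∧
    ((incr (6 * t + 6)).ncard : ℤ) = q + 6 * t + 6 := by
  induction t with
  | zero =>
    obtain ⟨h0, h1, h2, h3, h4, h5, h6⟩ := incr_small
    exact ⟨1, by simpa using h0, by simpa using h1, by simpa using h2, by simpa using h3,
      by simpa using h4, by simpa using h5, by simpa using h6⟩
  | succ t ih =>
    obtain ⟨q, h0, h1, h2, h3, h4, h5, h6⟩ := ih
    have k0 := incr_step_six (e := 6 * t) (by omega)
    have k1 := incr_step_six (e := 6 * t + 1) (by omega)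
    have k2 := incr_step_six (e := 6 * t + 2) (by omega)
    have k3 := incr_step_six (e := 6 * t + 3) (by omega)
    have k4 := incr_step_six (e := 6 * t + 4) (by omega)
    have k5 := incr_step_six (e := 6 * t + 5) (by omega)
    have k6 := incr_step_six (e := 6 * t + 6) (by omega)
    -- The last value of the block, at `6 * t + 6`, is the first value of the next one.
    refine ⟨q + 6 * t + 6, ?_⟩
    push_cast
    ring_nf at *
    omega

theorem evenTri_zero (j : ℕ) : (Module.finrank ℚ (skewFn koszul (EvenTri (4 * j))) : ℤ) =
    (incr (2 * j)).ncard := by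
  rw [finrank_evenTri, show 3 * (4 * j) % 4 = 0 by omega, show 4 * j = 2 * (2 * j) by ring,
    numCanon_zero]
  push_cast
  rfl

theorem evenTri_one (j : ℕ) : (Module.finrank ℚ (skewFn koszul (EvenTri (4 * j + 1))) : ℤ) =
    (incr (2 * j - 4)).ncard := by
  rw [finrank_evenTri, show 3 * (4 * j + 1) % 4 = 3 by omega,
    show 4 * j + 1 = 2 * (2 * j) + 1 by ring, numCanon_three]
  push_cast
  rfl

theorem evenTri_two (j : ℕ) : (Module.finrank ℚ (skewFn koszul (EvenTri (4 * j + 2))) : ℤ) =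
    (halfIncr (2 * j - 1)).ncard := by
  rw [finrank_evenTri, show 3 * (4 * j + 2) % 4 = 2 by omega,
    show 4 * j + 2 = 2 * (2 * j + 1) by ring, numCanon_two]
  push_cast
  rw [show (2 * (j : ℤ) + 1 - 2) = 2 * j - 1 by ring]

theorem evenTri_three (j : ℕ) : (Module.finrank ℚ (skewFn koszul (EvenTri (4 * j + 3))) : ℤ) =
    (halfIncr (2 * j + 1)).ncard := by
  rw [finrank_evenTri, show 3 * (4 * j + 3) % 4 = 1 by omega,
    show 4 * j + 3 = 2 * (2 * j + 1) + 1 by ring, numCanon_one]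
  push_cast
  rfl

theorem hasSum3_zero (j : ℕ) : (Module.finrank ℚ (skewFn koszul (HasSum3 (4 * j))) : ℤ) =
    (incr (2 * j)).ncard + (halfIncr (2 * j - 2)).ncard := by
  rw [finrank_hasSum3, show 3 * (4 * j) % 4 = 0 by omega, show (3 * (4 * j) + 2) % 4 = 2 by omega,
    show 4 * j = 2 * (2 * j) by ring, numCanon_zero, numCanon_two]
  push_cast
  rfl

theorem hasSum3_one (j : ℕ) : (Module.finrank ℚ (skewFn koszul (HasSum3 (4 * j + 1))) : ℤ) =
    (halfIncr (2 * j)).ncard + (incr (2 * j - 4)).ncard := by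
  rw [finrank_hasSum3, show 3 * (4 * j + 1) % 4 = 3 by omega,
    show (3 * (4 * j + 1) + 2) % 4 = 1 by omega, show 4 * j + 1 = 2 * (2 * j) + 1 by ring,
    numCanon_three, numCanon_one, add_comm]
  push_cast
  rfl

theorem hasSum3_two (j : ℕ) : (Module.finrank ℚ (skewFn koszul (HasSum3 (4 * j + 2))) : ℤ) =
    (halfIncr (2 * j - 1)).ncard + (incr (2 * j + 1)).ncard := by
  rw [finrank_hasSum3, show 3 * (4 * j + 2) % 4 = 2 by omega,
    show (3 * (4 * j + 2) + 2) % 4 = 0 by omega, show 4 * j + 2 = 2 * (2 * j + 1) by ring,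
    numCanon_two, numCanon_zero]
  push_cast
  rw [show (2 * (j : ℤ) + 1 - 2) = 2 * j - 1 by ring]

theorem hasSum3_three (j : ℕ) : (Module.finrank ℚ (skewFn koszul (HasSum3 (4 * j + 3))) : ℤ) =
    (halfIncr (2 * j + 1)).ncard + (incr (2 * j - 3)).ncard := by
  rw [finrank_hasSum3, show 3 * (4 * j + 3) % 4 = 1 by omega,
    show (3 * (4 * j + 3) + 2) % 4 = 3 by omega, show 4 * j + 3 = 2 * (2 * j + 1) + 1 by ring,
    numCanon_three, numCanon_one]
  push_cast
  rw [show (2 * (j : ℤ) + 1 - 4) = 2 * j - 3 by ring]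

/-- Differences of the counting function near an even argument. -/
theorem incr_diff (j : ℕ) :
    ((incr (2 * j + 1)).ncard : ℤ) = (incr (2 * j)).ncard + ((j : ℤ) + 2) / 3 ∧
    ((incr (2 * j + 2)).ncard : ℤ) = (incr (2 * j + 1)).ncard + ((j : ℤ) + 1) / 3 + 1 := by
  obtain ⟨q, h0, h1, h2, h3, h4, h5, h6⟩ := incr_closed (j / 3)
  have hr : j = 3 * (j / 3) ∨ j = 3 * (j / 3) + 1 ∨ j = 3 * (j / 3) + 2 := by omega
  generalize j / 3 = t at *
  rcases hr with rfl | rfl | rfl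
  · rw [show (2 * ((3 * t : ℕ) : ℤ)) = 6 * t by push_cast; ring, h0, h1, h2]
    omega
  · rw [show (2 * ((3 * t + 1 : ℕ) : ℤ)) = 6 * t + 2 by push_cast; ring,
      show (6 * (t : ℤ) + 2 + 1) = 6 * t + 3 by ring, show (6 * (t : ℤ) + 2 + 2) = 6 * t + 4 by ring,
      h2, h3, h4]
    omega
  · rw [show (2 * ((3 * t + 2 : ℕ) : ℤ)) = 6 * t + 4 by push_cast; ring,
      show (6 * (t : ℤ) + 4 + 1) = 6 * t + 5 by ring, show (6 * (t : ℤ) + 4 + 2) = 6 * t + 6 by ring,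
      h4, h5, h6]
    omega

theorem incr_shift_three (j : ℕ) :
    ((incr (2 * j)).ncard : ℤ) = (incr (2 * j - 3)).ncard + j + 1 := by
  have h := incr_step (e := 2 * j - 3) (by omega)
  rw [show 2 * (j : ℤ) - 3 + 3 = 2 * j by ring] at h
  omega

theorem incr_shift_four (j : ℕ) :
    ((incr (2 * j + 2)).ncard : ℤ) = (incr (2 * j - 4)).ncard + 2 * j + 2 := by
  -- At `j = 0` the argument `-4` lies below the range of `incr_step_six`.
  obtain rfl | hj := j.eq_zero_or_pos
  · rw [incr_neg' (e := 2 * (0 : ℕ) - 4) (by norm_num)]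
    simpa using incr_small.2.2.1
  have h := incr_step_six (e := 2 * j - 4) (by omega)
  rw [show 2 * (j : ℤ) - 4 + 6 = 2 * j + 2 by ring] at h
  omega

theorem incr_shift_five (j : ℕ) :
    ((incr (2 * j + 1)).ncard : ℤ) = (incr (2 * j - 5)).ncard + 2 * j + 1 := by
  obtain rfl | hj := j.eq_zero_or_pos
  · rw [incr_neg' (e := 2 * (0 : ℕ) - 5) (by norm_num)]
    simpa using incr_small.2.1
  have h := incr_step_six (e := 2 * j - 5) (by omega)
  rw [show 2 * (j : ℤ) - 5 + 6 = 2 * j + 1 by ring] at h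
  omega

theorem halfIncr_even (j : ℕ) :
    ((halfIncr (2 * j)).ncard : ℤ) = (halfIncr (2 * j - 1)).ncard + j + 1 := by
  have h := halfIncr_step (e := 2 * j - 1) (by omega)
  rw [show 2 * (j : ℤ) - 1 + 1 = 2 * j by ring] at h
  omega

theorem halfIncr_odd (j : ℕ) :
    ((halfIncr (2 * j + 1)).ncard : ℤ) = (halfIncr (2 * j)).ncard + j + 1 := by
  have h := halfIncr_step (e := 2 * j) (by omega)
  omega

/-- By surjectivity of the unsigned operator the dimension is the number of weakly increasing
triples with sum `2 * j + 2` minus that with sum `2 * j + 1`. -/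
theorem finrank_kerFn_three (j : ℕ) :
    Module.finrank ℚ (kerFn (4 * j + 3)) = (j + 1) / 3 + 1 := by
  have h := finrank_ker_addDual isSignRule_one (2 * j + 1)
  rw [finrank_sym, finrank_sym, ← kerFn_three] at h
  have h' := (incr_diff j).2
  push_cast at h
  rw [show (2 * (j : ℤ) + 1 + 1) = 2 * j + 2 by ring] at h
  omega

/-- For `j > 0` the dimension is the number of strictly increasing triples with sum `2 * j` minus
that with sum `2 * j - 1`; there are none with sum zero. -/
theorem finrank_kerFn_two (j : ℕ) : Module.finrank ℚ (kerFn (4 * j + 2)) = j / 3 := by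
  rw [kerFn_two]
  obtain _ | i := j
  · have h := Submodule.finrank_mono (inf_le_left : skewFn (-1) (HasSum3 (2 * 0)) ⊓
      LinearMap.ker (addDual 1) ≤ skewFn (-1) (HasSum3 (2 * 0)))
    rw [finrank_alt, incr_neg (by norm_num)] at h
    omega
  · have h := finrank_ker_addDual isSignRule_neg_one (2 * i + 1)
    rw [finrank_alt, finrank_alt] at h
    have h1 := incr_diff (i + 1)
    have h2 := incr_shift_three (i + 1)
    have h3 := incr_shift_four (i + 1)
    push_cast at h h1 h2 h3
    rw [show (2 * (i : ℤ) + 1 - 3) = 2 * (i + 1) - 4 by ring,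
      show (2 * (i : ℤ) + 1 + 1 - 3) = 2 * (i + 1) - 3 by ring] at h
    rw [show 2 * (i + 1) = 2 * i + 1 + 1 by ring]
    omega

/-! ### Closed formulas for the Betti numbers -/

/-- The dimension of the homology of Hodge degree `k` in defect zero. -/
def bettiZero (k : ℕ) : ℕ :=
  if k % 4 = 3 then (k / 4 + 1) / 3 + 1 else if k % 4 = 2 then k / 4 / 3 else 0

/-- The dimension of the homology of Hodge degree `k` in defect one. -/
def bettiOne (k : ℕ) : ℕ :=
  if k % 4 = 1 then k / 4 / 3 + 1 else if k % 4 = 0 then (k / 4 - 1) / 3 else 0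

theorem cases_mod_four (k : ℕ) :
    ∃ j, k = 4 * j ∨ k = 4 * j + 1 ∨ k = 4 * j + 2 ∨ k = 4 * j + 3 := ⟨k / 4, by omega⟩

theorem finrank_kerFn {k : ℕ} (hk : 0 < k) : Module.finrank ℚ (kerFn k) = bettiZero k := by
  unfold bettiZero
  obtain ⟨j, rfl | rfl | rfl | rfl⟩ := cases_mod_four k
  · rw [kerFn_zero (by omega), finrank_bot, if_neg (by omega), if_neg (by omega)]
  · rw [kerFn_one, finrank_bot, if_neg (by omega), if_neg (by omega)]
  · rw [finrank_kerFn_two, if_neg (by omega), if_pos (by omega)]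
    omega
  · rw [finrank_kerFn_three, if_pos (by omega)]
    omega

theorem finrank_homology_of_chains_eq_bot {m N i k : ℕ} (h : chains m N i k = ⊥) :
    Module.finrank ℚ (Homology m N i k) = 0 := by
  have h' : cycles m N i k = ⊥ := by rw [cycles, h, bot_inf_eq]
  have : Subsingleton (cycles m N i k) := by rw [h']; infer_instance
  exact Module.finrank_zero_of_subsingleton

theorem finrank_homology_zero_eq {m N : ℕ} (hm : Even m) (hN : Odd N) (k : ℕ) :
    Module.finrank ℚ (Homology m N 0 k) = bettiZero k := by
  obtain _ | d := k
  · exact finrank_homology_of_chains_eq_bot (chains_eq_bot m N (by omega))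
  · rw [finrank_homology_zero hm hN, finrank_kerFn (Nat.succ_pos d)]

/-- The relation of `finrank_homology_one` is solved in each residue class of the Hodge degree
modulo four, with the counts of sorted triples inserted. -/
theorem finrank_homology_one_eq {m N : ℕ} (hm : Even m) (hN : Odd N) (k : ℕ) :
    Module.finrank ℚ (Homology m N 1 k) = bettiOne k := by
  obtain _ | d := k
  · exact finrank_homology_of_chains_eq_bot (chains_eq_bot m N (by omega))
  have h := finrank_homology_one hm hN d
  rw [(chains_zero hm hN (k := d + 1) (Nat.succ_pos d)).2, (chains_one hm hN d).2,
    finrank_homology_zero_eq hm hN] at h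
  -- Hodge degree one is separate: there are no chains of defect two.
  obtain _ | d := d
  · rw [chains_eq_bot m N (by omega), finrank_bot] at h
    have h0 : (Module.finrank ℚ (skewFn koszul (HasSum3 0)) : ℤ) =
      (incr 0).ncard + (halfIncr (-2)).ncard := hasSum3_zero 0
    have h1 : (Module.finrank ℚ (skewFn koszul (EvenTri (0 + 1))) : ℤ) = (incr (-4)).ncard :=
      evenTri_one 0
    have h2 := incr_small.1
    rw [incr_neg (by norm_num)] at h1
    rw [halfIncr_neg (by norm_num)] at h0
    have e0 : bettiZero (0 + 1) = 0 := rfl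
    have e1 : bettiOne (0 + 1) = 1 := rfl
    omega
  · rw [(chains_two hm hN d).2] at h
    unfold bettiZero at h
    unfold bettiOne
    obtain ⟨i, rfl | rfl | rfl | rfl⟩ := cases_mod_four d
    · rw [show 4 * i + 1 + 1 = 4 * i + 2 by ring] at h ⊢
      have h0 := evenTri_zero i
      have h1 := hasSum3_one i
      have h2 := evenTri_two i
      have h3 := halfIncr_even i
      have h4 := incr_diff i
      rw [if_neg (by omega), if_pos (by omega)] at h
      rw [if_neg (by omega), if_neg (by omega)]
      have h5 := incr_shift_four i
      omega
    · rw [show 4 * i + 1 + 1 = 4 * i + 2 by ring, show 4 * i + 2 + 1 = 4 * i + 3 by ring] at h ⊢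
      have h0 := evenTri_one i
      have h1 := hasSum3_two i
      have h2 := evenTri_three i
      have h3 := halfIncr_even i
      have h4 := halfIncr_odd i
      have h5 := incr_diff i
      rw [if_pos (by omega)] at h
      rw [if_neg (by omega), if_neg (by omega)]
      have h6 := incr_shift_four i
      omega
    · rw [show 4 * i + 2 + 1 = 4 * i + 3 by ring] at h ⊢
      have h0 := evenTri_two i
      have h1 := hasSum3_three i
      have h2 := evenTri_zero (i + 1)
      have h3 := halfIncr_even i
      have h4 := halfIncr_odd i
      have h5 := incr_diff (i + 1)
      have h6 := incr_shift_five (i + 1)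
      rw [if_neg (by omega), if_neg (by omega)] at h
      rw [if_neg (by omega), if_pos (by omega)]
      push_cast at h2 h5 h6
      rw [show (2 * ((i : ℤ) + 1) - 5) = 2 * i - 3 by ring] at h6
      rw [show 4 * (i + 1) = 4 * i + 3 + 1 by ring] at h2
      omega
    · have h0 := evenTri_three i
      have h1 := hasSum3_zero (i + 1)
      have h2 := evenTri_one (i + 1)
      have h3 := halfIncr_even i
      have h4 := halfIncr_odd i
      have h5 := incr_diff (i + 1)
      have h6 := incr_shift_four (i + 1)
      rw [if_neg (by omega), if_neg (by omega)] at h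
      rw [if_pos (by omega)]
      push_cast at h1 h2 h5 h6
      rw [show (2 * ((i : ℤ) + 1) - 2) = 2 * i by ring,
        show 4 * (i + 1) = 4 * i + 3 + 1 by ring] at h1
      rw [show 4 * (i + 1) + 1 = 4 * i + 3 + 1 + 1 by ring] at h2
      omega

/-! ### Generating functions -/

theorem eulerChar_eq {m N : ℕ} (hm : Even m) (hN : Odd N) (k : ℕ) :
    eulerChar m N k = (-1) ^ k * ((bettiZero k : ℤ) - bettiOne k) := by
  have hs : ∀ i, ((chainDegree m N i k).negOnePow : ℤ) = (-1) ^ k * (-1) ^ i := by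
    intro i
    have h : (chainDegree m N i k).negOnePow = ((k + i : ℕ) : ℤ).negOnePow := by
      rw [Int.negOnePow_eq_iff]
      obtain ⟨a, rfl⟩ := hm
      obtain ⟨b, rfl⟩ := hN
      -- Half the difference of `chainDegree` and `k + i`, for `m = a + a` and `N = 2 * b + 1`.
      refine ⟨k * (b - a - 1) + b - 1, ?_⟩
      rw [chainDegree]
      push_cast
      ring
    rw [h, Int.negOnePow_def, zpow_natCast, pow_add]
    push_cast
    rfl
  simp only [eulerChar, Finset.sum_range_succ, Finset.sum_range_zero, hs]
  obtain _ | d := k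
  · rw [chains_eq_bot m N (by omega), chains_eq_bot m N (by omega), chains_eq_bot m N (by omega),
      finrank_bot]
    rfl
  · have h := finrank_homology_one hm hN d
    rw [finrank_homology_zero_eq hm hN, finrank_homology_one_eq hm hN] at h
    zify at h
    linear_combination (-1) ^ (d + 1) * h

/-- The recurrence with characteristic polynomial `(1 - X ^ 4) * (1 - X ^ 12)`, the denominator of
the series. -/
theorem bettiZero_rec (k : ℕ) :
    bettiZero (k + 16) + bettiZero k = bettiZero (k + 12) + bettiZero (k + 4) := by
  unfold bettiZero
  obtain ⟨j, rfl | rfl | rfl | rfl⟩ := cases_mod_four k <;> split_ifs <;> omega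

/-- It fails at `k = 0`, which accounts for the term `X ^ 16` in the numerator. -/
theorem bettiOne_rec (k : ℕ) (hk : 0 < k) :
    bettiOne (k + 16) + bettiOne k = bettiOne (k + 12) + bettiOne (k + 4) := by
  unfold bettiOne
  obtain ⟨j, rfl | rfl | rfl | rfl⟩ := cases_mod_four k <;> split_ifs <;> omega

theorem bettiOne_rec' (k : ℕ) : (bettiOne (k + 17) : ℚ) =
    bettiOne (k + 13) + bettiOne (k + 5) - bettiOne (k + 1) := by
  have h := bettiOne_rec (k + 1) (Nat.succ_pos k)
  have h' : (bettiOne (k + 17) : ℚ) + bettiOne (k + 1) = bettiOne (k + 13) + bettiOne (k + 5) := by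
    exact_mod_cast h
  linarith

theorem homologySeries_zero {m N : ℕ} (hm : Even m) (hN : Odd N) : homologySeries m N 0 =
    (PowerSeries.X ^ 3 + PowerSeries.X ^ 11 + PowerSeries.X ^ 14 - PowerSeries.X ^ 15) *
      ((1 - PowerSeries.X ^ 4) * (1 - PowerSeries.X ^ 12))⁻¹ := by
  rw [PowerSeries.eq_mul_inv_iff_mul_eq (by simp), homologySeries]
  simp only [finrank_homology_zero_eq hm hN]
  have e : ((1 - PowerSeries.X ^ 4) * (1 - PowerSeries.X ^ 12) : ℚ⟦X⟧) =
      1 - PowerSeries.X ^ 4 - PowerSeries.X ^ 12 + PowerSeries.X ^ 16 := by ring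
  rw [e]
  ext n
  simp only [mul_add, mul_sub, mul_one, map_add, map_sub, PowerSeries.coeff_mul_X_pow',
    PowerSeries.coeff_X_pow, PowerSeries.coeff_mk]
  -- The numerator has degree `15`; from degree `16` on the claim is the recurrence.
  by_cases hn : n < 16
  · interval_cases n <;> norm_num [bettiZero]
  · obtain ⟨k, rfl⟩ := Nat.exists_eq_add_of_le' (not_lt.1 hn)
    have h : (bettiZero (k + 16) : ℚ) + bettiZero k = bettiZero (k + 12) + bettiZero (k + 4) := by
      exact_mod_cast bettiZero_rec k
    rw [if_pos (by omega), if_pos (by omega), if_pos (by omega), if_neg (by omega),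
      if_neg (by omega), if_neg (by omega), if_neg (by omega), show k + 16 - 4 = k + 12 by omega,
      show k + 16 - 12 = k + 4 by omega, Nat.add_sub_cancel]
    linarith

theorem homologySeries_one {m N : ℕ} (hm : Even m) (hN : Odd N) : homologySeries m N 1 =
    (PowerSeries.X + PowerSeries.X ^ 16) *
      ((1 - PowerSeries.X ^ 4) * (1 - PowerSeries.X ^ 12))⁻¹ := by
  rw [PowerSeries.eq_mul_inv_iff_mul_eq (by simp), homologySeries]
  simp only [finrank_homology_one_eq hm hN]
  have e : ((1 - PowerSeries.X ^ 4) * (1 - PowerSeries.X ^ 12) : ℚ⟦X⟧) =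
      1 - PowerSeries.X ^ 4 - PowerSeries.X ^ 12 + PowerSeries.X ^ 16 := by ring
  rw [e]
  ext n
  simp only [mul_add, mul_sub, mul_one, map_add, map_sub, PowerSeries.coeff_mul_X_pow',
    PowerSeries.coeff_X_pow, PowerSeries.coeff_X, PowerSeries.coeff_mk]
  by_cases hn : n < 17
  · interval_cases n <;> norm_num [bettiOne]
  · obtain ⟨k, rfl⟩ := Nat.exists_eq_add_of_le' (not_lt.1 hn)
    have h := bettiOne_rec' k
    rw [if_pos (by omega), if_pos (by omega), if_pos (by omega), if_neg (by omega),
      if_neg (by omega), show k + 17 - 4 = k + 13 by omega, show k + 17 - 12 = k + 5 by omega,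
      show k + 17 - 16 = k + 1 by omega]
    linarith

/-- The recurrence given by `(1 + X ^ 2) * (1 - X ^ 12)`. Its shifts are even, so the signs `(-1) ^
k` of the Euler characteristics factor out. -/
theorem betti_alternating (k : ℕ) : ((bettiZero (k + 15) : ℤ) - bettiOne (k + 15)) -
      ((bettiZero (k + 1) : ℤ) - bettiOne (k + 1)) =
    ((bettiZero (k + 3) : ℤ) - bettiOne (k + 3)) -
      ((bettiZero (k + 13) : ℤ) - bettiOne (k + 13)) := by
  have z0 : ∀ j, bettiZero (4 * j) = 0 := fun j => by unfold bettiZero; split_ifs <;> omega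
  have z1 : ∀ j, bettiZero (4 * j + 1) = 0 := fun j => by unfold bettiZero; split_ifs <;> omega
  have z2 : ∀ j, bettiZero (4 * j + 2) = j / 3 := fun j => by unfold bettiZero; split_ifs <;> omega
  have z3 : ∀ j, bettiZero (4 * j + 3) = (j + 1) / 3 + 1 := fun j => by
    unfold bettiZero; split_ifs <;> omega
  have o0 : ∀ j, bettiOne (4 * j) = (j - 1) / 3 := fun j => by unfold bettiOne; split_ifs <;> omega
  have o1 : ∀ j, bettiOne (4 * j + 1) = j / 3 + 1 := fun j => by
    unfold bettiOne; split_ifs <;> omega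
  have o2 : ∀ j, bettiOne (4 * j + 2) = 0 := fun j => by unfold bettiOne; split_ifs <;> omega
  have o3 : ∀ j, bettiOne (4 * j + 3) = 0 := fun j => by unfold bettiOne; split_ifs <;> omega
  obtain ⟨j, rfl | rfl | rfl | rfl⟩ := cases_mod_four k
  · rw [show 4 * j + 15 = 4 * (j + 3) + 3 by ring, show 4 * j + 13 = 4 * (j + 3) + 1 by ring, z3, o3,
      z1, o1, z3, o3, z1, o1]
    omega
  · rw [show 4 * j + 1 + 15 = 4 * (j + 4) by ring, show 4 * j + 1 + 13 = 4 * (j + 3) + 2 by ring,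
      show 4 * j + 1 + 1 = 4 * j + 2 by ring, show 4 * j + 1 + 3 = 4 * (j + 1) by ring, z0, o0,
      z2, o2, z0, o0, z2, o2]
    omega
  · rw [show 4 * j + 2 + 15 = 4 * (j + 4) + 1 by ring, show 4 * j + 2 + 13 = 4 * (j + 3) + 3 by ring,
      show 4 * j + 2 + 1 = 4 * j + 3 by ring, show 4 * j + 2 + 3 = 4 * (j + 1) + 1 by ring, z1, o1,
      z3, o3, z1, o1, z3, o3]
    omega
  · rw [show 4 * j + 3 + 15 = 4 * (j + 4) + 2 by ring, show 4 * j + 3 + 13 = 4 * (j + 4) by ring,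
      show 4 * j + 3 + 1 = 4 * (j + 1) by ring, show 4 * j + 3 + 3 = 4 * (j + 1) + 2 by ring, z2, o2,
      z0, o0, z2, o2, z0, o0]
    omega

theorem eulerSeries_eq {m N : ℕ} (hm : Even m) (hN : Odd N) : eulerSeries m N =
    (PowerSeries.X - PowerSeries.X ^ 11 - PowerSeries.X ^ 13 + PowerSeries.X ^ 14) *
      ((1 + PowerSeries.X ^ 2) * (1 - PowerSeries.X ^ 12))⁻¹ := by
  rw [PowerSeries.eq_mul_inv_iff_mul_eq (by simp), eulerSeries]
  simp only [eulerChar_eq hm hN]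
  have e : ((1 + PowerSeries.X ^ 2) * (1 - PowerSeries.X ^ 12) : ℚ⟦X⟧) =
      1 + PowerSeries.X ^ 2 - PowerSeries.X ^ 12 - PowerSeries.X ^ 14 := by ring
  rw [e]
  ext n
  simp only [mul_add, mul_sub, mul_one, map_add, map_sub, PowerSeries.coeff_mul_X_pow',
    PowerSeries.coeff_X_pow, PowerSeries.coeff_X, PowerSeries.coeff_mk]
  by_cases hn : n < 15
  · interval_cases n <;> norm_num [bettiZero, bettiOne]
  · obtain ⟨k, rfl⟩ := Nat.exists_eq_add_of_le' (not_lt.1 hn)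
    have h : ((bettiZero (k + 15) : ℚ) - bettiOne (k + 15)) -
        ((bettiZero (k + 1) : ℚ) - bettiOne (k + 1)) =
        ((bettiZero (k + 3) : ℚ) - bettiOne (k + 3)) -
        ((bettiZero (k + 13) : ℚ) - bettiOne (k + 13)) := by
      exact_mod_cast betti_alternating k
    rw [if_pos (by omega), if_pos (by omega), if_pos (by omega), if_neg (by omega),
      if_neg (by omega), if_neg (by omega), if_neg (by omega), show k + 15 - 2 = k + 13 by omega,
      show k + 15 - 12 = k + 3 by omega, show k + 15 - 14 = k + 1 by omega]
    push_cast
    linear_combination (-(-1) ^ k) * h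

end HairyGraph

end

theorem mainTheorem3 (m N : ℕ) (hm : Even m) (hN : Odd N) :
    (∀ i k : ℕ, Module.Finite ℚ (HairyGraph.chains m N i k)) ∧
    (∀ i k : ℕ, HairyGraph.boundaries m N i k ≤ HairyGraph.cycles m N i k) ∧
    HairyGraph.homologySeries m N 0 =
      (PowerSeries.X ^ 3 + PowerSeries.X ^ 11 + PowerSeries.X ^ 14 - PowerSeries.X ^ 15) *
        ((1 - PowerSeries.X ^ 4) * (1 - PowerSeries.X ^ 12))⁻¹ ∧
    HairyGraph.homologySeries m N 1 =
      (PowerSeries.X + PowerSeries.X ^ 16) *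
        ((1 - PowerSeries.X ^ 4) * (1 - PowerSeries.X ^ 12))⁻¹ ∧
    HairyGraph.eulerSeries m N =
      (PowerSeries.X - PowerSeries.X ^ 11 - PowerSeries.X ^ 13 + PowerSeries.X ^ 14) *
        ((1 + PowerSeries.X ^ 2) * (1 - PowerSeries.X ^ 12))⁻¹ := by
  exact ⟨HairyGraph.finite_chains hm hN, HairyGraph.boundaries_le_cycles hm hN,
    HairyGraph.homologySeries_zero hm hN, HairyGraph.homologySeries_one hm hN,
    HairyGraph.eulerSeries_eq hm hN⟩
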